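/- Let $\mathbb{K}$ be an algebraically closed field of characteristic $p>2$ and let $n>2$. Let $$\mathfrak{g}=\mathfrak{p}(n)=\left\{\begin{pmatrix}A&B\\C&-A^{t}\end{pmatrix}\;:\;\operatorname{tr}A=0,\ B^t=B,\ C^t=-C\right\}$$ ($n\times n$ blocks over $\mathbb{K}$) be the periplectic Lie superalgebra, with even part $\mathfrak{g}_{\bar 0}=\{B=C=0\}\cong\mathfrak{sl}(n)$, $\mathfrak{g}_{+1}=\{A=C=0\}$, and with $p$-map $x^{[p]}=x^p$ (matrix power) on $\mathfrak{g}_{\bar 0}$. Let $\mathfrak{h}$, $\mathfrak{n}_0$ and $\mathfrak{b}_0=\mathfrak{h}\oplus\mathfrak{n}_0$ be the subalgebras of $\mathfrak{g}_{\bar 0}$ for which $A$ is diagonal, strictly upper triangular and upper triangular, respectively. For a graded subalgebra $\mathfrak{a}\subseteq\mathfrak{g}$ with $\mathfrak{a}_{\bar 0}$ closed under the $p$-map and $\chi\in\mathfrak{g}_{\bar 0}^*$, let $U_\chi(\mathfrak{a})$ be the quotient of the enveloping superalgebra $U(\mathfrak{a})$ by the two-sided ideal generated by all $x^p-x^{[p]}-\chi(x)^p$,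 $x\in\mathfrak{a}_{\bar 0}$. Call $\chi\in\mathfrak{g}_{\bar 0}^*$ regular nilpotent if there is $g\in GL(n)$ such that $(g\cdot\chi)(\mathfrak{h}\oplus\mathfrak{n}_0)=0$ and $(g\cdot\chi)(X_{-\alpha})\neq 0$ for every simple root $\alpha=\epsilon_i-\epsilon_{i+1}$, $1\le i<n$, where $X_{-\alpha}=E_{i+1,i}-E_{n+i,n+i+1}$ and $GL(n)$ acts on $\mathfrak{g}_{\bar 0}$ by $A\mapsto gAg^{-1}$ and on $\mathfrak{g}_{\bar 0}^*$ by the dual action. Set $$\Lambda_\chi=\{\lambda\in\mathfrak{h}^*:\lambda(h)^p-\lambda(h^{[p]})=\chi(h)^p\ \text{ for all } h\in\mathfrak{h}\}.$$ If $\chi(\mathfrak{n}_0)=0$ and $\lambda\in\Lambda_\chi$, let $\mathbb{K}_\lambda$ be the one-dimensional $U_\chi(\mathfrak{b}_0)$-module on which $\mathfrak{h}$ acts by $\lambda$ and $\mathfrak{n}_0$ by $0$, let $Z^0_\chi(\lambda)=U_\chi(\mathfrak{g}_{\bar 0})\otimes_{U_\chi(\mathfrak{b}_0)}\mathbb{K}_\lambda$,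 let $L^0_\chi(\lambda)$ be the quotient of $Z^0_\chi(\lambda)$ by the intersection of its maximal submodules (this is its simple quotient when it has a unique maximal submodule), regarded as a $U_\chi(\mathfrak{g}_{\bar 0}\oplus\mathfrak{g}_{+1})$-module with $\mathfrak{g}_{+1}$ acting by $0$, and define the Kac module $$K_\chi(\lambda)=U_\chi(\mathfrak{g})\otimes_{U_\chi(\mathfrak{g}_{\bar 0}\oplus\mathfrak{g}_{+1})}L^0_\chi(\lambda).$$ **Proposition.** Let $\chi\in\mathfrak{g}_{\bar 0}^*$ be regular nilpotent with $\chi(\mathfrak{n}_0)=0$, let $\lambda\in\Lambda_\chi$, and suppose $p\geq n+1$. Then $K_\chi(\lambda)$ is an irreducible $U(\mathfrak{g})$-module. -/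

import Mathlib

open Matrix TensorProduct

noncomputable section

universe u v w

/-- A restricted Lie superalgebra realised by operators: an even space and an odd space of elements
of an associative algebra `A` over `K`, closed under the supercommutator
(`x y - y x` if `x` or `y` is even, `x y + y x` if both are odd) and with even part closed under
the `p`-th power map `x ↦ x ^ p`, which plays the role of `x ↦ x^{[p]}`.
The Lie superalgebra is the (external) direct sum `even ⊕ odd`. -/
structure RestrictedLieSuper (K : Type u) (p : ℕ) (A : Type v) [Field K] [Ring A] [Algebra K A] where
  even : Submodule K A
  odd : Submodule K A
  even_even : ∀ x ∈ even, ∀ y ∈ even, x * y - y * x ∈ even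
  even_odd : ∀ x ∈ even, ∀ y ∈ odd, x * y - y * x ∈ odd
  odd_odd : ∀ x ∈ odd, ∀ y ∈ odd, x * y + y * x ∈ even
  pow_mem : ∀ x ∈ even, x ^ p ∈ even

namespace RestrictedLieSuper

section Enveloping

variable {K : Type u} {p : ℕ} {A : Type v} [Field K] [Ring A] [Algebra K A]

/-- The bracket of two even elements. -/
def br00 (L : RestrictedLieSuper K p A) (x y : L.even) : L.even :=
  ⟨x.1 * y.1 - y.1 * x.1, L.even_even _ x.2 _ y.2⟩

/-- The bracket of an even and an odd element. -/
def br01 (L : RestrictedLieSuper K p A) (x : L.even) (y : L.odd) : L.odd :=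
  ⟨x.1 * y.1 - y.1 * x.1, L.even_odd _ x.2 _ y.2⟩

/-- The bracket of two odd elements. -/
def br11 (L : RestrictedLieSuper K p A) (x y : L.odd) : L.even :=
  ⟨x.1 * y.1 + y.1 * x.1, L.odd_odd _ x.2 _ y.2⟩

/-- The `p`-map on the even part. -/
def pmap (L : RestrictedLieSuper K p A) (x : L.even) : L.even :=
  ⟨x.1 ^ p, L.pow_mem _ x.2⟩

/-- `L ≤ L'`: `L` is a (graded, restricted) subalgebra of `L'`. -/
instance : LE (RestrictedLieSuper K p A) := ⟨fun L L' => L.even ≤ L'.even ∧ L.odd ≤ L'.odd⟩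

/-- An even element as a generator of the tensor algebra of `even ⊕ odd`. -/
def tEven (L : RestrictedLieSuper K p A) (x : L.even) : TensorAlgebra K (L.even × L.odd) :=
  TensorAlgebra.ι K (x, 0)

/-- An odd element as a generator of the tensor algebra of `even ⊕ odd`. -/
def tOdd (L : RestrictedLieSuper K p A) (y : L.odd) : TensorAlgebra K (L.even × L.odd) :=
  TensorAlgebra.ι K (0, y)

/-- The defining relations `a b - (-1)^{|a||b|} b a = [a, b]` of the universal enveloping
superalgebra. -/
inductive EnvRel (L : RestrictedLieSuper K p A) :
    TensorAlgebra K (L.even × L.odd) → TensorAlgebra K (L.even × L.odd) → Prop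
  | even_even (x y : L.even) :
      EnvRel L (L.tEven x * L.tEven y - L.tEven y * L.tEven x) (L.tEven (L.br00 x y))
  | even_odd (x : L.even) (y : L.odd) :
      EnvRel L (L.tEven x * L.tOdd y - L.tOdd y * L.tEven x) (L.tOdd (L.br01 x y))
  | odd_odd (x y : L.odd) :
      EnvRel L (L.tOdd x * L.tOdd y + L.tOdd y * L.tOdd x) (L.tEven (L.br11 x y))

/-- The universal enveloping superalgebra `U(L)`. -/
def U (L : RestrictedLieSuper K p A) : Type (max u v) := RingQuot (EnvRel L)

instance (L : RestrictedLieSuper K p A) : Ring L.U := inferInstanceAs (Ring (RingQuot (EnvRel L)))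

instance (L : RestrictedLieSuper K p A) : Algebra K L.U :=
  inferInstanceAs (Algebra K (RingQuot (EnvRel L)))

/-- The quotient map from the tensor algebra onto `U(L)`. -/
def toU (L : RestrictedLieSuper K p A) : TensorAlgebra K (L.even × L.odd) →ₐ[K] L.U :=
  RingQuot.mkAlgHom K (EnvRel L)

/-- The relations `x ^ p - x^{[p]} = χ(x) ^ p`, for `x` even. -/
inductive RedRel (L : RestrictedLieSuper K p A) (χ : Module.Dual K L.even) : L.U → L.U → Prop
  | pow (x : L.even) :
      RedRel L χ (L.toU (L.tEven x) ^ p - L.toU (L.tEven (L.pmap x)))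
        (algebraMap K L.U (χ x ^ p))

/-- The reduced enveloping algebra `U_χ(L)`: the quotient of `U(L)` by the two-sided ideal
generated by the elements `x ^ p - x^{[p]} - χ(x) ^ p`, for `x` even. -/
def UChi (L : RestrictedLieSuper K p A) (χ : Module.Dual K L.even) : Type (max u v) :=
  RingQuot (RedRel L χ)

instance (L : RestrictedLieSuper K p A) (χ : Module.Dual K L.even) : Ring (L.UChi χ) :=
  inferInstanceAs (Ring (RingQuot (RedRel L χ)))

instance (L : RestrictedLieSuper K p A) (χ : Module.Dual K L.even) : Algebra K (L.UChi χ) :=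
  inferInstanceAs (Algebra K (RingQuot (RedRel L χ)))

/-- The quotient map `U(L) → U_χ(L)`. -/
def toUChi (L : RestrictedLieSuper K p A) (χ : Module.Dual K L.even) : L.U →ₐ[K] L.UChi χ :=
  RingQuot.mkAlgHom K (RedRel L χ)

/-- The linear map from the even part to `U_χ(L)`. -/
def ιEven (L : RestrictedLieSuper K p A) (χ : Module.Dual K L.even) : L.even →ₗ[K] L.UChi χ :=
  (L.toUChi χ).toLinearMap ∘ₗ L.toU.toLinearMap ∘ₗ TensorAlgebra.ι K ∘ₗ
    LinearMap.inl K L.even L.odd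

/-- The linear map from the odd part to `U_χ(L)`. -/
def ιOdd (L : RestrictedLieSuper K p A) (χ : Module.Dual K L.even) : L.odd →ₗ[K] L.UChi χ :=
  (L.toUChi χ).toLinearMap ∘ₗ L.toU.toLinearMap ∘ₗ TensorAlgebra.ι K ∘ₗ
    LinearMap.inr K L.even L.odd

lemma ιEven_apply (L : RestrictedLieSuper K p A) (χ : Module.Dual K L.even) (x : L.even) :
    L.ιEven χ x = L.toUChi χ (L.toU (L.tEven x)) := rfl

lemma ιOdd_apply (L : RestrictedLieSuper K p A) (χ : Module.Dual K L.even) (x : L.odd) :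
    L.ιOdd χ x = L.toUChi χ (L.toU (L.tOdd x)) := rfl

lemma ιEven_br00 (L : RestrictedLieSuper K p A) (χ : Module.Dual K L.even) (x y : L.even) :
    L.ιEven χ x * L.ιEven χ y - L.ιEven χ y * L.ιEven χ x = L.ιEven χ (L.br00 x y) := by
  have h : L.toU _ = L.toU _ := RingQuot.mkAlgHom_rel K (EnvRel.even_even (L := L) x y)
  simpa [ιEven_apply] using congrArg (L.toUChi χ) h

lemma ιEven_br01 (L : RestrictedLieSuper K p A) (χ : Module.Dual K L.even) (x : L.even)
    (y : L.odd) :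
    L.ιEven χ x * L.ιOdd χ y - L.ιOdd χ y * L.ιEven χ x = L.ιOdd χ (L.br01 x y) := by
  have h : L.toU _ = L.toU _ := RingQuot.mkAlgHom_rel K (EnvRel.even_odd (L := L) x y)
  simpa [ιEven_apply, ιOdd_apply] using congrArg (L.toUChi χ) h

lemma ιOdd_br11 (L : RestrictedLieSuper K p A) (χ : Module.Dual K L.even) (x y : L.odd) :
    L.ιOdd χ x * L.ιOdd χ y + L.ιOdd χ y * L.ιOdd χ x = L.ιEven χ (L.br11 x y) := by
  have h : L.toU _ = L.toU _ := RingQuot.mkAlgHom_rel K (EnvRel.odd_odd (L := L) x y)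
  simpa [ιEven_apply, ιOdd_apply] using congrArg (L.toUChi χ) h

lemma ιEven_pow (L : RestrictedLieSuper K p A) (χ : Module.Dual K L.even) (x : L.even) :
    L.ιEven χ x ^ p - L.ιEven χ (L.pmap x) = algebraMap K (L.UChi χ) (χ x ^ p) := by
  have h : L.toUChi χ _ = L.toUChi χ _ := RingQuot.mkAlgHom_rel K (RedRel.pow (L := L) (χ := χ) x)
  rw [AlgHom.commutes] at h
  simpa [ιEven_apply] using h

variable {B : Type w} [Ring B] [Algebra K B]

/-- The universal property of `U(L)`. -/
def liftU (L : RestrictedLieSuper K p A) (f : L.even →ₗ[K] B) (g : L.odd →ₗ[K] B)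
    (h00 : ∀ x y, f x * f y - f y * f x = f (L.br00 x y))
    (h01 : ∀ x y, f x * g y - g y * f x = g (L.br01 x y))
    (h11 : ∀ x y, g x * g y + g y * g x = f (L.br11 x y)) : L.U →ₐ[K] B :=
  RingQuot.liftAlgHom K ⟨TensorAlgebra.lift K (f.coprod g), by
    intro a b h
    cases h with
    | even_even x y => simpa [tEven] using h00 x y
    | even_odd x y => simpa [tEven, tOdd] using h01 x y
    | odd_odd x y => simpa [tEven, tOdd] using h11 x y⟩

lemma liftU_tEven (L : RestrictedLieSuper K p A) (f : L.even →ₗ[K] B) (g : L.odd →ₗ[K] B)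
    (h00 h01 h11) (x : L.even) : L.liftU f g h00 h01 h11 (L.toU (L.tEven x)) = f x := by
  have h := RingQuot.liftAlgHom_mkAlgHom_apply K (TensorAlgebra.lift K (f.coprod g))
    (s := EnvRel L) (by
      intro a b h
      cases h with
      | even_even x y => simpa [tEven] using h00 x y
      | even_odd x y => simpa [tEven, tOdd] using h01 x y
      | odd_odd x y => simpa [tEven, tOdd] using h11 x y) (L.tEven x)
  refine h.trans ?_
  simp [tEven]

/-- The universal property of `U_χ(L)`. -/
def liftUChi (L : RestrictedLieSuper K p A) (χ : Module.Dual K L.even)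
    (f : L.even →ₗ[K] B) (g : L.odd →ₗ[K] B)
    (h00 : ∀ x y, f x * f y - f y * f x = f (L.br00 x y))
    (h01 : ∀ x y, f x * g y - g y * f x = g (L.br01 x y))
    (h11 : ∀ x y, g x * g y + g y * g x = f (L.br11 x y))
    (hp : ∀ x, f x ^ p - f (L.pmap x) = algebraMap K B (χ x ^ p)) : L.UChi χ →ₐ[K] B :=
  RingQuot.liftAlgHom K ⟨L.liftU f g h00 h01 h11, by
    intro a b h
    cases h with
    | pow x =>
      rw [map_sub, map_pow, liftU_tEven, liftU_tEven, AlgHom.commutes]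
      exact hp x⟩

/-- The restriction of a linear form on the even part to a subalgebra. -/
def resDual {L L' : RestrictedLieSuper K p A} (h : L ≤ L') (χ : Module.Dual K L'.even) :
    Module.Dual K L.even :=
  χ ∘ₗ Submodule.inclusion h.1

/-- The algebra map `U_χ(L) → U_χ(L')` induced by the inclusion of a subalgebra `L ≤ L'`. -/
def incl {L L' : RestrictedLieSuper K p A} (h : L ≤ L') (χ : Module.Dual K L'.even) :
    L.UChi (resDual h χ) →ₐ[K] L'.UChi χ :=
  L.liftUChi (resDual h χ) (L'.ιEven χ ∘ₗ Submodule.inclusion h.1)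
    (L'.ιOdd χ ∘ₗ Submodule.inclusion h.2)
    (fun x y => L'.ιEven_br00 χ (Submodule.inclusion h.1 x) (Submodule.inclusion h.1 y))
    (fun x y => L'.ιEven_br01 χ (Submodule.inclusion h.1 x) (Submodule.inclusion h.2 y))
    (fun x y => L'.ιOdd_br11 χ (Submodule.inclusion h.2 x) (Submodule.inclusion h.2 y))
    (fun x => L'.ιEven_pow χ (Submodule.inclusion h.1 x))

end Enveloping

end RestrictedLieSuper

section Induction

variable {K : Type u} [Field K] {A : Type v} {B : Type w} [Ring A] [Ring B] [Algebra K A]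
  [Algebra K B] {M : Type*} [AddCommGroup M] [Module K M]

/-- The `B`-submodule of `B ⊗[K] M` generated by the elements `b φ(a) ⊗ m - b ⊗ a m`. -/
def indRel (φ : A →ₐ[K] B) (r : A →ₐ[K] Module.End K M) : Submodule B (B ⊗[K] M) :=
  Submodule.span B {t | ∃ (b : B) (a : A) (m : M), t = (b * φ a) ⊗ₜ[K] m - b ⊗ₜ[K] (r a m)}

/-- The induced module `B ⊗_A M`, for an algebra map `φ : A → B` and a representation `r` of `A`
on `M`. -/
abbrev Ind (φ : A →ₐ[K] B) (r : A →ₐ[K] Module.End K M) : Type _ := (B ⊗[K] M) ⧸ indRel φ r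

end Induction

namespace Periplectic

section Matrices

variable (K : Type u) [Field K] (p n : ℕ)

/-- The `2n × 2n` matrices in `n × n` blocks. -/
abbrev Mat := Matrix (Fin n ⊕ Fin n) (Fin n ⊕ Fin n) K

/-- `A ↦ (A, 0; 0, -Aᵗ)`. -/
def diagBlock : Matrix (Fin n) (Fin n) K →ₗ[K] Mat K n where
  toFun A := fromBlocks A 0 0 (-Aᵀ)
  map_add' A B := by simp [fromBlocks_add, add_comm]
  map_smul' c A := by simp [fromBlocks_smul]

lemma diagBlock_apply (A : Matrix (Fin n) (Fin n) K) :
    diagBlock K n A = fromBlocks A 0 0 (-Aᵀ) := rfl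

/-- `(B, C) ↦ (0, B; C, 0)`. -/
def offBlock : Matrix (Fin n) (Fin n) K × Matrix (Fin n) (Fin n) K →ₗ[K] Mat K n where
  toFun B := fromBlocks 0 B.1 B.2 0
  map_add' A B := by simp [fromBlocks_add]
  map_smul' c A := by simp [fromBlocks_smul]

lemma offBlock_apply (B : Matrix (Fin n) (Fin n) K × Matrix (Fin n) (Fin n) K) :
    offBlock K n B = fromBlocks 0 B.1 B.2 0 := rfl

/-- Matrices of trace zero. -/
def slMat : Submodule K (Matrix (Fin n) (Fin n) K) where
  carrier := {A | A.trace = 0}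
  add_mem' {A B} hA hB := by simp_all
  zero_mem' := by simp
  smul_mem' c A hA := by simp_all

/-- Upper triangular matrices of trace zero. -/
def borelMat : Submodule K (Matrix (Fin n) (Fin n) K) where
  carrier := {A | A.trace = 0 ∧ ∀ i j, j < i → A i j = 0}
  add_mem' {A B} hA hB := ⟨by simp [hA.1, hB.1], fun i j h => by simp [hA.2 i j h, hB.2 i j h]⟩
  zero_mem' := by simp
  smul_mem' c A hA := ⟨by simp [hA.1], fun i j h => by simp [hA.2 i j h]⟩

/-- Diagonal matrices of trace zero. -/
def cartanMat : Submodule K (Matrix (Fin n) (Fin n) K) where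
  carrier := {A | A.trace = 0 ∧ ∀ i j, i ≠ j → A i j = 0}
  add_mem' {A B} hA hB := ⟨by simp [hA.1, hB.1], fun i j h => by simp [hA.2 i j h, hB.2 i j h]⟩
  zero_mem' := by simp
  smul_mem' c A hA := ⟨by simp [hA.1], fun i j h => by simp [hA.2 i j h]⟩

/-- Strictly upper triangular matrices. -/
def nilMat : Submodule K (Matrix (Fin n) (Fin n) K) where
  carrier := {A | ∀ i j, j ≤ i → A i j = 0}
  add_mem' {A B} hA hB := fun i j h => by simp [hA i j h, hB i j h]
  zero_mem' := by simp
  smul_mem' c A hA := fun i j h => by simp [hA i j h]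

/-- Pairs `(B, C)` with `B` symmetric and `C` skew-symmetric. (The condition that the diagonal of
`C` vanishes follows from `Cᵗ = -C` in characteristic other than two.) -/
def symSkew : Submodule K (Matrix (Fin n) (Fin n) K × Matrix (Fin n) (Fin n) K) where
  carrier := {B | B.1ᵀ = B.1 ∧ B.2ᵀ = -B.2 ∧ ∀ i, B.2 i i = 0}
  add_mem' {A B} hA hB := ⟨by simp [hA.1, hB.1], by simp [hA.2.1, hB.2.1, add_comm],
    fun i => by simp [hA.2.2, hB.2.2]⟩
  zero_mem' := by simp
  smul_mem' c A hA := ⟨by simp [hA.1], by simp [hA.2.1], fun i => by simp [hA.2.2]⟩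

/-- Pairs `(B, 0)` with `B` symmetric. -/
def symZero : Submodule K (Matrix (Fin n) (Fin n) K × Matrix (Fin n) (Fin n) K) where
  carrier := {B | B.1ᵀ = B.1 ∧ B.2 = 0}
  add_mem' {A B} hA hB := ⟨by simp [hA.1, hB.1], by simp [hA.2, hB.2]⟩
  zero_mem' := by simp
  smul_mem' c A hA := ⟨by simp [hA.1], by simp [hA.2]⟩

variable {K n}

lemma diagBlock_pow [Fact p.Prime] [CharP K p] (A : Matrix (Fin n) (Fin n) K) :
    diagBlock K n A ^ p = diagBlock K n (A ^ p) := by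
  have h : ∀ k : ℕ, diagBlock K n A ^ k = fromBlocks (A ^ k) 0 0 ((-Aᵀ) ^ k) := by
    intro k
    induction k with
    | zero => simp
    | succ k ih => rw [pow_succ, ih, pow_succ, pow_succ]; simp [diagBlock_apply, fromBlocks_multiply]
  rw [h]
  have h2 : (-Aᵀ) ^ p = -(A ^ p)ᵀ := by
    have := (Fact.out : p.Prime).eq_two_or_odd'
    rcases this with h2 | h2
    · subst h2
      have : CharP K 2 := inferInstance
      rw [transpose_pow, neg_sq]
      ext i j
      simp [CharTwo.neg_eq]
    · rw [h2.neg_pow, transpose_pow]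
  rw [h2]; rfl

lemma charpoly_pow_char [Fact p.Prime] [CharP K p] (M : Matrix (Fin n) (Fin n) K) :
    (M ^ p).charpoly = M.charpoly.map (frobenius K p) := by
  cases (isEmpty_or_nonempty (Fin n)).symm
  · have hp0 : 0 < p := (Fact.out : p.Prime).pos
    apply Polynomial.expand_injective hp0
    rw [← Polynomial.map_expand, Polynomial.map_frobenius_expand]
    unfold charpoly
    rw [AlgHom.map_det, ← coe_detMonoidHom,
      ← (detMonoidHom : Matrix (Fin n) (Fin n) (Polynomial K) →* Polynomial K).map_pow]
    apply congr_arg det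
    refine matPolyEquiv.injective ?_
    rw [map_pow, matPolyEquiv_charmatrix, sub_pow_char_of_commute, ← Polynomial.C_pow]
    · exact (id (matPolyEquiv_eq_X_pow_sub_C p M) :)
    · exact (Polynomial.C M).commute_X
  · simp [charpoly, Matrix.det_isEmpty]

lemma trace_pow_char [Fact p.Prime] [CharP K p] (M : Matrix (Fin n) (Fin n) K) :
    (M ^ p).trace = M.trace ^ p := by
  have hp0 : p ≠ 0 := (Fact.out : p.Prime).ne_zero
  cases isEmpty_or_nonempty (Fin n)
  · simp [Matrix.trace, hp0]
  rw [Matrix.trace_eq_neg_charpoly_coeff, Matrix.trace_eq_neg_charpoly_coeff,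
    charpoly_pow_char, Polynomial.coeff_map, ← frobenius_def, map_neg]

lemma upper_mul {A B : Matrix (Fin n) (Fin n) K} (hA : ∀ i j, j < i → A i j = 0)
    (hB : ∀ i j, j < i → B i j = 0) :
    (∀ i j, j < i → (A * B) i j = 0) ∧ ∀ i, (A * B) i i = A i i * B i i := by
  refine ⟨fun i j h => ?_, fun i => ?_⟩
  · rw [mul_apply]
    refine Finset.sum_eq_zero fun k _ => ?_
    rcases lt_or_ge k i with hk | hk
    · simp [hA i k hk]
    · simp [hB k j (h.trans_le hk)]
  · rw [mul_apply]
    refine Finset.sum_eq_single i (fun k _ hk => ?_) (by simp)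
    rcases lt_or_gt_of_ne hk with hk | hk
    · simp [hA i k hk]
    · simp [hB k i hk]

lemma upper_pow {A : Matrix (Fin n) (Fin n) K} (hA : ∀ i j, j < i → A i j = 0) (k : ℕ) :
    (∀ i j, j < i → (A ^ k) i j = 0) ∧ ∀ i, (A ^ k) i i = A i i ^ k := by
  induction k with
  | zero => exact ⟨fun i j h => by simp [one_apply, h.ne'], fun i => by simp⟩
  | succ k ih =>
    rw [pow_succ]
    refine ⟨(upper_mul ih.1 hA).1, fun i => ?_⟩
    rw [(upper_mul ih.1 hA).2, ih.2, pow_succ]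

lemma diag_mul {A B : Matrix (Fin n) (Fin n) K} (hA : ∀ i j, i ≠ j → A i j = 0)
    (hB : ∀ i j, i ≠ j → B i j = 0) : ∀ i j, i ≠ j → (A * B) i j = 0 := by
  intro i j h
  rw [mul_apply]
  refine Finset.sum_eq_zero fun k _ => ?_
  by_cases hk : i = k
  · subst hk; simp [hB i j h]
  · simp [hA i k hk]

lemma diag_pow {A : Matrix (Fin n) (Fin n) K} (hA : ∀ i j, i ≠ j → A i j = 0) (k : ℕ) :
    ∀ i j, i ≠ j → (A ^ k) i j = 0 := by
  induction k with
  | zero => intro i j h; simp [one_apply, h]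
  | succ k ih => rw [pow_succ]; exact diag_mul ih hA

lemma trace_comm_zero (A B : Matrix (Fin n) (Fin n) K) : (A * B - B * A).trace = 0 := by
  rw [trace_sub, trace_mul_comm, sub_self]

/-- The restricted Lie superalgebra of all matrices `(A, B; C, -Aᵗ)` with `A ∈ S` and
`(B, C) ∈ T`, where `B` is symmetric and `C` skew-symmetric. -/
def ofBlocks [Fact p.Prime] [CharP K p] (S : Submodule K (Matrix (Fin n) (Fin n) K))
    (T : Submodule K (Matrix (Fin n) (Fin n) K × Matrix (Fin n) (Fin n) K))
    (hT : T ≤ symSkew K n)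
    (hSS : ∀ A ∈ S, ∀ A' ∈ S, A * A' - A' * A ∈ S) (hSp : ∀ A ∈ S, A ^ p ∈ S)
    (hST : ∀ A ∈ S, ∀ B ∈ T, (A * B.1 + B.1 * Aᵀ, -(Aᵀ * B.2) - B.2 * A) ∈ T)
    (hTT : ∀ B ∈ T, ∀ B' ∈ T, B.1 * B'.2 + B'.1 * B.2 ∈ S) :
    RestrictedLieSuper K p (Mat K n) where
  even := S.map (diagBlock K n)
  odd := T.map (offBlock K n)
  even_even := by
    rintro _ ⟨A, hA, rfl⟩ _ ⟨A', hA', rfl⟩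
    refine ⟨_, hSS A hA A' hA', ?_⟩
    simp [diagBlock_apply, fromBlocks_multiply, sub_eq_add_neg, transpose_mul, fromBlocks_add, fromBlocks_neg, add_comm]
  even_odd := by
    rintro _ ⟨A, hA, rfl⟩ _ ⟨B, hB, rfl⟩
    refine ⟨_, hST A hA B hB, ?_⟩
    simp [diagBlock_apply, offBlock_apply, fromBlocks_multiply, sub_eq_add_neg, fromBlocks_add, fromBlocks_neg]
  odd_odd := by
    rintro _ ⟨B, hB, rfl⟩ _ ⟨B', hB', rfl⟩
    refine ⟨_, hTT B hB B' hB', ?_⟩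
    have h := hT hB
    have h' := hT hB'
    simp [diagBlock_apply, offBlock_apply, fromBlocks_multiply, fromBlocks_add, transpose_mul, h.1, h.2.1, h'.1,
      h'.2.1, add_comm]
  pow_mem := by
    rintro _ ⟨A, hA, rfl⟩
    exact ⟨_, hSp A hA, (diagBlock_pow p A).symm⟩

end Matrices

section Subalgebras

variable (K : Type u) [Field K] (p n : ℕ) [Fact p.Prime] [CharP K p]

lemma slMat_pow {A : Matrix (Fin n) (Fin n) K} (hA : A ∈ slMat K n) : A ^ p ∈ slMat K n := by
  have h : A.trace = 0 := hA
  have hp0 : p ≠ 0 := (Fact.out : p.Prime).ne_zero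
  change (A ^ p).trace = 0
  rw [trace_pow_char, h, zero_pow hp0]

lemma trace_symm_skew (X Y : Matrix (Fin n) (Fin n) K) (hX : Xᵀ = X) (hY : Yᵀ = -Y)
    (hY0 : ∀ i, Y i i = 0) : (X * Y).trace = 0 := by
  have hX' : ∀ i j, X i j = X j i := fun i j => by rw [← transpose_apply X, hX]
  have hY' : ∀ i j, Y i j = -Y j i := fun i j => by rw [← transpose_apply Y, hY, Matrix.neg_apply]
  simp only [trace, diag_apply, mul_apply]
  rw [← Finset.sum_product']
  refine Finset.sum_involution (fun x _ => (x.2, x.1)) ?_ ?_ (by simp) (by simp)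
  · rintro ⟨i, j⟩ _
    simp only
    rw [hX' i j, hY' j i]
    ring
  · rintro ⟨i, j⟩ _ h h'
    simp only [Prod.mk.injEq] at h h'
    obtain ⟨rfl, -⟩ := h'
    simp [hY0] at h

lemma stable_symSkew (A : Matrix (Fin n) (Fin n) K)
    (B : Matrix (Fin n) (Fin n) K × Matrix (Fin n) (Fin n) K) (hB : B ∈ symSkew K n) :
    (A * B.1 + B.1 * Aᵀ, -(Aᵀ * B.2) - B.2 * A) ∈ symSkew K n := by
  have hY' : ∀ i j, B.2 i j = -B.2 j i := fun i j => by
    rw [← transpose_apply B.2, hB.2.1, Matrix.neg_apply]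
  refine ⟨by simp [transpose_mul, hB.1, add_comm],
    by simp [transpose_mul, hB.2.1, add_comm, sub_eq_add_neg], fun i => ?_⟩
  simp only [Matrix.sub_apply, Matrix.neg_apply, mul_apply, transpose_apply]
  rw [← Finset.sum_neg_distrib, ← Finset.sum_sub_distrib]
  refine Finset.sum_eq_zero fun k _ => ?_
  rw [hY' i k]
  ring

/-- The periplectic Lie superalgebra `𝔭(n)`: matrices `(A, B; C, -Aᵗ)` with `tr A = 0`,
`B` symmetric and `C` skew-symmetric. -/
def periplectic : RestrictedLieSuper K p (Mat K n) :=
  ofBlocks p (slMat K n) (symSkew K n) le_rfl (fun A _ B _ => trace_comm_zero A B)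
    (fun _ hA => slMat_pow K p n hA) (fun A _ B hB => stable_symSkew K n A B hB)
    (fun B hB B' hB' => by
      change (B.1 * B'.2 + B'.1 * B.2).trace = 0
      rw [trace_add, trace_symm_skew K n _ _ hB.1 hB'.2.1 hB'.2.2,
        trace_symm_skew K n _ _ hB'.1 hB.2.1 hB.2.2, add_zero])

/-- The subalgebra `𝔤₀ ⊕ 𝔤₊₁`: matrices `(A, B; 0, -Aᵗ)` with `tr A = 0` and `B` symmetric. -/
def parabolic : RestrictedLieSuper K p (Mat K n) :=
  ofBlocks p (slMat K n) (symZero K n) (fun B hB => ⟨hB.1, by simp [hB.2], by simp [hB.2]⟩)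
    (fun A _ B _ => trace_comm_zero A B) (fun _ hA => slMat_pow K p n hA)
    (fun A _ B hB => ⟨by simp [transpose_mul, hB.1, add_comm], by simp [hB.2]⟩)
    (fun B hB B' hB' => by
      rw [hB.2, hB'.2]
      simp)

/-- The even part `𝔤₀`: matrices `(A, 0; 0, -Aᵗ)` with `tr A = 0`. -/
def evenPart : RestrictedLieSuper K p (Mat K n) :=
  ofBlocks p (slMat K n) ⊥ bot_le (fun A _ B _ => trace_comm_zero A B)
    (fun _ hA => slMat_pow K p n hA)
    (fun A _ B hB => by rw [Submodule.mem_bot] at hB; subst hB; simp)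
    (fun B hB B' hB' => by
      rw [Submodule.mem_bot] at hB hB'; subst hB; subst hB'; simp)

/-- The Borel subalgebra `𝔟₀ = 𝔫₀ ⊕ 𝔥` of `𝔤₀`: matrices `(A, 0; 0, -Aᵗ)` with `A` upper
triangular and `tr A = 0`. -/
def borel : RestrictedLieSuper K p (Mat K n) :=
  ofBlocks p (borelMat K n) ⊥ bot_le
    (fun A hA B hB => ⟨trace_comm_zero A B, fun i j h => by
      rw [Matrix.sub_apply, (upper_mul hA.2 hB.2).1 i j h, (upper_mul hB.2 hA.2).1 i j h, sub_zero]⟩)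
    (fun A hA => ⟨slMat_pow K p n (A := A) hA.1, (upper_pow hA.2 p).1⟩)
    (fun A _ B hB => by rw [Submodule.mem_bot] at hB; subst hB; simp)
    (fun B hB B' hB' => by
      rw [Submodule.mem_bot] at hB hB'; subst hB; subst hB'; simp)

/-- The Cartan subalgebra `𝔥`: matrices `(A, 0; 0, -A)` with `A` diagonal and `tr A = 0`. -/
def cartan : RestrictedLieSuper K p (Mat K n) :=
  ofBlocks p (cartanMat K n) ⊥ bot_le
    (fun A hA B hB => ⟨trace_comm_zero A B, fun i j h => by
      rw [Matrix.sub_apply, diag_mul hA.2 hB.2 i j h, diag_mul hB.2 hA.2 i j h, sub_zero]⟩)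
    (fun A hA => ⟨slMat_pow K p n (A := A) hA.1, diag_pow hA.2 p⟩)
    (fun A _ B hB => by rw [Submodule.mem_bot] at hB; subst hB; simp)
    (fun B hB B' hB' => by
      rw [Submodule.mem_bot] at hB hB'; subst hB; subst hB'; simp)

/-- The nilradical `𝔫₀` of `𝔟₀`: matrices `(A, 0; 0, -Aᵗ)` with `A` strictly upper triangular. -/
def nilpotentPart : Submodule K (Mat K n) := (nilMat K n).map (diagBlock K n)

lemma cartan_le_borel : cartan K p n ≤ borel K p n :=
  ⟨Submodule.map_mono fun _ hA => ⟨hA.1, fun i j h => hA.2 i j h.ne'⟩, le_rfl⟩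

lemma borel_le_evenPart : borel K p n ≤ evenPart K p n :=
  ⟨Submodule.map_mono fun _ hA => hA.1, le_rfl⟩

lemma evenPart_le_parabolic : evenPart K p n ≤ parabolic K p n :=
  ⟨le_rfl, Submodule.map_mono bot_le⟩

lemma parabolic_le_periplectic : parabolic K p n ≤ periplectic K p n :=
  ⟨le_rfl, Submodule.map_mono fun _ hB => ⟨hB.1, by simp [hB.2], by simp [hB.2]⟩⟩

lemma evenPart_le_periplectic : evenPart K p n ≤ periplectic K p n :=
  ⟨le_rfl, Submodule.map_mono bot_le⟩

lemma borel_le_periplectic : borel K p n ≤ periplectic K p n :=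
  ⟨(borel_le_evenPart K p n).1, Submodule.map_mono bot_le⟩

lemma cartan_le_periplectic : cartan K p n ≤ periplectic K p n :=
  ⟨(cartan_le_borel K p n).1.trans (borel_le_evenPart K p n).1, Submodule.map_mono bot_le⟩

end Subalgebras

section Characters

variable {K : Type u} [Field K] {p n : ℕ} [Fact p.Prime] [CharP K p]

/-- The set `Λ_χ` of all `λ ∈ 𝔥^*` with `λ(h) ^ p - λ(h^{[p]}) = χ(h) ^ p` for all `h ∈ 𝔥`. -/
def weights (χ : Module.Dual K (periplectic K p n).even) :
    Set (Module.Dual K (cartan K p n).even) :=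
  {lam | ∀ h : (cartan K p n).even, lam h ^ p - lam ((cartan K p n).pmap h) =
    χ (Submodule.inclusion (cartan_le_periplectic K p n).1 h) ^ p}

/-- `χ(𝔫₀) = 0`. -/
def VanishesOnNil (χ : Module.Dual K (periplectic K p n).even) : Prop :=
  ∀ x : (periplectic K p n).even, x.1 ∈ nilpotentPart K n → χ x = 0

/-- The root vector `X_{ε_i - ε_j} = E_{i,j} - E_{n+j,n+i}`, for `i ≠ j`. -/
def rootVec (i j : Fin n) (h : i ≠ j) : (periplectic K p n).even :=
  ⟨diagBlock K n (Matrix.single i j 1), Matrix.single i j 1, by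
    change (Matrix.single i j (1 : K)).trace = 0
    simp [h], rfl⟩

/-- The element `g ↦ (g, 0; 0, (g⁻¹)ᵗ)`. -/
def glBlock (g : GL (Fin n) K) : Mat K n := fromBlocks g.1 0 0 (g⁻¹).1ᵀ

/-- The adjoint action of `GL(n)` on the even part of `𝔭(n)`: it sends `(A, 0; 0, -Aᵗ)` to
`(gAg⁻¹, 0; 0, -(gAg⁻¹)ᵗ)`. -/
def Ad (g : GL (Fin n) K) : (periplectic K p n).even →ₗ[K] (periplectic K p n).even :=
  (LinearMap.mulRight K (glBlock g⁻¹) ∘ₗ LinearMap.mulLeft K (glBlock g)).restrict (by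
    rintro _ ⟨A, hA, rfl⟩
    refine ⟨g.1 * A * (g⁻¹).1, ?_, ?_⟩
    · change (g.1 * A * (g⁻¹).1).trace = 0
      have h : A.trace = 0 := hA
      rw [trace_mul_comm, ← mul_assoc, ← Units.val_mul, inv_mul_cancel, Units.val_one, one_mul, h]
    · simp [glBlock, diagBlock_apply, fromBlocks_multiply, transpose_mul, mul_assoc])

/-- The coadjoint action of `GL(n)`: `(g · χ)(x) = χ(g⁻¹ · x)`. -/
def coAd (g : GL (Fin n) K) (χ : Module.Dual K (periplectic K p n).even) :
    Module.Dual K (periplectic K p n).even :=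
  χ ∘ₗ Ad g⁻¹

/-- `χ` is regular nilpotent: some `GL(n)`-conjugate of `χ` vanishes on `𝔥 ⊕ 𝔫₀` and is nonzero on
each root vector `X_{-α}`, for `α = ε_i - ε_{i+1}` a simple root. -/
def IsRegularNilpotent (χ : Module.Dual K (periplectic K p n).even) : Prop :=
  ∃ g : GL (Fin n) K,
    (∀ x : (periplectic K p n).even, x.1 ∈ (borel K p n).even → coAd g χ x = 0) ∧
    ∀ (i j : Fin n) (h : j ≠ i), i.val + 1 = j.val → coAd g χ (rootVec j i h) ≠ 0

/-- The restriction of `χ` to `𝔤₀` (it has the same underlying space as `𝔭(n)_0`). -/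
abbrev χEven (χ : Module.Dual K (periplectic K p n).even) : Module.Dual K (evenPart K p n).even :=
  RestrictedLieSuper.resDual (evenPart_le_periplectic K p n) χ

/-- The restriction of `χ` to `𝔟₀`. -/
abbrev χBorel (χ : Module.Dual K (periplectic K p n).even) : Module.Dual K (borel K p n).even :=
  RestrictedLieSuper.resDual (borel_le_evenPart K p n) (χEven χ)

/-- The restriction of `χ` to the even part of `𝔤₀ ⊕ 𝔤₊₁`. -/
abbrev χPar (χ : Module.Dual K (periplectic K p n).even) : Module.Dual K (parabolic K p n).even :=
  RestrictedLieSuper.resDual (parabolic_le_periplectic K p n) χ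

end Characters

section Modules

variable {K : Type u} [Field K] {p n : ℕ} [Fact p.Prime] [CharP K p]

/-- The diagonal part of a matrix. -/
def diagPart : Matrix (Fin n) (Fin n) K →ₗ[K] Matrix (Fin n) (Fin n) K where
  toFun A := diagonal A.diag
  map_add' A B := by simp
  map_smul' c A := by simp

lemma diagPart_apply (A : Matrix (Fin n) (Fin n) K) : diagPart A = diagonal A.diag := rfl

/-- The projection `𝔟₀ = 𝔫₀ ⊕ 𝔥 → 𝔥`. -/
def toCartan : (borel K p n).even →ₗ[K] (cartan K p n).even :=
  LinearMap.restrict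
    (diagBlock K n ∘ₗ diagPart ∘ₗ
      { toFun := fun X : Mat K n => X.toBlocks₁₁
        map_add' := fun _ _ => rfl
        map_smul' := fun _ _ => rfl }) (by
    rintro _ ⟨A, hA, rfl⟩
    refine ⟨diagPart A, ⟨?_, fun i j h => by simp [diagPart_apply, h]⟩, ?_⟩
    · have h : A.trace = 0 := hA.1
      simpa [diagPart_apply, trace] using h
    · rfl)

lemma toCartan_mk (A : Matrix (Fin n) (Fin n) K) (hA) (hA') :
    toCartan (p := p) ⟨diagBlock K n A, hA⟩ = ⟨diagBlock K n (diagonal A.diag), hA'⟩ := rfl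

lemma toCartan_br00 (x y : (borel K p n).even) : toCartan ((borel K p n).br00 x y) = 0 := by
  obtain ⟨_, A, hA, rfl⟩ := x
  obtain ⟨_, B, hB, rfl⟩ := y
  have h : (A * B - B * A).diag = 0 := by
    funext i
    simp [(upper_mul hA.2 hB.2).2, (upper_mul hB.2 hA.2).2, mul_comm]
  apply Subtype.ext
  change diagBlock K n (diagonal (toBlocks₁₁ (diagBlock K n A * diagBlock K n B -
    diagBlock K n B * diagBlock K n A)).diag) = 0
  have h2 : toBlocks₁₁ (diagBlock K n A * diagBlock K n B -
    diagBlock K n B * diagBlock K n A) = A * B - B * A := by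
    simp [diagBlock_apply, fromBlocks_multiply, sub_eq_add_neg, fromBlocks_add, fromBlocks_neg]
  rw [h2, h]
  simp

lemma toCartan_pmap (x : (borel K p n).even) :
    toCartan ((borel K p n).pmap x) = (cartan K p n).pmap (toCartan x) := by
  obtain ⟨_, A, hA, rfl⟩ := x
  apply Subtype.ext
  change diagBlock K n (diagonal (toBlocks₁₁ (diagBlock K n A ^ p)).diag) =
    diagBlock K n (diagonal A.diag) ^ p
  rw [diagBlock_pow, diagBlock_pow, diagonal_pow]
  congr 2
  funext i
  exact (upper_pow hA.2 p).2 i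

lemma χ_toCartan {χ : Module.Dual K (periplectic K p n).even} (hχ : VanishesOnNil χ)
    (x : (borel K p n).even) :
    χBorel χ x = χ (Submodule.inclusion (cartan_le_periplectic K p n).1 (toCartan x)) := by
  rw [← sub_eq_zero]
  change χ (Submodule.inclusion (borel_le_periplectic K p n).1 x) - _ = 0
  rw [← map_sub]
  apply hχ
  obtain ⟨_, A, hA, rfl⟩ := x
  refine ⟨A - diagonal A.diag, fun i j h => ?_, ?_⟩
  · rcases h.lt_or_eq with h | h
    · simp [hA.2 i j h, h.ne']
    · subst h; simp
  · rw [map_sub]; rfl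

/-- The one-dimensional `U_χ(𝔟₀)`-module `K_λ`, `λ ∈ Λ_χ`: `𝔥` acts through `λ` and `𝔫₀` acts
by zero. -/
def Kchar (χ : Module.Dual K (periplectic K p n).even) (hχ : VanishesOnNil χ)
    (lam : Module.Dual K (cartan K p n).even) (hlam : lam ∈ weights χ) :
    (borel K p n).UChi (χBorel χ) →ₐ[K] K :=
  (borel K p n).liftUChi (χBorel χ) (lam ∘ₗ toCartan) 0
    (fun x y => by simp [toCartan_br00, mul_comm])
    (fun x y => by simp)
    (fun x y => by
      have hx : x = 0 := by
        obtain ⟨_, B, hB, rfl⟩ := x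
        have hB' : B = 0 := hB
        subst hB'
        exact Subtype.ext (map_zero _)
      subst hx
      have h : (borel K p n).br11 0 y = 0 := Subtype.ext (by simp [RestrictedLieSuper.br11])
      simp [h])
    (fun x => by
      rw [χ_toCartan hχ, LinearMap.comp_apply, LinearMap.comp_apply, toCartan_pmap]
      exact hlam (toCartan x))

/-- The baby Verma module `Z⁰_χ(λ) = U_χ(𝔤₀) ⊗_{U_χ(𝔟₀)} K_λ`. -/
def BabyVerma (χ : Module.Dual K (periplectic K p n).even) (hχ : VanishesOnNil χ)
    (lam : Module.Dual K (cartan K p n).even) (hlam : lam ∈ weights χ) : Type u :=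
  Ind (RestrictedLieSuper.incl (borel_le_evenPart K p n) (χEven χ))
    ((Algebra.lsmul K K K).comp (Kchar χ hχ lam hlam))

lemma parabolic_even_le : (parabolic K p n).even ≤ (evenPart K p n).even := le_rfl

/-- The surjection `U_χ(𝔤₀ ⊕ 𝔤₊₁) → U_χ(𝔤₀)` that is the identity on `𝔤₀` and zero on `𝔤₊₁`. -/
def parToEven (χ : Module.Dual K (periplectic K p n).even) :
    (parabolic K p n).UChi (χPar χ) →ₐ[K] (evenPart K p n).UChi (χEven χ) :=
  (parabolic K p n).liftUChi (χPar χ)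
    ((evenPart K p n).ιEven (χEven χ) ∘ₗ Submodule.inclusion parabolic_even_le) 0
    (fun x y => (evenPart K p n).ιEven_br00 (χEven χ) x y)
    (fun x y => by simp)
    (fun x y => by
      obtain ⟨_, B, hB, rfl⟩ := x
      obtain ⟨_, B', hB', rfl⟩ := y
      have h : (parabolic K p n).br11 ⟨_, B, hB, rfl⟩ ⟨_, B', hB', rfl⟩ = 0 := by
        apply Subtype.ext
        have h1 := hB.2
        have h2 := hB'.2
        simp [RestrictedLieSuper.br11, offBlock_apply, fromBlocks_multiply, h1, h2]
      rw [h, map_zero]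
      simp only [LinearMap.zero_apply, mul_zero, add_zero])
    (fun x => (evenPart K p n).ιEven_pow (χEven χ) x)

variable (χ : Module.Dual K (periplectic K p n).even) (hχ : VanishesOnNil χ)
  (lam : Module.Dual K (cartan K p n).even) (hlam : lam ∈ weights χ)

instance : AddCommGroup (BabyVerma χ hχ lam hlam) :=
  inferInstanceAs (AddCommGroup (Ind _ _))

instance : Module K (BabyVerma χ hχ lam hlam) :=
  inferInstanceAs (Module K (Ind _ _))

instance : Module ((evenPart K p n).UChi (χEven χ)) (BabyVerma χ hχ lam hlam) :=
  inferInstanceAs (Module _ (Ind _ _))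

instance : IsScalarTower K ((evenPart K p n).UChi (χEven χ)) (BabyVerma χ hχ lam hlam) :=
  inferInstanceAs (IsScalarTower K _ (Ind _ _))

/-- The simple quotient `L⁰_χ(λ)` of `Z⁰_χ(λ)` by its maximal submodule (the intersection of its
maximal submodules). -/
abbrev SimpleEven : Type u :=
  BabyVerma χ hχ lam hlam ⧸
    Module.jacobson ((evenPart K p n).UChi (χEven χ)) (BabyVerma χ hχ lam hlam)

/-- The representation of `U_χ(𝔤₀ ⊕ 𝔤₊₁)` on `L⁰_χ(λ)` with trivial action of `𝔤₊₁`. -/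
def parRep : (parabolic K p n).UChi (χPar χ) →ₐ[K] Module.End K (SimpleEven χ hχ lam hlam) :=
  (Algebra.lsmul K K (SimpleEven χ hχ lam hlam)).comp (parToEven χ)

/-- The Kac module `K_χ(λ) = U_χ(𝔤) ⊗_{U_χ(𝔤₀ ⊕ 𝔤₊₁)} L⁰_χ(λ)`, for `𝔤 = 𝔭(n)`. -/
def KacModule : Type u :=
  Ind (RestrictedLieSuper.incl (parabolic_le_periplectic K p n) χ) (parRep χ hχ lam hlam)

instance : AddCommGroup (KacModule χ hχ lam hlam) :=
  inferInstanceAs (AddCommGroup (Ind _ _))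

instance : Module ((periplectic K p n).UChi χ) (KacModule χ hχ lam hlam) :=
  inferInstanceAs (Module _ (Ind _ _))

/-- `K_χ(λ)` as a `U(𝔤)`-module, through `U(𝔤) → U_χ(𝔤)`. -/
instance : Module (periplectic K p n).U (KacModule χ hχ lam hlam) :=
  Module.compHom _ ((periplectic K p n).toUChi χ).toRingHom

end Modules

end Periplectic

end

/-! Put N = n(n-1)/2, which is both the number of positive roots of sl(n) and the dimension of the
space of skew-symmetric matrices. The proof compares two dimension estimates with the same value
(2p)^N.

Upper bound: the Kac module is generated by one vector v that is killed by the upper odd part and is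
an eigenvector of the Borel subalgebra. Ordered monomials in the N lower odd elements (each of
square zero) and the N lower root vectors (each with scalar p-th power), applied to v, therefore
span it (`exists_span_of_highestWeight`). Spanning is all that is needed, so no PBW basis enters.

Lower bound: conjugate χ so that, below the diagonal, it lives on the first subdiagonal and has no
zeros there (`exists_conj_subdiagonal`). In a nonzero invariant subspace, look for Whittaker
vectors: lower root vectors act by χ and lower odd elements act by zero. Impose these 2N conditions
column by column. Each is the kernel of an operator that is nilpotent on the current subspace, so
something nonzero survives. Each also has a partner: an even or odd element whose commutator or
anticommutator with it acts by an invertible scalar (up to a multiple of the operator itself). A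
Heisenberg pair in characteristic p cuts the dimension at least by the factor p, a Clifford pair at
least by 2 (`column_step`). Hence every nonzero invariant subspace has dimension at least (2p)^N
(`prod_le_finrank`) and must be the whole module.

It remains to see that the Kac module is not zero, since an induced module given by generators and
relations could collapse. This is shown by mapping to explicit models. For the baby Verma module the
model is the coordinate ring of the first Frobenius kernel of GL(n), with right translations twisted
by a potential that produces the p-character χ (`exists_weight_evenOperatorRep`). For the Kac module
it is the exterior algebra of the skew-symmetric matrices tensored with the even module
(`exists_exterior_operatorRep`). The simple quotient in between is nonzero because the radical of a
nonzero cyclic module is proper. -/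

namespace Periplectic

/-! ### Linear algebra: kernels of Heisenberg and Clifford pairs, and finite spanning sets -/

section LinearAlgebra

variable {K : Type*} [Field K] {V : Type*} [AddCommGroup V] [Module K V]

/-- If an operator preserves `W` and some power of it vanishes on `W ≠ 0`, then it has a kernel
in `W`. -/
lemma inf_ker_ne_bot_of_pow {W : Submodule K V} (hW : W ≠ ⊥) {D : Module.End K V}
    (hD : ∀ w ∈ W, D w ∈ W) {q : ℕ} (hq : ∀ w ∈ W, (D ^ q) w = 0) : W ⊓ LinearMap.ker D ≠ ⊥ := by
  intro h
  apply hW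
  have inj : ∀ w ∈ W, D w = 0 → w = 0 := fun w hw h0 => by
    have : w ∈ W ⊓ LinearMap.ker D := ⟨hw, h0⟩
    rwa [h, Submodule.mem_bot] at this
  have key : ∀ k : ℕ, ∀ w ∈ W, (D ^ k) w = 0 → w = 0 := by
    intro k
    induction k with
    | zero => intro w _ h0; simpa using h0
    | succ k ih =>
      intro w hw h0
      rw [pow_succ, Module.End.mul_apply] at h0
      exact inj w hw (ih _ (hD w hw) h0)
  exact (Submodule.eq_bot_iff _).2 fun w hw => key q w hw (hq w hw)

lemma finrank_inf_ker_add_finrank_map [FiniteDimensional K V] (W : Submodule K V)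
    (D : Module.End K V) :
    Module.finrank K (W.map D) + Module.finrank K (W ⊓ LinearMap.ker D : Submodule K V) =
      Module.finrank K W := by
  have h := LinearMap.finrank_range_add_finrank_ker (D.domRestrict W)
  rw [LinearMap.range_domRestrict, LinearMap.ker_domRestrict] at h
  rw [← h]
  congr 1
  rw [← Submodule.finrank_map_subtype_eq W, Submodule.map_comap_subtype]

/-- An odd pair of operators: if `D Z` is an invertible scalar on `W ∩ ker D`, then
`W ∩ ker D` has at most half the dimension of `W`. -/
lemma two_mul_finrank_inf_ker_le [FiniteDimensional K V] {W : Submodule K V}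
    {D Z : Module.End K V} (hZ : ∀ w ∈ W, Z w ∈ W) {s : K} (hs : s ≠ 0)
    (h : ∀ w ∈ W, D w = 0 → D (Z w) = s • w) :
    2 * Module.finrank K (W ⊓ LinearMap.ker D : Submodule K V) ≤ Module.finrank K W := by
  -- By rank-nullity it is enough that `W ⊓ ker D` lies in the image `D(W)`, and `Z` provides the
  -- preimages.
  rw [← finrank_inf_ker_add_finrank_map W D, two_mul]
  refine Nat.add_le_add_right (Submodule.finrank_mono ?_) _
  rintro w ⟨hw, h0⟩
  refine ⟨Z (s⁻¹ • w), hZ _ (W.smul_mem _ hw), ?_⟩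
  rw [map_smul, map_smul, h w hw h0, smul_smul, inv_mul_cancel₀ hs, one_smul]

/-- A Heisenberg-like pair of operators: if `D Y - Y D = s + t D` on `W`, with `s` invertible,
then `W ∩ ker D` has at most `1/p` of the dimension of `W`. -/
lemma char_mul_finrank_inf_ker_le [FiniteDimensional K V] (p : ℕ) [Fact p.Prime] [CharP K p]
    {W : Submodule K V} {D Y : Module.End K V} (hY : ∀ w ∈ W, Y w ∈ W)
    {s t : K} (hs : s ≠ 0)
    (h : ∀ w ∈ W, D (Y w) = Y (D w) + s • w + t • D w) :
    p * Module.finrank K (W ⊓ LinearMap.ker D : Submodule K V) ≤ Module.finrank K W := by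
  have lift : ∀ w ∈ W, D w = 0 → ∃ q : ℕ → V, q 0 = w ∧ (∀ k, q k ∈ W) ∧
      (∀ k : ℕ, D (q (k + 1)) = (((k + 1 : ℕ) : K) * s) • q k) := by
    intro w hw h0
    -- Subtracting `k t` from `Y` at the k-th step cancels the contribution of `t • D w`, so that
    -- `D` lowers the chain exactly as in the Heisenberg case `t = 0`.
    let q : ℕ → V := fun k => Nat.rec w (fun k v => Y v - ((k : K) * t) • v) k
    have q0 : q 0 = w := rfl
    have qs : ∀ k, q (k + 1) = Y (q k) - ((k : K) * t) • q k := fun _ => rfl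
    have hq : ∀ k, q k ∈ W := by
      intro k
      induction k with
      | zero => exact hw
      | succ k ih => rw [qs]; exact W.sub_mem (hY _ ih) (W.smul_mem _ ih)
    refine ⟨q, q0, hq, fun k => ?_⟩
    induction k with
    | zero => rw [qs, q0]; simp [h w hw, h0]
    | succ k ih =>
      rw [qs (k + 1), map_sub, h _ (hq (k + 1)), map_smul, ih, map_smul, qs k]
      push_cast
      module
  -- Each layer `ker D^(k+1) / ker D^k` of `W` is at least as large as `W ⊓ ker D`, because `D^k`
  -- maps the chain element `q k` to a nonzero multiple of its starting vector.
  have main : ∀ k : ℕ, k ≤ p → k * Module.finrank K (W ⊓ LinearMap.ker D : Submodule K V) ≤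
      Module.finrank K (W ⊓ LinearMap.ker (D ^ k) : Submodule K V) := by
    intro k
    induction k with
    | zero => simp
    | succ k ih =>
      intro hk
      have h1 := finrank_inf_ker_add_finrank_map (W ⊓ LinearMap.ker (D ^ (k + 1))) (D ^ k)
      have h2 : W ⊓ LinearMap.ker (D ^ (k + 1)) ⊓ LinearMap.ker (D ^ k) =
          W ⊓ LinearMap.ker (D ^ k) := by
        rw [inf_assoc]
        congr 1
        refine inf_eq_right.2 fun v hv => ?_
        rw [LinearMap.mem_ker] at hv ⊢
        rw [pow_succ', Module.End.mul_apply, hv, map_zero]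
      have h3 : W ⊓ LinearMap.ker D ≤ (W ⊓ LinearMap.ker (D ^ (k + 1))).map (D ^ k) := by
        rintro w ⟨hw, h0⟩
        obtain ⟨q, q0, hq, hqs⟩ := lift w hw h0
        have hpow : ∀ j : ℕ, (D ^ j) (q j) = ((j.factorial : K) * s ^ j) • w := by
          intro j
          induction j with
          | zero => simp [q0]
          | succ j ih =>
            rw [pow_succ, Module.End.mul_apply, hqs, map_smul, ih, smul_smul, Nat.factorial_succ]
            push_cast
            ring_nf
        -- The factorial is invertible exactly while `k < p`; this is why the count stops at `p`
        -- layers.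
        have hc : ((k.factorial : K) * s ^ k) ≠ 0 := by
          refine mul_ne_zero ?_ (pow_ne_zero _ hs)
          rw [Ne, CharP.cast_eq_zero_iff K p, (Fact.out : p.Prime).dvd_factorial]
          omega
        refine ⟨((k.factorial : K) * s ^ k)⁻¹ • q k, ⟨W.smul_mem _ (hq k), ?_⟩, ?_⟩
        · show (D ^ (k + 1)) _ = 0
          rw [map_smul, pow_succ', Module.End.mul_apply, hpow, map_smul,
            LinearMap.mem_ker.1 h0, smul_zero, smul_zero]
        · rw [map_smul, hpow, smul_smul, inv_mul_cancel₀ hc, one_smul]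
      rw [h2] at h1
      have h4 := Submodule.finrank_mono h3
      have h5 := ih (by omega)
      rw [Nat.succ_mul]
      omega
  exact (main p le_rfl).trans (Submodule.finrank_mono inf_le_left)

/-- Iteration of a bound on the common kernel of a family of operators. -/
lemma pow_card_mul_finrank_inf_iInf_ker_le {ι : Type*} [DecidableEq ι] (q : ℕ)
    {W : Submodule K V} (J : Finset ι)
    (D Y : ι → Module.End K V)
    (hD : ∀ j ∈ J, ∀ w ∈ W, D j w ∈ W) (hY : ∀ j ∈ J, ∀ w ∈ W, Y j w ∈ W)
    (hDD : ∀ j ∈ J, ∀ l ∈ J, j ≠ l → ∀ w ∈ W, D l w = 0 → D l (D j w) = 0)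
    (hDY : ∀ j ∈ J, ∀ l ∈ J, j ≠ l → ∀ w ∈ W, D l w = 0 → D l (Y j w) = 0)
    (step : ∀ j ∈ J, ∀ W' ≤ W, (∀ w ∈ W', D j w ∈ W') → (∀ w ∈ W', Y j w ∈ W') → W' ≠ ⊥ →
      W' ⊓ LinearMap.ker (D j) ≠ ⊥ ∧
        q * Module.finrank K (W' ⊓ LinearMap.ker (D j) : Submodule K V) ≤ Module.finrank K W')
    (hW : W ≠ ⊥) :
    W ⊓ (⨅ j ∈ J, LinearMap.ker (D j)) ≠ ⊥ ∧
      q ^ J.card * Module.finrank K (W ⊓ ⨅ j ∈ J, LinearMap.ker (D j) : Submodule K V) ≤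
        Module.finrank K W := by
  induction J using Finset.induction_on with
  | empty =>
    have h : W ⊓ (⨅ j ∈ (∅ : Finset ι), LinearMap.ker (D j)) = W := by simp
    rw [h]
    simpa using hW
  | insert a J ha ih =>
    obtain ⟨h1, h2⟩ := ih (fun j hj => hD j (Finset.mem_insert_of_mem hj))
      (fun j hj => hY j (Finset.mem_insert_of_mem hj))
      (fun j hj l hl => hDD j (Finset.mem_insert_of_mem hj) l (Finset.mem_insert_of_mem hl))
      (fun j hj l hl => hDY j (Finset.mem_insert_of_mem hj) l (Finset.mem_insert_of_mem hl))
      (fun j hj => step j (Finset.mem_insert_of_mem hj))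
    have ha' := Finset.mem_insert_self a J
    have hne : ∀ l ∈ J, a ≠ l := fun l hl h => ha (h ▸ hl)
    have hmem : ∀ w, w ∈ W ⊓ (⨅ j ∈ J, LinearMap.ker (D j)) ↔ w ∈ W ∧ ∀ j ∈ J, D j w = 0 := by
      intro w; simp [Submodule.mem_iInf]
    obtain ⟨h3, h4⟩ := step a ha' (W ⊓ ⨅ j ∈ J, LinearMap.ker (D j)) inf_le_left
      (fun w hw => by
        rw [hmem] at hw ⊢
        exact ⟨hD a ha' w hw.1, fun l hl =>
          hDD a ha' l (Finset.mem_insert_of_mem hl) (hne l hl) w hw.1 (hw.2 l hl)⟩)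
      (fun w hw => by
        rw [hmem] at hw ⊢
        exact ⟨hY a ha' w hw.1, fun l hl =>
          hDY a ha' l (Finset.mem_insert_of_mem hl) (hne l hl) w hw.1 (hw.2 l hl)⟩) h1
    have h5 : W ⊓ (⨅ j ∈ insert a J, LinearMap.ker (D j)) =
        W ⊓ (⨅ j ∈ J, LinearMap.ker (D j)) ⊓ LinearMap.ker (D a) := by
      rw [Finset.iInf_insert, inf_assoc, inf_comm (LinearMap.ker (D a))]
    rw [h5]
    refine ⟨h3, le_trans ?_ h2⟩
    rw [Finset.card_insert_of_notMem ha, pow_succ, mul_assoc]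
    exact Nat.mul_le_mul_left _ h4

/-- Adjoining one operator to a family of operators that preserve a finitely spanned subspace. -/
lemma exists_finset_extension [DecidableEq V] {Q : Submodule K (Module.End K V)} {s : Finset V}
    {q : ℕ} (hq : 0 < q) {f : Module.End K V}
    (hQ : ∀ x ∈ Q, ∀ v ∈ Submodule.span K (s : Set V), x v ∈ Submodule.span K (s : Set V))
    {r : K} (hf : f ^ q = algebraMap K _ r)
    (hc : ∀ x ∈ Q, ∃ x₁ ∈ Q, ∃ x₂ ∈ Q, ∃ c : K, x * f = f * x₁ + x₂ + c • f) :
    ∃ t : Finset V, t.card ≤ q * s.card ∧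
      (∀ x ∈ Q ⊔ K ∙ f, ∀ v ∈ Submodule.span K (t : Set V), x v ∈ Submodule.span K (t : Set V)) ∧
      (s : Set V) ⊆ t ∧
      ∀ T : Submodule K V, (s : Set V) ⊆ T → (∀ v ∈ T, f v ∈ T) → (t : Set V) ⊆ T := by
  -- Exponents below `q` suffice because `f ^ q` is a scalar.
  set t : Finset V := Finset.image₂ (fun (a : ℕ) v => (f ^ a) v) (Finset.range q) s with ht
  have hmem : ∀ a < q, ∀ v ∈ Submodule.span K (s : Set V),
      (f ^ a) v ∈ Submodule.span K (t : Set V) := by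
    intro a ha v hv
    induction hv using Submodule.span_induction with
    | mem v hv =>
      exact Submodule.subset_span (Finset.mem_image₂_of_mem (Finset.mem_range.2 ha) hv)
    | zero => simp
    | add v w _ _ h1 h2 => rw [map_add]; exact Submodule.add_mem _ h1 h2
    | smul c v _ h => rw [map_smul]; exact Submodule.smul_mem _ _ h
  have hst : (s : Set V) ⊆ t := fun v hv =>
    Finset.mem_image₂.2 ⟨0, Finset.mem_range.2 hq, v, hv, by simp⟩
  have hspan : Submodule.span K (s : Set V) ≤ Submodule.span K (t : Set V) :=
    Submodule.span_mono hst
  have ext : ∀ x : Module.End K V, (∀ a < q, ∀ v ∈ Submodule.span K (s : Set V),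
      x ((f ^ a) v) ∈ Submodule.span K (t : Set V)) →
      ∀ v ∈ Submodule.span K (t : Set V), x v ∈ Submodule.span K (t : Set V) := by
    intro x hx v hv
    have : Submodule.span K (t : Set V) ≤ (Submodule.span K (t : Set V)).comap x := by
      rw [Submodule.span_le]
      intro w hw
      obtain ⟨a, ha, v, hv, rfl⟩ := Finset.mem_image₂.1 hw
      exact hx a (Finset.mem_range.1 ha) v (Submodule.subset_span hv)
    exact this hv
  have hft : ∀ v ∈ Submodule.span K (t : Set V), f v ∈ Submodule.span K (t : Set V) := by
    refine ext f fun a ha v hv => ?_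
    rw [← Module.End.mul_apply, ← pow_succ']
    rcases Nat.lt_or_ge (a + 1) q with h | h
    · exact hmem _ h v hv
    · obtain rfl : a + 1 = q := by omega
      rw [hf, Module.algebraMap_end_apply]
      exact Submodule.smul_mem _ _ (hspan hv)
  -- Moving `x` past one factor `f` produces only elements of `Q` applied to lower powers, and
  -- multiples of `f`.
  have hQt : ∀ a < q, ∀ x ∈ Q, ∀ v ∈ Submodule.span K (s : Set V),
      x ((f ^ a) v) ∈ Submodule.span K (t : Set V) := by
    intro a
    induction a with
    | zero => intro _ x hx v hv; simpa using hspan (hQ x hx v hv)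
    | succ a ih =>
      intro ha x hx v hv
      obtain ⟨x₁, h₁, x₂, h₂, c, h⟩ := hc x hx
      have ha' : a < q := by omega
      have : x ((f ^ (a + 1)) v) = f (x₁ ((f ^ a) v)) + x₂ ((f ^ a) v) + c • f ((f ^ a) v) := by
        rw [pow_succ', Module.End.mul_apply, ← Module.End.mul_apply x f, h]
        simp
      rw [this]
      exact Submodule.add_mem _ (Submodule.add_mem _ (hft _ (ih ha' x₁ h₁ v hv))
        (ih ha' x₂ h₂ v hv)) (Submodule.smul_mem _ _ (hft _ (hmem a ha' v hv)))
  refine ⟨t, ?_, ?_, hst, ?_⟩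
  · have := Finset.card_image₂_le (fun (a : ℕ) v => (f ^ a) v) (Finset.range q) s
    rwa [Finset.card_range] at this
  · intro x hx v hv
    obtain ⟨y, hy, z, hz, rfl⟩ := Submodule.mem_sup.1 hx
    obtain ⟨c, rfl⟩ := Submodule.mem_span_singleton.1 hz
    rw [LinearMap.add_apply, LinearMap.smul_apply]
    exact Submodule.add_mem _ (ext y (fun a ha => hQt a ha y hy) v hv)
      (Submodule.smul_mem _ _ (hft v hv))
  · intro T hsT hfT w hw
    obtain ⟨a, -, v, hv, rfl⟩ := Finset.mem_image₂.1 hw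
    clear hw
    have hvT := hsT hv
    show (f ^ a) v ∈ T
    induction a with
    | zero => simpa using hvT
    | succ a ih => rw [pow_succ', Module.End.mul_apply]; exact hfT _ ih

end LinearAlgebra

end Periplectic

/-! ### Operators satisfying the relations of the reduced enveloping algebra -/

namespace Periplectic

/-- Elements `a A`, `b M`, `c M` of an algebra that satisfy the relations of `U_χ(𝔭(n))`, where
`a A` stands for `(A, 0; 0, -Aᵗ)` if `tr A = 0`, `b M` for `(0, M + Mᵗ; 0, 0)` and `c M` for
`(0, 0; M - Mᵗ, 0)`. -/
structure OperatorRep {K : Type*} [Field K] {n : ℕ} (p : ℕ)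
    (χ : Matrix (Fin n) (Fin n) K →ₗ[K] K) (𝒜 : Type*) [Ring 𝒜] [Algebra K 𝒜] where
  a : Matrix (Fin n) (Fin n) K →ₗ[K] 𝒜
  b : Matrix (Fin n) (Fin n) K →ₗ[K] 𝒜
  c : Matrix (Fin n) (Fin n) K →ₗ[K] 𝒜
  a_a : ∀ A A', A.trace = 0 → A'.trace = 0 → a A * a A' - a A' * a A = a (A * A' - A' * A)
  a_b : ∀ A M, A.trace = 0 → a A * b M - b M * a A = b (A * M + M * Aᵀ)
  a_c : ∀ A M, A.trace = 0 → a A * c M - c M * a A = -c (Aᵀ * M + M * A)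
  b_c : ∀ M M', b M * c M' + c M' * b M = a ((M + Mᵀ) * (M' - M'ᵀ))
  b_b : ∀ M M', b M * b M' + b M' * b M = 0
  c_c : ∀ M M', c M * c M' + c M' * c M = 0
  b_transpose : ∀ M, b Mᵀ = b M
  c_transpose : ∀ M, c Mᵀ = -c M
  a_pow : ∀ A, A.trace = 0 → a A ^ p - a (A ^ p) = algebraMap K 𝒜 (χ A ^ p)

namespace OperatorRep

variable {K : Type*} [Field K] {n p : ℕ} {χ : Matrix (Fin n) (Fin n) K →ₗ[K] K}

/-- The image under an algebra map. -/
def map {𝒜 ℬ : Type*} [Ring 𝒜] [Algebra K 𝒜] [Ring ℬ] [Algebra K ℬ] (R : OperatorRep p χ 𝒜)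
    (f : 𝒜 →ₐ[K] ℬ) : OperatorRep p χ ℬ where
  a := f.toLinearMap ∘ₗ R.a
  b := f.toLinearMap ∘ₗ R.b
  c := f.toLinearMap ∘ₗ R.c
  a_a A A' h h' := by simpa using congrArg f (R.a_a A A' h h')
  a_b A M h := by simpa using congrArg f (R.a_b A M h)
  a_c A M h := by simpa using congrArg f (R.a_c A M h)
  b_c M M' := by simpa using congrArg f (R.b_c M M')
  b_b M M' := by simpa using congrArg f (R.b_b M M')
  c_c M M' := by simpa using congrArg f (R.c_c M M')
  b_transpose M := by simpa using congrArg f (R.b_transpose M)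
  c_transpose M := by simpa using congrArg f (R.c_transpose M)
  a_pow A h := by simpa using congrArg f (R.a_pow A h)

/-- Conjugation by an element of `GL(n)`. -/
def conj {𝒜 : Type*} [Ring 𝒜] [Algebra K 𝒜] (R : OperatorRep p χ 𝒜) (g : GL (Fin n) K) :
    OperatorRep p (χ ∘ₗ LinearMap.mulLeft K g.1 ∘ₗ LinearMap.mulRight K g⁻¹.1) 𝒜 := by
  have gg' : g⁻¹.1 * g.1 = 1 := by rw [← Units.val_mul, inv_mul_cancel, Units.val_one]
  have tt : g.1ᵀ * g⁻¹.1ᵀ = 1 := by rw [← transpose_mul, gg', transpose_one]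
  have c1 : ∀ X : Matrix (Fin n) (Fin n) K, g⁻¹.1 * (g.1 * X) = X := fun X => by
    rw [← mul_assoc, gg', one_mul]
  have c2 : ∀ X : Matrix (Fin n) (Fin n) K, g.1ᵀ * (g⁻¹.1ᵀ * X) = X := fun X => by
    rw [← mul_assoc, tt, one_mul]
  have tr : ∀ A : Matrix (Fin n) (Fin n) K, A.trace = 0 → (g.1 * (A * g⁻¹.1)).trace = 0 := by
    intro A hA
    rw [trace_mul_comm, mul_assoc, gg', mul_one, hA]
  exact
  -- Conjugating by diag(g, g⁻ᵗ) acts on the upper right block by B ↦ g B gᵗ and on the lower left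
  -- block by C ↦ g⁻ᵗ C g⁻¹.
  { a := R.a ∘ₗ LinearMap.mulLeft K g.1 ∘ₗ LinearMap.mulRight K g⁻¹.1
    b := R.b ∘ₗ LinearMap.mulLeft K g.1 ∘ₗ LinearMap.mulRight K g.1ᵀ
    c := R.c ∘ₗ LinearMap.mulLeft K g⁻¹.1ᵀ ∘ₗ LinearMap.mulRight K g⁻¹.1
    a_a := fun A A' h h' => by
      have := R.a_a _ _ (tr A h) (tr A' h')
      simpa [mul_assoc, c1, mul_sub, sub_mul] using this
    a_b := fun A M h => by
      have := R.a_b _ (g.1 * (M * g.1ᵀ)) (tr A h)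
      simpa only [LinearMap.comp_apply, LinearMap.mulLeft_apply, LinearMap.mulRight_apply,
        mul_assoc, c1, c2, mul_add, add_mul, transpose_mul, map_add] using this
    a_c := fun A M h => by
      have := R.a_c _ (g⁻¹.1ᵀ * (M * g⁻¹.1)) (tr A h)
      simpa only [LinearMap.comp_apply, LinearMap.mulLeft_apply, LinearMap.mulRight_apply,
        mul_assoc, c1, c2, mul_add, add_mul, transpose_mul, map_add] using this
    b_c := fun M M' => by
      have := R.b_c (g.1 * (M * g.1ᵀ)) (g⁻¹.1ᵀ * (M' * g⁻¹.1))
      simpa only [LinearMap.comp_apply, LinearMap.mulLeft_apply, LinearMap.mulRight_apply,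
        mul_assoc, c1, c2, mul_add, add_mul, mul_sub, sub_mul, transpose_mul,
        transpose_transpose] using this
    b_b := fun M M' => R.b_b _ _
    c_c := fun M M' => R.c_c _ _
    b_transpose := fun M => by
      have := R.b_transpose (g.1 * (M * g.1ᵀ))
      simpa [mul_assoc] using this
    c_transpose := fun M => by
      have := R.c_transpose (g⁻¹.1ᵀ * (M * g⁻¹.1))
      simpa only [LinearMap.comp_apply, LinearMap.mulLeft_apply, LinearMap.mulRight_apply,
        mul_assoc, transpose_mul, transpose_transpose] using this
    a_pow := fun A h => by
      have := R.a_pow _ (tr A h)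
      have hp : ∀ k : ℕ, (g.1 * (A * g⁻¹.1)) ^ k = g.1 * (A ^ k * g⁻¹.1) := by
        intro k
        induction k with
        | zero => simp
        | succ k ih => rw [pow_succ, ih, pow_succ]; simp [mul_assoc]
      rw [hp] at this
      simpa using this }

variable {V : Type*} [AddCommGroup V] [Module K V] (R : OperatorRep p χ (Module.End K V))

lemma a_a_apply {A A' : Matrix (Fin n) (Fin n) K} (h : A.trace = 0) (h' : A'.trace = 0) (v : V) :
    R.a A (R.a A' v) = R.a A' (R.a A v) + R.a (A * A' - A' * A) v := by
  have := LinearMap.congr_fun (R.a_a A A' h h') v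
  rw [← this]; simp

lemma a_b_apply {A : Matrix (Fin n) (Fin n) K} (M) (h : A.trace = 0) (v : V) :
    R.a A (R.b M v) = R.b M (R.a A v) + R.b (A * M + M * Aᵀ) v := by
  have := LinearMap.congr_fun (R.a_b A M h) v
  rw [← this]; simp

lemma a_c_apply {A : Matrix (Fin n) (Fin n) K} (M) (h : A.trace = 0) (v : V) :
    R.a A (R.c M v) = R.c M (R.a A v) - R.c (Aᵀ * M + M * A) v := by
  have := LinearMap.congr_fun (R.a_c A M h) v
  rw [LinearMap.neg_apply] at this
  rw [sub_eq_add_neg, ← this]; simp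

lemma c_b_apply (M M' : Matrix (Fin n) (Fin n) K) (v : V) :
    R.c M' (R.b M v) = R.a ((M + Mᵀ) * (M' - M'ᵀ)) v - R.b M (R.c M' v) := by
  have := LinearMap.congr_fun (R.b_c M M') v
  rw [← this]; simp

lemma c_c_apply (M M' : Matrix (Fin n) (Fin n) K) (v : V) :
    R.c M (R.c M' v) = -R.c M' (R.c M v) := by
  have := LinearMap.congr_fun (R.c_c M M') v
  exact eq_neg_of_add_eq_zero_left this

end OperatorRep

end Periplectic

/-! ### Whittaker vectors and the lower bound for invariant subspaces -/

namespace Periplectic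

namespace OperatorRep

variable {K : Type*} [Field K] {n p : ℕ} {χ : Matrix (Fin n) (Fin n) K →ₗ[K] K}
variable {V : Type*} [AddCommGroup V] [Module K V] (R : OperatorRep p χ (Module.End K V))

lemma trace_single_of_ne {i j : Fin n} (h : i ≠ j) : (single i j (1 : K)).trace = 0 := by
  simp [h]

lemma single_pow_of_ne {i j : Fin n} (h : i ≠ j) {k : ℕ} (hk : 2 ≤ k) :
    (single i j (1 : K)) ^ k = 0 := by
  obtain ⟨m, rfl⟩ := Nat.exists_eq_add_of_le hk
  rw [pow_add, pow_two, single_mul_single_of_ne _ _ _ _ h.symm, zero_mul]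

lemma a_single_pow [Fact p.Prime] {i j : Fin n} (h : i ≠ j) :
    R.a (single i j 1) ^ p = algebraMap K _ (χ (single i j 1) ^ p) := by
  have := R.a_pow _ (trace_single_of_ne h)
  rwa [single_pow_of_ne h (Fact.out : p.Prime).two_le, map_zero, sub_zero] at this

/-- The p-th power map is additive on commuting operators, and a root vector has zero p-th matrix
power. Its only possible eigenvalue is therefore the value of χ, so a nonzero subspace stable under
it contains an eigenvector with that value. -/
lemma a_single_sub_pow [Fact p.Prime] [CharP K p] {i j : Fin n} (h : i ≠ j) :
    (R.a (single i j 1) - algebraMap K _ (χ (single i j 1))) ^ p = 0 := by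
  cases subsingleton_or_nontrivial V
  · exact Subsingleton.elim _ _
  have : CharP (Module.End K V) p :=
    charP_of_injective_algebraMap (algebraMap K (Module.End K V)).injective p
  rw [sub_pow_char_of_commute p (Algebra.commutes _ _).symm, R.a_single_pow h,
    ← map_pow (algebraMap K (Module.End K V)), sub_self]

lemma c_mul_self (h2 : (2 : K) ≠ 0) (M : Matrix (Fin n) (Fin n) K) : R.c M * R.c M = 0 := by
  have h := R.c_c M M
  rw [← two_smul K] at h
  exact (smul_eq_zero.1 h).resolve_left h2

lemma c_single_self (h2 : (2 : K) ≠ 0) (i : Fin n) : R.c (single i i 1) = 0 := by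
  have h := R.c_transpose (single i i 1)
  rw [transpose_single, eq_neg_iff_add_eq_zero, ← two_smul K] at h
  exact (smul_eq_zero.1 h).resolve_left h2

lemma c_single_swap (i j : Fin n) : R.c (single j i 1) = -R.c (single i j 1) := by
  rw [← R.c_transpose, transpose_single]

/-- One column of the Whittaker conditions: imposing them on a subspace `W` that is stable under
the operators involved divides its dimension at least by `2p` for each entry of the column. -/
lemma column_step [Fact p.Prime] [CharP K p] [FiniteDimensional K V] (h2 : (2 : K) ≠ 0)
    (hn : (n : K) ≠ 0) {k k₁ : Fin n}
    (hk : k < k₁) (hkk : ∀ j, k < j ↔ j = k₁ ∨ k₁ < j)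
    (hχ₁ : χ (single k₁ k 1) ≠ 0) (hχ : ∀ j, k₁ < j → χ (single j k 1) = 0)
    {W : Submodule K V} (hW : W ≠ ⊥)
    (hx : ∀ j, k < j → ∀ w ∈ W, R.a (single j k 1) w ∈ W)
    (hy : ∀ j, k₁ < j → ∀ w ∈ W, R.a (single k₁ j 1) w ∈ W)
    (hy₁ : ∀ w ∈ W, R.a (single k₁ k₁ 1 - (n : K)⁻¹ • 1) w ∈ W)
    (hc : ∀ M, ∀ w ∈ W, R.c M w ∈ W)
    (hb : ∀ j, k < j → ∀ w ∈ W, R.b (single k₁ j 1) w ∈ W) :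
    ∃ W' : Submodule K V, (∀ w, w ∈ W' ↔ w ∈ W ∧
      (∀ j, k < j → R.a (single j k 1) w = χ (single j k 1) • w) ∧
      ∀ j, k < j → R.c (single k j 1) w = 0) ∧ W' ≠ ⊥ ∧
      (2 * p) ^ (Finset.univ.filter (k < ·)).card * Module.finrank K W' ≤
        Module.finrank K W := by
  set s := χ (single k₁ k 1) with hs
  have hp := (Fact.out : p.Prime).two_le
  have tr₁ : (single k₁ k₁ 1 - (n : K)⁻¹ • 1 : Matrix (Fin n) (Fin n) K).trace = 0 := by
    simp [hn]
  set J := Finset.univ.filter (fun j : Fin n => k₁ < j) with hJ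
  have memJ : ∀ j, j ∈ J ↔ k₁ < j := fun j => by simp [hJ]
  have cardJ : (Finset.univ.filter (k < ·)).card = J.card + 1 := by
    rw [← Finset.card_insert_of_notMem (a := k₁) (s := J) (by simp [hJ])]
    congr 1
    ext j
    simp [hJ, hkk]
  -- first stage
  set D₁ : Module.End K V := R.a (single k₁ k 1) - algebraMap K _ s with hD₁
  have D₁_apply : ∀ w, D₁ w = R.a (single k₁ k 1) w - s • w := fun w => by simp [hD₁]
  set W₁ := W ⊓ LinearMap.ker D₁ with hW₁
  have mem₁ : ∀ w, w ∈ W₁ ↔ w ∈ W ∧ R.a (single k₁ k 1) w = s • w := fun w => by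
    simp [hW₁, D₁_apply, sub_eq_zero]
  have W₁ne : W₁ ≠ ⊥ := by
    refine inf_ker_ne_bot_of_pow (q := p) hW (fun w hw => ?_) (fun w _ => ?_)
    · rw [D₁_apply]
      exact W.sub_mem (hx _ hk w hw) (W.smul_mem _ hw)
    · rw [hD₁, hs, R.a_single_sub_pow hk.ne', LinearMap.zero_apply]
  -- The partner is minus a diagonal element, made traceless with the help of 1/n: the bracket of
  -- E_{k₁k} with it is E_{k₁k} itself, which is `s + D₁`. Hence `t = 1`.
  have dim₁ : p * Module.finrank K W₁ ≤ Module.finrank K W := by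
    refine char_mul_finrank_inf_ker_le p (Y := -R.a (single k₁ k₁ 1 - (n : K)⁻¹ • 1))
      (s := s) (t := 1) (fun w hw => W.neg_mem (hy₁ w hw)) hχ₁ fun w hw => ?_
    have e : (single k₁ k 1 * (single k₁ k₁ 1 - (n : K)⁻¹ • 1) -
        (single k₁ k₁ 1 - (n : K)⁻¹ • 1) * single k₁ k 1 : Matrix (Fin n) (Fin n) K) =
        -single k₁ k 1 := by
      rw [mul_sub, sub_mul, single_mul_single_of_ne _ _ _ _ hk.ne, single_mul_single_same]
      simp only [Matrix.mul_smul, Matrix.smul_mul, mul_one, one_mul]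
      abel
    have e' := R.a_a_apply (trace_single_of_ne hk.ne') tr₁ w
    rw [e] at e'
    generalize R.a (single k₁ k₁ 1 - (n : K)⁻¹ • 1) = Y at e' ⊢
    simp only [D₁_apply, LinearMap.neg_apply, map_neg, map_sub, map_smul, one_smul, e']
    module
  -- second stage
  have ne_of : ∀ {j}, k₁ < j → k ≠ j := fun h => (hk.trans h).ne
  set W₂ := W₁ ⊓ ⨅ j ∈ J, LinearMap.ker (R.a (single j k 1)) with hW₂
  have mem₂ : ∀ w, w ∈ W₂ ↔ w ∈ W₁ ∧ ∀ j, k₁ < j → R.a (single j k 1) w = 0 := fun w => by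
    simp [hW₂, memJ, Submodule.mem_iInf]
  have comm_x : ∀ i j, k < i → k < j → ∀ w, R.a (single i k 1) (R.a (single j k 1) w) =
      R.a (single j k 1) (R.a (single i k 1) w) := fun i j hi hj w => by
    rw [R.a_a_apply (trace_single_of_ne hi.ne') (trace_single_of_ne hj.ne')]
    simp [single_mul_single_of_ne _ _ _ _ hi.ne, single_mul_single_of_ne _ _ _ _ hj.ne]
  have comm_y : ∀ i j, k < i → k₁ < j → i ≠ j → ∀ w,
      R.a (single i k 1) (R.a (single k₁ j 1) w) =
      R.a (single k₁ j 1) (R.a (single i k 1) w) := fun i j hi hj hij w => by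
    rw [R.a_a_apply (trace_single_of_ne hi.ne') (trace_single_of_ne hj.ne)]
    simp [single_mul_single_of_ne _ _ _ _ hk.ne, single_mul_single_of_ne _ _ _ _ hij.symm]
  have hx₁ : ∀ j, k₁ < j → ∀ w ∈ W₁, R.a (single j k 1) w ∈ W₁ := fun j hj w hw => by
    rw [mem₁] at hw ⊢
    refine ⟨hx j (hk.trans hj) w hw.1, ?_⟩
    rw [comm_x _ _ hk (hk.trans hj), hw.2, map_smul]
  have hy₁ : ∀ j, k₁ < j → ∀ w ∈ W₁, R.a (single k₁ j 1) w ∈ W₁ := fun j hj w hw => by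
    rw [mem₁] at hw ⊢
    refine ⟨hy j hj w hw.1, ?_⟩
    rw [comm_y _ _ hk hj hj.ne, hw.2, map_smul]
  -- The partner of E_{jk} is E_{k₁j}. Their bracket is -E_{k₁k}, which acts on `W₁` by the nonzero
  -- scalar `-s`; for different indices the brackets vanish.
  obtain ⟨W₂ne, dim₂⟩ := pow_card_mul_finrank_inf_iInf_ker_le p J
    (fun j => R.a (single j k 1)) (fun j => R.a (single k₁ j 1))
    (fun j hj => hx₁ j ((memJ j).1 hj)) (fun j hj => hy₁ j ((memJ j).1 hj))
    (fun j hj l hl _ w _ h0 => by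
      simp only [memJ] at hj hl
      rw [comm_x _ _ (hk.trans hl) (hk.trans hj), h0, map_zero])
    (fun j hj l hl hjl w _ h0 => by
      simp only [memJ] at hj hl
      rw [comm_y _ _ (hk.trans hl) hj hjl.symm, h0, map_zero])
    (fun j hj W' hW' hDW' hYW' hne => by
      simp only [memJ] at hj
      constructor
      · refine inf_ker_ne_bot_of_pow (q := p) hne hDW' (fun w _ => ?_)
        rw [R.a_single_pow (hk.trans hj).ne', hχ j hj,
          zero_pow (Fact.out : p.Prime).ne_zero, map_zero, LinearMap.zero_apply]
      · refine char_mul_finrank_inf_ker_le p (s := -s) (t := 0) hYW'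
          (neg_ne_zero.2 hχ₁) fun w hw => ?_
        rw [R.a_a_apply (trace_single_of_ne (hk.trans hj).ne') (trace_single_of_ne hj.ne),
          single_mul_single_of_ne _ _ _ _ hk.ne, single_mul_single_same, mul_one, zero_sub,
          map_neg, LinearMap.neg_apply, ((mem₁ w).1 (hW' hw)).2]
        module) W₁ne
  -- third stage
  set W₃ := W₂ ⊓ ⨅ j ∈ J, LinearMap.ker (R.c (single k j 1)) with hW₃
  have mem₃ : ∀ w, w ∈ W₃ ↔ w ∈ W₂ ∧ ∀ j, k₁ < j → R.c (single k j 1) w = 0 := fun w => by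
    simp [hW₃, memJ, Submodule.mem_iInf]
  have mem₂' : ∀ w, w ∈ W₂ ↔ w ∈ W ∧
      ∀ j, k < j → R.a (single j k 1) w = χ (single j k 1) • w := fun w => by
    rw [mem₂, mem₁, and_assoc]
    refine and_congr_right fun _ => ⟨fun h j hj => ?_, fun h => ⟨h k₁ hk, fun j hj => ?_⟩⟩
    · rcases (hkk j).1 hj with rfl | hj
      · exact h.1
      · rw [h.2 j hj, hχ j hj, zero_smul]
    · rw [h j (hk.trans hj), hχ j hj, zero_smul]
  have hc₂ : ∀ j, k < j → ∀ w ∈ W₂, R.c (single k j 1) w ∈ W₂ := fun j hj w hw => by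
    rw [mem₂'] at hw ⊢
    refine ⟨hc _ w hw.1, fun i hi => ?_⟩
    have e : R.c ((single i k 1)ᵀ * single k j 1 + single k j 1 * single i k 1) = 0 := by
      rw [transpose_single, single_mul_single_of_ne _ _ _ _ hi.ne', zero_add]
      by_cases hij : j = i
      · subst hij; rw [single_mul_single_same, mul_one, R.c_single_self h2]
      · rw [single_mul_single_of_ne _ _ _ _ hij, map_zero]
    rw [R.a_c_apply _ (trace_single_of_ne hi.ne'), e, hw.2 i hi, map_smul, LinearMap.zero_apply,
      sub_zero]
  have hb₂ : ∀ j, k < j → ∀ w ∈ W₂, R.b (single k₁ j 1) w ∈ W₂ := fun j hj w hw => by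
    rw [mem₂'] at hw ⊢
    refine ⟨hb j hj w hw.1, fun i hi => ?_⟩
    rw [R.a_b_apply _ (trace_single_of_ne hi.ne'), transpose_single,
      single_mul_single_of_ne _ _ _ _ hk.ne, single_mul_single_of_ne _ _ _ _ hj.ne', zero_add,
      map_zero, hw.2 i hi, map_smul, LinearMap.zero_apply, add_zero]
  -- The anticommutator is -δ_{ij} E_{k₁k} - δ_{k₁i} E_{jk}, and on `W₂` both root vectors act by
  -- the values of χ. The second term survives only for i = j = k₁, where it doubles the first.
  have pair : ∀ i j, k < i → k < j → ∀ w ∈ W₂, R.c (single k i 1) (R.b (single k₁ j 1) w) =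
      (-((if j = i then s else 0) + if j = k₁ ∧ k₁ = i then s else 0)) • w -
        R.b (single k₁ j 1) (R.c (single k i 1) w) := fun i j hi hj w hw => by
    rw [R.c_b_apply, transpose_single, transpose_single, add_mul, mul_sub, mul_sub,
      single_mul_single_of_ne _ _ _ _ hj.ne', single_mul_single_of_ne _ _ _ _ hk.ne', zero_sub,
      zero_sub]
    rw [mem₂'] at hw
    congr 1
    by_cases h1 : j = i
    · subst h1
      by_cases h3 : k₁ = j
      · subst h3
        simp [single_mul_single_same, hw.2 _ hk, ← hs, add_smul]
      · rw [single_mul_single_same, single_mul_single_of_ne _ _ _ _ h3]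
        simp [hw.2 _ hk, ← hs, h3]
    · rw [single_mul_single_of_ne _ _ _ _ h1]
      by_cases h3 : k₁ = i
      · subst h3
        have : k₁ < j := ((hkk j).1 hj).resolve_left h1
        simp [single_mul_single_same, hw.2 j hj, hχ j this, h1]
      · rw [single_mul_single_of_ne _ _ _ _ h3]
        simp [h1, h3]
  have sq : ∀ M, ∀ w : V, ((R.c M) ^ 2) w = 0 := fun M w => by
    rw [pow_two, R.c_mul_self h2, LinearMap.zero_apply]
  obtain ⟨W₃ne, dim₃⟩ := pow_card_mul_finrank_inf_iInf_ker_le 2 J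
    (fun j => R.c (single k j 1)) (fun j => R.b (single k₁ j 1))
    (fun j hj => hc₂ j (hk.trans ((memJ j).1 hj))) (fun j hj => hb₂ j (hk.trans ((memJ j).1 hj)))
    (fun j _ l _ _ w _ h0 => by rw [R.c_c_apply, h0, map_zero, neg_zero])
    (fun j hj l hl hjl w hw h0 => by
      simp only [memJ] at hj hl
      rw [pair _ _ (hk.trans hl) (hk.trans hj) w hw, h0]
      simp [hjl, hl.ne])
    (fun j hj W' hW' hDW' hYW' hne => by
      simp only [memJ] at hj
      refine ⟨inf_ker_ne_bot_of_pow (q := 2) hne hDW' fun w _ => sq _ w, ?_⟩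
      refine two_mul_finrank_inf_ker_le (s := -s) hYW' (neg_ne_zero.2 hχ₁) fun w hw h0 => ?_
      rw [pair _ _ (hk.trans hj) (hk.trans hj) w (hW' hw), h0]
      simp [hj.ne]) W₂ne
  -- fourth stage
  have W₃₂ : W₃ ≤ W₂ := inf_le_left
  have hc₃ : ∀ w ∈ W₃, R.c (single k k₁ 1) w ∈ W₃ := fun w hw => by
    rw [mem₃] at hw ⊢
    refine ⟨hc₂ _ hk w hw.1, fun j hj => ?_⟩
    rw [R.c_c_apply, hw.2 j hj, map_zero, neg_zero]
  have hb₃ : ∀ w ∈ W₃, R.b (single k₁ k₁ 1) w ∈ W₃ := fun w hw => by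
    rw [mem₃] at hw ⊢
    refine ⟨hb₂ _ hk w hw.1, fun j hj => ?_⟩
    rw [pair _ _ (hk.trans hj) hk w hw.1, hw.2 j hj]
    simp [hj.ne]
  have W₄ne := inf_ker_ne_bot_of_pow (q := 2) W₃ne hc₃ fun w _ => sq _ w
  -- At j = k₁ the scalar is `-2s` instead of `-s`, still invertible since 2 is.
  have dim₄ := two_mul_finrank_inf_ker_le (s := -(s + s)) hb₃
    (neg_ne_zero.2 (by rw [← two_mul]; exact mul_ne_zero h2 hχ₁))
    (D := R.c (single k k₁ 1)) fun w hw h0 => by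
      rw [pair _ _ hk hk w (W₃₂ hw), h0]
      simp
  refine ⟨W₃ ⊓ LinearMap.ker (R.c (single k k₁ 1)), fun w => ?_, W₄ne, ?_⟩
  · rw [Submodule.mem_inf, mem₃, mem₂', LinearMap.mem_ker, and_assoc, and_assoc]
    refine and_congr_right fun _ => and_congr_right fun _ => ⟨fun h j hj => ?_, fun h =>
      ⟨fun j hj => h j (hk.trans hj), h _ hk⟩⟩
    rcases (hkk j).1 hj with rfl | hj
    · exact h.2
    · exact h.1 j hj
  -- The four stages contribute the factors p, p^|J|, 2^|J| and 2.
  · rw [cardJ]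
    refine le_trans ?_ dim₁
    refine le_trans ?_ (Nat.mul_le_mul_left p dim₂)
    refine le_trans ?_ (Nat.mul_le_mul_left p (Nat.mul_le_mul_left _ dim₃))
    refine le_trans (le_of_eq ?_) (Nat.mul_le_mul_left p (Nat.mul_le_mul_left _
      (Nat.mul_le_mul_left _ dim₄)))
    ring

/-- Every nonzero stable subspace has dimension at least `(2p)^(n(n-1)/2)`, for a linear form that
on strictly lower triangular matrices is supported, without zeros, on the first subdiagonal. -/
theorem prod_le_finrank [Fact p.Prime] [CharP K p] [FiniteDimensional K V] (h2 : (2 : K) ≠ 0)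
    (hn : (n : K) ≠ 0) (hχ₁ : ∀ k i : Fin n, k.val + 1 = i.val → χ (single i k 1) ≠ 0)
    (hχ : ∀ k i : Fin n, k.val + 1 < i.val → χ (single i k 1) = 0)
    {N : Submodule K V} (hN : N ≠ ⊥) (ha : ∀ A, A.trace = 0 → ∀ w ∈ N, R.a A w ∈ N)
    (hb : ∀ M, ∀ w ∈ N, R.b M w ∈ N) (hc : ∀ M, ∀ w ∈ N, R.c M w ∈ N) :
    ∏ k : Fin n, (2 * p) ^ (Finset.univ.filter (k < ·)).card ≤ Module.finrank K N := by
  -- The odd conditions are imposed for all `j`, not only `j > l`. By skew-symmetry the others are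
  -- automatic or belong to earlier columns, and in this form a whole row of lower odd elements
  -- annihilates `W`, which makes stability easy to check.
  have main : ∀ m : ℕ, m ≤ n → ∃ W : Submodule K V, (∀ w, w ∈ W ↔ w ∈ N ∧ ∀ l : Fin n, l.val < m →
      (∀ i, l < i → R.a (single i l 1) w = χ (single i l 1) • w) ∧
      ∀ j, R.c (single l j 1) w = 0) ∧ W ≠ ⊥ ∧
      (∏ k ∈ Finset.univ.filter (fun k : Fin n => k.val < m),
        (2 * p) ^ (Finset.univ.filter (k < ·)).card) * Module.finrank K W ≤
        Module.finrank K N := by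
    intro m
    induction m with
    | zero => intro _; exact ⟨N, by simp, hN, by simp⟩
    | succ m ih =>
      intro hm
      obtain ⟨W, hW, hne, hdim⟩ := ih (by omega)
      set k : Fin n := ⟨m, hm⟩ with hk
      have hfil : Finset.univ.filter (fun k : Fin n => k.val < m + 1) =
          insert k (Finset.univ.filter (fun k : Fin n => k.val < m)) := by
        ext l
        simp only [Finset.mem_filter, Finset.mem_univ, true_and, Finset.mem_insert, hk, Fin.ext_iff]
        omega
      have step : ∃ W' : Submodule K V, (∀ w, w ∈ W' ↔ w ∈ W ∧
          (∀ j, k < j → R.a (single j k 1) w = χ (single j k 1) • w) ∧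
          ∀ j, k < j → R.c (single k j 1) w = 0) ∧ W' ≠ ⊥ ∧
          (2 * p) ^ (Finset.univ.filter (k < ·)).card * Module.finrank K W' ≤
            Module.finrank K W := by
        -- The last column has no entries below the diagonal and imposes nothing.
        by_cases hlast : m + 1 = n
        · have hno : ∀ j, ¬ k < j := fun j hj => by
            have := j.2
            simp only [hk, Fin.lt_def] at hj
            omega
          exact ⟨W, by simp [hno], hne, by simp [hno]⟩
        set k₁ : Fin n := ⟨m + 1, by omega⟩ with hk₁
        -- stability of `W` under matrices whose rows up to the `k`-th are scalar
        have stab : ∀ (A : Matrix (Fin n) (Fin n) K) (t : K), A.trace = 0 →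
            (∀ l i : Fin n, l.val ≤ m → A l i = if l = i then t else 0) →
            ∀ w ∈ W, R.a A w ∈ W := by
          intro A t hA hrow w hw
          rw [hW] at hw ⊢
          refine ⟨ha A hA w hw.1, fun l hl => ⟨fun i hi => ?_, fun j => ?_⟩⟩
          · have e : (single i l 1 * A - A * single i l 1 : Matrix (Fin n) (Fin n) K) =
                -∑ r : Fin n, (if r.val ≤ m then 0 else
                  (A r i - if r = i then t else 0)) • single r l 1 := by
              ext r q
              rw [Matrix.sub_apply, Matrix.neg_apply, Matrix.sum_apply]
              simp only [Matrix.smul_apply, single_apply, smul_eq_mul]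
              rw [Finset.sum_eq_single r (fun b _ hb => by simp [hb]) (by simp)]
              by_cases hlq : l = q
              · subst hlq
                rw [mul_single_apply_same]
                by_cases hir : i = r
                · subst hir
                  rw [single_mul_apply_same, hrow l l hl.le]
                  by_cases him : i.val ≤ m
                  · simp [him, hrow i i him]
                  · simp [him]
                · rw [single_mul_apply_of_ne _ _ _ _ _ (Ne.symm hir)]
                  by_cases hrm : r.val ≤ m
                  · simp [hrm, hrow r i hrm, Ne.symm hir]
                  · simp [hrm, Ne.symm hir]
              · rw [mul_single_apply_of_ne _ _ _ _ _ (Ne.symm hlq)]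
                by_cases hir : i = r
                · subst hir
                  rw [single_mul_apply_same, hrow l q hl.le]
                  simp [hlq]
                · rw [single_mul_apply_of_ne _ _ _ _ _ (Ne.symm hir)]
                  simp [hlq]
            rw [R.a_a_apply (trace_single_of_ne hi.ne') hA, e, (hw.2 l hl).1 i hi, map_smul,
              map_neg, map_sum, LinearMap.neg_apply, LinearMap.sum_apply,
              Finset.sum_eq_zero, neg_zero, add_zero]
            intro r _
            by_cases hr : r.val ≤ m
            · simp [hr]
            · rw [map_smul, LinearMap.smul_apply, (hw.2 l hl).1 r (Fin.lt_def.2 (by omega)),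
                hχ l r (by omega), zero_smul, smul_zero]
          -- Everything stays in row `l`, and all lower odd elements of that row annihilate `w`.
          · have e : (Aᵀ * single l j 1 + single l j 1 * A : Matrix (Fin n) (Fin n) K) =
                t • single l j 1 + ∑ q : Fin n, A j q • single l q 1 := by
              ext r q
              rw [Matrix.add_apply, Matrix.add_apply, Matrix.sum_apply]
              simp only [Matrix.smul_apply, single_apply, smul_eq_mul]
              rw [Finset.sum_eq_single q (fun b _ hb => by simp [hb]) (by simp)]
              congr 1
              · by_cases hjq : j = q
                · subst hjq
                  rw [mul_single_apply_same, transpose_apply, hrow l r hl.le]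
                  simp
                · rw [mul_single_apply_of_ne _ _ _ _ _ (Ne.symm hjq)]
                  simp [hjq]
              · by_cases hlr : l = r
                · subst hlr
                  rw [single_mul_apply_same]; simp
                · rw [single_mul_apply_of_ne _ _ _ _ _ (Ne.symm hlr)]
                  simp [hlr]
            have h0 := R.a_c_apply (single l j 1) hA w
            rw [(hw.2 l hl).2 j, map_zero, e, map_add, map_smul, map_sum, LinearMap.add_apply,
              LinearMap.smul_apply, (hw.2 l hl).2 j, LinearMap.sum_apply, Finset.sum_eq_zero] at h0
            · simpa using h0.symm
            · intro q _
              rw [map_smul, LinearMap.smul_apply, (hw.2 l hl).2 q, smul_zero]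
        refine R.column_step h2 hn (k := k) (k₁ := k₁) (Fin.lt_def.2 (by simp [hk, hk₁]))
          (fun j => ?_) (hχ₁ _ _ rfl) (fun j hj => hχ _ _ (by simpa [hk, hk₁, Fin.lt_def] using hj))
          hne (fun j hj => stab _ 0 (trace_single_of_ne hj.ne') ?_)
          (fun j hj => stab _ 0 (trace_single_of_ne hj.ne) ?_)
          (stab _ (-(n : K)⁻¹) ?_ ?_) ?_ ?_
        · simp only [hk, hk₁, Fin.lt_def, Fin.ext_iff]; omega
        · intro l i hl
          have : j ≠ l := fun h => by subst h; simp only [hk, Fin.lt_def] at hj; omega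
          simp [this]
        · intro l i hl
          have : k₁ ≠ l := fun h => by subst h; simp [hk₁] at hl
          simp [this]
        · simp [hn]
        · intro l i hl
          have : k₁ ≠ l := fun h => by subst h; simp [hk₁] at hl
          simp only [Matrix.sub_apply, single_apply, this, false_and, if_false, Matrix.smul_apply,
            one_apply, smul_eq_mul]
          split_ifs <;> simp
        · intro M w hw
          rw [hW] at hw ⊢
          refine ⟨hc M w hw.1, fun l hl => ⟨fun i hi => ?_, fun j => ?_⟩⟩
          · have e : ((single i l 1)ᵀ * M + M * single i l 1 : Matrix (Fin n) (Fin n) K) =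
                ∑ q : Fin n, M i q • single l q 1 + ∑ q : Fin n, M q i • single q l 1 := by
              rw [transpose_single]
              ext r q
              simp only [Matrix.add_apply, Matrix.sum_apply, Matrix.smul_apply, single_apply,
                smul_eq_mul]
              congr 1
              · rw [Finset.sum_eq_single q (fun b _ hb => by simp [hb]) (by simp)]
                by_cases hlr : l = r
                · subst hlr; simp
                · rw [single_mul_apply_of_ne _ _ _ _ _ (Ne.symm hlr)]; simp [hlr]
              · rw [Finset.sum_eq_single r (fun b _ hb => by simp [hb]) (by simp)]
                by_cases hlq : l = q
                · subst hlq; simp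
                · rw [mul_single_apply_of_ne _ _ _ _ _ (Ne.symm hlq)]; simp [hlq]
            rw [R.a_c_apply _ (trace_single_of_ne hi.ne'), (hw.2 l hl).1 i hi, e]
            simp only [map_add, map_sum, map_smul, LinearMap.add_apply, LinearMap.sum_apply,
              LinearMap.smul_apply, (hw.2 l hl).2, R.c_single_swap l, LinearMap.neg_apply,
              neg_zero, smul_zero, Finset.sum_const_zero, add_zero, sub_zero]
          · rw [R.c_c_apply, (hw.2 l hl).2 j, map_zero, neg_zero]
        · intro j hj w hw
          rw [hW] at hw ⊢
          refine ⟨hb _ w hw.1, fun l hl => ⟨fun i hi => ?_, fun i => ?_⟩⟩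
          · have h1 : l ≠ k₁ := fun h => by subst h; simp [hk₁] at hl
            have h3 : j ≠ l := fun h => by subst h; simp only [hk, Fin.lt_def] at hj; omega
            rw [R.a_b_apply _ (trace_single_of_ne hi.ne'), (hw.2 l hl).1 i hi, transpose_single,
              single_mul_single_of_ne _ _ _ _ h1, single_mul_single_of_ne _ _ _ _ h3]
            simp
          · have h1 : k₁ ≠ l := fun h => by subst h; simp [hk₁] at hl
            have h3 : j ≠ l := fun h => by subst h; simp only [hk, Fin.lt_def] at hj; omega
            -- The anticommutator of this `b` with the odd elements of an earlier row `l` involves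
            -- only E_{k₁l} and E_{jl}. As l < k < k₁ and j > k, both lie below the first
            -- subdiagonal.
            have h4 : R.a (single k₁ l 1) w = 0 := by
              rw [(hw.2 l hl).1 k₁ (Fin.lt_def.2 (by simp [hk₁]; omega)),
                hχ l k₁ (by simp [hk₁]; omega), zero_smul]
            have h5 : R.a (single j l 1) w = 0 := by
              simp only [hk, Fin.lt_def] at hj
              rw [(hw.2 l hl).1 j (Fin.lt_def.2 (by omega)), hχ l j (by omega), zero_smul]
            rw [R.c_b_apply, (hw.2 l hl).2 i, map_zero, sub_zero, transpose_single,
              transpose_single, add_mul, mul_sub, mul_sub, single_mul_single_of_ne _ _ _ _ h1,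
              single_mul_single_of_ne _ _ _ _ h3]
            have h6 : ∀ r s : Fin n, R.a (single r l 1) w = 0 →
                R.a (single r s 1 * single i l 1) w = 0 := by
              intro r s h
              by_cases hsi : s = i
              · subst hsi; rw [single_mul_single_same, mul_one, h]
              · rw [single_mul_single_of_ne _ _ _ _ hsi, map_zero, LinearMap.zero_apply]
            simp [-single_mul_single_same, h6 _ _ h4, h6 _ _ h5]
      obtain ⟨W', hW', hne', hdim'⟩ := step
      refine ⟨W', fun w => ?_, hne', ?_⟩
      · rw [hW', hW, and_assoc]
        refine and_congr_right fun _ => ⟨fun ⟨h, hk1, hk2⟩ l hl => ?_, fun h => ⟨fun l hl =>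
          h l (by omega), (h k (by simp [hk])).1, fun j _ => (h k (by simp [hk])).2 j⟩⟩
        rcases Nat.lt_succ_iff_lt_or_eq.1 hl with hl | hl
        · exact h l hl
        · have hlk : l = k := Fin.ext hl
          rw [hlk]
          refine ⟨hk1, fun j => ?_⟩
          rcases lt_trichotomy k j with hj | hj | hj
          · exact hk2 j hj
          · rw [← hj, R.c_single_self h2, LinearMap.zero_apply]
          · rw [R.c_single_swap, LinearMap.neg_apply, (h j hj).2 k, neg_zero]
      · rw [hfil, Finset.prod_insert (by simp [hk])]
        refine le_trans ?_ hdim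
        rw [mul_comm ((2 * p) ^ _), mul_assoc]
        exact Nat.mul_le_mul_left _ hdim'
  obtain ⟨W, -, hne, hdim⟩ := main n le_rfl
  have h1 : Finset.univ.filter (fun k : Fin n => k.val < n) = Finset.univ := by simp
  rw [h1] at hdim
  refine le_trans ?_ hdim
  -- The space of Whittaker vectors is nonzero, so its dimension can be dropped from the product.
  exact Nat.le_mul_of_pos_right _
    (Nat.pos_of_ne_zero fun h => hne (Submodule.finrank_eq_zero.1 h))

end OperatorRep

end Periplectic

/-! ### Normal form of a regular nilpotent linear form -/

namespace Periplectic

section NormalForm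

variable {K : Type*} [Field K] {n : ℕ}

/-- A linear form on matrices is a sum over the matrix units. -/
lemma linearForm_eq_trace (χ : Matrix (Fin n) (Fin n) K →ₗ[K] K) (A : Matrix (Fin n) (Fin n) K) :
    χ A = (of (fun j i => χ (single i j 1)) * A).trace := by
  conv_lhs => rw [matrix_eq_sum_single A]
  simp only [map_sum, trace, diag_apply, mul_apply, of_apply]
  rw [Finset.sum_comm]
  refine Finset.sum_congr rfl fun j _ => Finset.sum_congr rfl fun i _ => ?_
  rw [← mul_one (A i j), ← smul_eq_mul, ← smul_single, map_smul, smul_eq_mul, smul_eq_mul, mul_one,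
    mul_comm]

/-- Each factor `Y` moves the lowest nonzero coordinate of a vector up by one row and multiplies it
by a superdiagonal entry. So the last basis vector is cyclic for `Y`, and its iterates form a
triangular basis. -/
lemma upper_nilpotent_pow_apply {m : ℕ} {Y : Matrix (Fin (m + 1)) (Fin (m + 1)) K}
    (hY : ∀ i j, j ≤ i → Y i j = 0)
    (hY₁ : ∀ i j : Fin (m + 1), i.val + 1 = j.val → Y i j ≠ 0) (k : ℕ) (i : Fin (m + 1)) :
    (m < i.val + k → (Y ^ k) i (Fin.last m) = 0) ∧
      (i.val + k = m → (Y ^ k) i (Fin.last m) ≠ 0) := by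
  induction k generalizing i with
  | zero =>
    refine ⟨fun h => absurd i.2 (by omega), fun h => ?_⟩
    obtain rfl : i = Fin.last m := Fin.ext h
    simp
  | succ k ih =>
    rw [pow_succ', mul_apply]
    have h0 : ∀ j, ¬ (i < j ∧ j.val + k ≤ m) → Y i j * (Y ^ k) j (Fin.last m) = 0 := by
      intro j hj
      by_cases hij : i < j
      · rw [(ih j).1 (by by_contra h; exact hj ⟨hij, by omega⟩), mul_zero]
      · rw [hY i j (not_lt.1 hij), zero_mul]
    refine ⟨fun h => Finset.sum_eq_zero fun j _ => h0 j fun hj => ?_, fun h => ?_⟩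
    · have := Fin.lt_def.1 hj.1; omega
    · rw [Finset.sum_eq_single (⟨i.val + 1, by omega⟩ : Fin (m + 1))]
      · exact mul_ne_zero (hY₁ _ _ rfl) ((ih _).2 (by simp only; omega))
      · intro j _ hne
        refine h0 j fun hj => hne (Fin.ext ?_)
        have := Fin.lt_def.1 hj.1
        simp only
        omega
      · simp

/-- A regular nilpotent linear form can be conjugated to one that is supported, on the strictly
lower triangular matrices, on the first subdiagonal. -/
lemma exists_conj_subdiagonal (χ : Matrix (Fin n) (Fin n) K →ₗ[K] K)
    (hχ : ∀ i j : Fin n, i ≤ j → χ (single i j 1) = 0)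
    (hχ₁ : ∀ i j : Fin n, j.val + 1 = i.val → χ (single i j 1) ≠ 0) :
    ∃ g : GL (Fin n) K, ∀ k i : Fin n, k < i →
      χ (g.1 * (single i k 1 * g⁻¹.1)) = if k.val + 1 = i.val then 1 else 0 := by
  cases n with
  | zero => exact ⟨1, fun k => k.elim0⟩
  | succ m =>
  set Y : Matrix (Fin (m + 1)) (Fin (m + 1)) K := of (fun j i => χ (single i j 1)) with hY
  have hp := upper_nilpotent_pow_apply (Y := Y) (fun i j h => hχ j i h) (fun i j h => hχ₁ j i h)
  -- The columns of `P` are the Jordan chain of the last basis vector, in reverse order, so that `Y`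
  -- sends column `i` to column `i - 1`. The preceding lemma makes `P` upper triangular with nonzero
  -- diagonal.
  set P : Matrix (Fin (m + 1)) (Fin (m + 1)) K := of (fun i j => (Y ^ (m - j.val)) i (Fin.last m))
    with hP
  have hdet : P.det ≠ 0 := by
    rw [det_of_isUpperTriangular]
    · refine Finset.prod_ne_zero_iff.2 fun i _ => (hp _ i).2 ?_
      have := i.2; omega
    · intro i j hij
      refine (hp _ i).1 ?_
      have := j.2
      have : j.val < i.val := hij
      omega
  set g := GeneralLinearGroup.mkOfDetNeZero P hdet with hg
  have hgP : g.1 = P := rfl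
  refine ⟨g, fun k i hki => ?_⟩
  have hi : 1 ≤ i.val := by have := Fin.lt_def.1 hki; omega
  set i' : Fin (m + 1) := ⟨i.val - 1, by have := i.2; omega⟩ with hi'
  have hcol : ∀ r, (Y * P) r i = P r i' := fun r => by
    have e : m - i'.val = (m - i.val) + 1 := by have := i.2; simp only [hi']; omega
    simp only [hP, mul_apply, of_apply]
    rw [e, pow_succ', mul_apply]
  have hinv : g⁻¹.1 * P = 1 := by rw [← hgP, ← Units.val_mul, inv_mul_cancel, Units.val_one]
  -- In terms of `Y`, the value of the conjugated form on E_{ik} is the (k, i) entry of g⁻¹ Y g,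
  -- that is, of a Jordan block.
  rw [linearForm_eq_trace, ← hY, hgP, ← mul_assoc, ← mul_assoc, trace_mul_comm, ← mul_assoc,
    trace_mul_single, MulOpposite.op_one, one_smul]
  have : (g⁻¹.1 * (Y * P)) k i = (g⁻¹.1 * P) k i' := by
    simp only [mul_apply (M := g⁻¹.1), hcol]
  rw [this, hinv, one_apply]
  congr 1
  simp only [hi', Fin.ext_iff, eq_iff_iff]
  omega

end NormalForm

/-! ### The upper bound: spanning a highest weight module -/

namespace OperatorRep

variable {K : Type*} [Field K] {n p : ℕ} {χ : Matrix (Fin n) (Fin n) K →ₗ[K] K}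
variable {V : Type*} [AddCommGroup V] [Module K V] (R : OperatorRep p χ (Module.End K V))

/-- The lower odd elements anticommute and have square zero, so adjoining one of them at most
doubles the spanning set. The last clause says that nothing superfluous was added; it is used
afterwards to transfer stability from the generator to the whole span. -/
lemma exists_span_of_c [DecidableEq V] (h2 : (2 : K) ≠ 0) (v : V) (S : Finset (Fin n × Fin n)) :
    ∃ t : Finset V, t.card ≤ 2 ^ S.card ∧
      (∀ x ∈ Submodule.span K ((fun x : Fin n × Fin n => R.c (single x.1 x.2 1)) '' S),
        ∀ w ∈ Submodule.span K (t : Set V), x w ∈ Submodule.span K (t : Set V)) ∧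
      v ∈ t ∧
      ∀ T : Submodule K V, v ∈ T → (∀ M, ∀ w ∈ T, R.c M w ∈ T) → (t : Set V) ⊆ T := by
  induction S using Finset.induction_on with
  | empty =>
    refine ⟨{v}, by simp, ?_, by simp, fun T hv _ => by simpa using hv⟩
    intro x hx w _
    rw [Finset.coe_empty, Set.image_empty, Submodule.span_empty, Submodule.mem_bot] at hx
    rw [hx]
    exact Submodule.zero_mem _
  | insert y S hy ih =>
    obtain ⟨s, hs, hQ, hv, hmin⟩ := ih
    obtain ⟨t, ht, htQ, hst, htmin⟩ := exists_finset_extension (f := R.c (single y.1 y.2 1))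
      (q := 2) (r := 0) two_pos hQ (by rw [pow_two, R.c_mul_self h2, map_zero]) (by
        intro x hx
        refine ⟨-x, neg_mem hx, 0, zero_mem _, 0, ?_⟩
        rw [add_zero, zero_smul, add_zero]
        induction hx using Submodule.span_induction with
        | mem x hx =>
          obtain ⟨z, -, rfl⟩ := hx
          rw [mul_neg]
          exact eq_neg_of_add_eq_zero_left (R.c_c _ _)
        | zero => simp
        | add x y _ _ hx hy => rw [add_mul, hx, hy]; noncomm_ring
        | smul c x _ hx => rw [smul_mul_assoc, hx]; simp)
    refine ⟨t, ?_, fun x hx => htQ x ?_, hst hv, fun T hvT hT => htmin T (hmin T hvT hT)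
      (hT _)⟩
    · rw [Finset.card_insert_of_notMem hy, pow_succ']
      exact ht.trans (Nat.mul_le_mul_left 2 hs)
    · rwa [Finset.coe_insert, Set.image_insert_eq, Submodule.span_insert, sup_comm] at hx

lemma c_mem_span (h2 : (2 : K) ≠ 0) (M : Matrix (Fin n) (Fin n) K) :
    R.c M ∈ Submodule.span K ((fun x : Fin n × Fin n => R.c (single x.1 x.2 1)) ''
      (Finset.univ.filter fun x : Fin n × Fin n => x.2 < x.1)) := by
  rw [matrix_eq_sum_single M, map_sum]
  refine Submodule.sum_mem _ fun i _ => ?_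
  rw [map_sum]
  refine Submodule.sum_mem _ fun j _ => ?_
  rw [← mul_one (M i j), ← smul_eq_mul, ← smul_single, map_smul]
  refine Submodule.smul_mem _ _ ?_
  have key : ∀ i j : Fin n, j < i → R.c (single i j 1) ∈
      Submodule.span K ((fun x : Fin n × Fin n => R.c (single x.1 x.2 1)) ''
      (Finset.univ.filter fun x : Fin n × Fin n => x.2 < x.1)) := fun i j h =>
    Submodule.subset_span ⟨(i, j), by simpa using h, rfl⟩
  rcases lt_trichotomy i j with h | h | h
  · rw [R.c_single_swap]
    exact neg_mem (key _ _ h)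
  · subst h; rw [R.c_single_self h2]; exact zero_mem _
  · exact key _ _ h

/-- The index set of the strictly lower triangular matrix units, in lexicographic order. -/
abbrev lowerPairs (n : ℕ) : Finset (Fin n ×ₗ Fin n) :=
  Finset.univ.filter fun x => (ofLex x).2 < (ofLex x).1

/-- Root vectors are adjoined in lexicographic order, each costing a factor `p` because its p-th
power is a scalar. If (k,l) precedes (i,j), then [E_{kl}, E_{ij}] is zero or, for j = k, equals
-E_{il}. Here (i,l) precedes (i,j) too, so an initial segment is all that the commutation hypothesis
of `exists_finset_extension` requires. -/
lemma exists_span_of_a [Fact p.Prime] [DecidableEq V] {s : Finset V}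
    (hs : ∀ M, ∀ w ∈ Submodule.span K (s : Set V), R.c M w ∈ Submodule.span K (s : Set V))
    (S : Finset (Fin n ×ₗ Fin n)) (hS : S ⊆ lowerPairs n)
    (hlow : ∀ x ∈ S, ∀ y ∈ lowerPairs n, y < x → y ∈ S) :
    ∃ t : Finset V, t.card ≤ p ^ S.card * s.card ∧
      (∀ x ∈ Submodule.span K (Set.range R.c ∪
          (fun x : Fin n ×ₗ Fin n => R.a (single (ofLex x).1 (ofLex x).2 1)) '' S),
        ∀ w ∈ Submodule.span K (t : Set V), x w ∈ Submodule.span K (t : Set V)) ∧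
      (s : Set V) ⊆ t ∧
      ∀ T : Submodule K V, (s : Set V) ⊆ T → (∀ i j : Fin n, j < i → ∀ w ∈ T,
        R.a (single i j 1) w ∈ T) → (t : Set V) ⊆ T := by
  induction S using Finset.induction_on_max with
  | empty =>
    refine ⟨s, by simp, ?_, subset_rfl, fun T h _ => h⟩
    intro x hx w hw
    rw [Finset.coe_empty, Set.image_empty, Set.union_empty] at hx
    induction hx using Submodule.span_induction with
    | mem x hx => obtain ⟨M, rfl⟩ := hx; exact hs M w hw
    | zero => exact zero_mem _
    | add x y _ _ hx hy => exact add_mem hx hy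
    | smul c x _ hx => exact Submodule.smul_mem _ c hx
  | insert y S hy ih =>
    have hyS : y ∉ S := fun h => lt_irrefl _ (hy y h)
    obtain ⟨s', hs', hQ, hss, hmin⟩ := ih ((Finset.subset_insert _ _).trans hS)
      (fun x hx z hz hzx => by
        rcases Finset.mem_insert.1 (hlow x (Finset.mem_insert_of_mem hx) z hz hzx) with rfl | h
        · exact absurd (hy x hx) (not_lt.2 hzx.le)
        · exact h)
    obtain ⟨i, j, rfl⟩ : ∃ i j, y = toLex (i, j) := ⟨_, _, rfl⟩
    have hij : j < i := (Finset.mem_filter.1 (hS (Finset.mem_insert_self _ _))).2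
    have tij : (single i j (1 : K)).trace = 0 := trace_single_of_ne hij.ne'
    have hcl : ∀ l : Fin n, l < j → (toLex (i, l)) ∈ S := fun l hl => by
      have h1 : (toLex (i, l)) < toLex (i, j) := Prod.Lex.toLex_lt_toLex.2 (Or.inr ⟨rfl, hl⟩)
      rcases Finset.mem_insert.1 (hlow _ (Finset.mem_insert_self _ _) (toLex (i, l))
        (by simpa using hl.trans hij) h1) with h | h
      · exact absurd h h1.ne
      · exact h
    obtain ⟨t, ht, htQ, hst, htmin⟩ := exists_finset_extension (f := R.a (single i j 1))
      (q := p) (Fact.out : p.Prime).pos hQ (R.a_single_pow hij.ne') (by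
        intro x hx
        induction hx using Submodule.span_induction with
        | mem x hx =>
          rcases hx with ⟨M, rfl⟩ | ⟨z, hz, rfl⟩
          · refine ⟨R.c M, Submodule.subset_span (Or.inl ⟨M, rfl⟩),
              R.c ((single i j 1)ᵀ * M + M * single i j 1),
              Submodule.subset_span (Or.inl ⟨_, rfl⟩), 0, ?_⟩
            rw [zero_smul, add_zero, ← neg_neg (R.c (_ + _)), ← R.a_c _ _ tij]
            abel
          · have hzl := hS (Finset.mem_insert_of_mem hz)
            have hzy := hy z hz
            obtain ⟨k, l, rfl⟩ : ∃ k l, z = toLex (k, l) := ⟨_, _, rfl⟩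
            have hkl : l < k := (Finset.mem_filter.1 hzl).2
            have hki : k ≤ i := by
              rcases Prod.Lex.toLex_lt_toLex.1 hzy with h | h
              · exact h.le
              · exact h.1.le
            have hli : l ≠ i := (hkl.trans_le hki).ne
            refine ⟨_, Submodule.subset_span (Or.inr ⟨_, hz, rfl⟩),
              if j = k then -R.a (single i l 1) else 0, ?_, 0, ?_⟩
            · split_ifs with h
              · subst h
                exact neg_mem (Submodule.subset_span (Or.inr ⟨_, hcl l hkl, rfl⟩))
              · exact zero_mem _
            · have := R.a_a _ _ (trace_single_of_ne (K := K) hkl.ne') tij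
              rw [zero_smul, add_zero]
              change R.a (single k l 1) * R.a (single i j 1) =
                R.a (single i j 1) * R.a (single k l 1) + _
              rw [← sub_eq_iff_eq_add', this, single_mul_single_of_ne _ _ _ _ hli]
              split_ifs with h
              · subst h; simp
              · rw [single_mul_single_of_ne _ _ _ _ h]; simp
        | zero => exact ⟨0, zero_mem _, 0, zero_mem _, 0, by simp⟩
        | add x y _ _ hx hy =>
          obtain ⟨x₁, h₁, x₂, h₂, c, h⟩ := hx
          obtain ⟨y₁, g₁, y₂, g₂, d, g⟩ := hy
          refine ⟨x₁ + y₁, add_mem h₁ g₁, x₂ + y₂, add_mem h₂ g₂, c + d, ?_⟩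
          rw [add_mul, h, g, mul_add, add_smul]
          abel
        | smul e x _ hx =>
          obtain ⟨x₁, h₁, x₂, h₂, c, h⟩ := hx
          refine ⟨e • x₁, Submodule.smul_mem _ _ h₁, e • x₂, Submodule.smul_mem _ _ h₂, e * c, ?_⟩
          rw [smul_mul_assoc, h, mul_smul_comm, smul_add, smul_add, smul_smul])
    refine ⟨t, ?_, fun x hx => htQ x ?_, hss.trans hst, fun T hvT hT => htmin T (hmin T hvT hT)
      (hT i j hij)⟩
    · rw [Finset.card_insert_of_notMem hyS, pow_succ', mul_assoc]
      exact ht.trans (Nat.mul_le_mul_left p hs')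
    · rw [Finset.coe_insert, Set.image_insert_eq, Set.union_insert, Submodule.span_insert,
        sup_comm] at hx
      exact hx

/-- A representation that is generated by a highest weight vector killed by `𝔤₊₁` is spanned by
`(2p)^(n(n-1)/2)` vectors. -/
theorem exists_span_of_highestWeight [Fact p.Prime] (h2 : (2 : K) ≠ 0) (v : V)
    (ha : ∀ A, A.trace = 0 → (∀ i j, j < i → A i j = 0) → ∃ r : K, R.a A v = r • v)
    (hb : ∀ M, R.b M v = 0)
    (hgen : ∀ T : Submodule K V, v ∈ T → (∀ A, A.trace = 0 → ∀ w ∈ T, R.a A w ∈ T) →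
      (∀ M, ∀ w ∈ T, R.b M w ∈ T) → (∀ M, ∀ w ∈ T, R.c M w ∈ T) → T = ⊤) :
    ∃ t : Finset V, t.card ≤ (2 * p) ^ (lowerPairs n).card ∧
      Submodule.span K (t : Set V) = ⊤ := by
  classical
  obtain ⟨s, hs, hsc, hvs, hsmin⟩ := R.exists_span_of_c h2 v
    (Finset.univ.filter fun x : Fin n × Fin n => x.2 < x.1)
  obtain ⟨t, ht, htQ, hst, htmin⟩ := R.exists_span_of_a (fun M => hsc _ (R.c_mem_span h2 M))
    (lowerPairs n) subset_rfl (fun _ _ y hy _ => hy)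
  set D := Submodule.span K (t : Set V) with hD
  have hc : ∀ M, ∀ w ∈ D, R.c M w ∈ D := fun M =>
    htQ _ (Submodule.subset_span (Or.inl ⟨M, rfl⟩))
  have hx : ∀ i j : Fin n, j < i → ∀ w ∈ D, R.a (single i j 1) w ∈ D := fun i j h =>
    htQ _ (Submodule.subset_span (Or.inr ⟨toLex (i, j), by simpa using h, rfl⟩))
  have hvD : v ∈ D := Submodule.subset_span (hst hvs)
  have trz : ∀ M M' : Matrix (Fin n) (Fin n) K, ((M + Mᵀ) * (M' - M'ᵀ)).trace = 0 := fun M M' =>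
    trace_symm_skew K n _ _ (by simp [add_comm]) (by simp) (by simp)
  -- `T` consists of the vectors of `D` that every even and every upper odd element sends into `D`.
  -- It contains `v` and is stable under the operators that generate `D` from `v`; hence it contains
  -- `D`, and `D` is stable under the whole algebra.
  let T : Submodule K V :=
    { carrier := {w | w ∈ D ∧ (∀ A, A.trace = 0 → R.a A w ∈ D) ∧ ∀ M, R.b M w ∈ D}
      add_mem' := fun {x y} hx hy => ⟨add_mem hx.1 hy.1,
        fun A hA => by rw [map_add]; exact add_mem (hx.2.1 A hA) (hy.2.1 A hA),
        fun M => by rw [map_add]; exact add_mem (hx.2.2 M) (hy.2.2 M)⟩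
      zero_mem' := ⟨zero_mem _, fun A _ => by rw [map_zero]; exact zero_mem _,
        fun M => by rw [map_zero]; exact zero_mem _⟩
      smul_mem' := fun c x hx => ⟨Submodule.smul_mem _ _ hx.1,
        fun A hA => by rw [map_smul]; exact Submodule.smul_mem _ _ (hx.2.1 A hA),
        fun M => by rw [map_smul]; exact Submodule.smul_mem _ _ (hx.2.2 M)⟩ }
  have hvT : v ∈ T := by
    refine ⟨hvD, fun A hA => ?_, fun M => by rw [hb]; exact zero_mem _⟩
    set U : Matrix (Fin n) (Fin n) K := of fun i j => if j < i then 0 else A i j with hU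
    -- The upper triangular part keeps the diagonal, hence trace zero, and acts on `v` by a scalar;
    -- the rest is a combination of lower root vectors.
    have hAU : A = U + ∑ i, ∑ j, (if j < i then A i j else 0) • single i j 1 := by
      ext i j
      rw [Matrix.add_apply, Matrix.sum_apply, Finset.sum_eq_single i _ (by simp),
        Matrix.sum_apply, Finset.sum_eq_single j _ (by simp)]
      · by_cases h : j < i <;> simp [hU, h]
      · intro b _ hb; simp [hb]
      · intro b _ hb
        rw [Matrix.sum_apply]
        exact Finset.sum_eq_zero fun c _ => by simp [hb]
    have hUtr : U.trace = 0 := by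
      rw [← hA]
      simp [trace, hU]
    obtain ⟨r, hr⟩ := ha U hUtr (fun i j h => by simp [hU, h])
    rw [hAU, map_add, LinearMap.add_apply, hr]
    refine add_mem (Submodule.smul_mem _ _ hvD) ?_
    simp only [map_sum, LinearMap.sum_apply, map_smul, LinearMap.smul_apply]
    refine Submodule.sum_mem _ fun i _ => Submodule.sum_mem _ fun j _ => ?_
    split_ifs with h
    · exact Submodule.smul_mem _ _ (hx i j h v hvD)
    · rw [zero_smul]; exact zero_mem _
  have hTc : ∀ M, ∀ w ∈ T, R.c M w ∈ T := fun M w hw => by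
    refine ⟨hc M w hw.1, fun A hA => ?_, fun M' => ?_⟩
    · rw [R.a_c_apply _ hA]
      exact sub_mem (hc _ _ (hw.2.1 A hA)) (hc _ _ hw.1)
    · have := R.c_b_apply M' M w
      rw [eq_sub_iff_add_eq', ← eq_sub_iff_add_eq] at this
      rw [this]
      exact sub_mem (hw.2.1 _ (trz _ _)) (hc _ _ (hw.2.2 M'))
  have hTa : ∀ i j : Fin n, j < i → ∀ w ∈ T, R.a (single i j 1) w ∈ T := fun i j h w hw => by
    have tij := trace_single_of_ne (K := K) h.ne'
    refine ⟨hx i j h w hw.1, fun A hA => ?_, fun M => ?_⟩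
    · rw [R.a_a_apply hA tij]
      exact add_mem (hx i j h _ (hw.2.1 A hA)) (hw.2.1 _ (trace_comm_zero _ _))
    · have := R.a_b_apply M tij w
      rw [← sub_eq_iff_eq_add] at this
      rw [← this]
      exact sub_mem (hx i j h _ (hw.2.2 M)) (hw.2.2 _)
  -- Minimality of both spanning sets enters here.
  have hDT : D ≤ T := Submodule.span_le.2 (htmin T (hsmin T hvT hTc) hTa)
  refine ⟨t, ?_, hgen D hvD (fun A hA w hw => (hDT hw).2.1 A hA) (fun M w hw => (hDT hw).2.2 M) hc⟩
  refine ht.trans (le_of_le_of_eq (Nat.mul_le_mul_left _ hs) ?_)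
  have : (Finset.univ.filter fun x : Fin n × Fin n => x.2 < x.1).card = (lowerPairs n).card := rfl
  rw [this, mul_pow, mul_comm]

lemma prod_eq_pow_card_lowerPairs (q : ℕ) :
    ∏ k : Fin n, q ^ (Finset.univ.filter (k < ·)).card = q ^ (lowerPairs n).card := by
  rw [Finset.prod_pow_eq_pow_sum]
  congr 1
  have : (lowerPairs n).card = (Finset.univ.filter fun x : Fin n × Fin n => x.2 < x.1).card := rfl
  rw [this]
  simp only [Finset.card_filter]
  rw [Fintype.sum_prod_type_right]

end OperatorRep

end Periplectic

/-! ### A model of the Kac module on the exterior algebra of the skew-symmetric matrices -/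

namespace Periplectic

section CharP

variable {K : Type*} [Field K] (p : ℕ) [Fact p.Prime] [CharP K p]

/-- In characteristic `p`, the `p`-th power of `ad a` is `ad (a ^ p)`. -/
lemma commutator_pow_char {𝒜 : Type*} [Ring 𝒜] [Algebra K 𝒜] (a x : 𝒜) :
    ((LinearMap.mulLeft K a - LinearMap.mulRight K a) ^ p) x = a ^ p * x - x * a ^ p := by
  cases subsingleton_or_nontrivial 𝒜
  · exact Subsingleton.elim _ _
  have : CharP (Module.End K 𝒜) p :=
    charP_of_injective_algebraMap (algebraMap K (Module.End K 𝒜)).injective p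
  rw [sub_pow_char_of_commute p (LinearMap.commute_mulLeft_right (R := K) a a),
    LinearMap.pow_mulLeft, LinearMap.pow_mulRight]
  rfl

end CharP

/-- Elements `a A` of an algebra that satisfy the relations of `U_χ(𝔰𝔩(n))`. -/
structure EvenOperatorRep {K : Type*} [Field K] {n : ℕ} (p : ℕ)
    (χ : Matrix (Fin n) (Fin n) K →ₗ[K] K) (𝒜 : Type*) [Ring 𝒜] [Algebra K 𝒜] where
  a : Matrix (Fin n) (Fin n) K →ₗ[K] 𝒜
  a_a : ∀ A A', A.trace = 0 → A'.trace = 0 → a A * a A' - a A' * a A = a (A * A' - A' * A)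
  a_pow : ∀ A, A.trace = 0 → a A ^ p - a (A ^ p) = algebraMap K 𝒜 (χ A ^ p)

section Skew

variable (K : Type*) [Field K] (n : ℕ)

/-- Skew-symmetric matrices with zero diagonal. -/
def skewMat : Submodule K (Matrix (Fin n) (Fin n) K) where
  carrier := {C | Cᵀ = -C ∧ ∀ i, C i i = 0}
  add_mem' {A B} hA hB := ⟨by simp [hA.1, hB.1, add_comm], fun i => by simp [hA.2, hB.2]⟩
  zero_mem' := by simp
  smul_mem' c A hA := ⟨by simp [hA.1], fun i => by simp [hA.2]⟩

variable {K n}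

/-- The action `y ↦ -(Aᵗ y + y A)` on skew-symmetric matrices. -/
def skewAct (A : Matrix (Fin n) (Fin n) K) : skewMat K n →ₗ[K] skewMat K n :=
  LinearMap.restrict (LinearMap.mulLeft K (-Aᵀ) + LinearMap.mulRight K (-A)) (by
    intro y hy
    have := (stable_symSkew K n A (0, y) ⟨by simp, hy.1, hy.2⟩).2
    simpa [skewMat, sub_eq_add_neg] using this)

lemma skewAct_coe (A : Matrix (Fin n) (Fin n) K) (y : skewMat K n) :
    (skewAct A y : Matrix (Fin n) (Fin n) K) = -(Aᵀ * y.1 + y.1 * A) := by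
  simp [skewAct, add_comm]

/-- Left and right multiplication commute, so the p-th power of their sum is the sum of the p-th
powers; for odd `p` the sign is kept. This is the compatibility of the p-map with the action on the
lower odd part. -/
lemma skewAct_pow_char {p : ℕ} [Fact p.Prime] [CharP K p] (hp : Odd p)
    (A : Matrix (Fin n) (Fin n) K) : skewAct A ^ p = skewAct (A ^ p) := by
  have : CharP (Module.End K (Matrix (Fin n) (Fin n) K)) p ∨
      Subsingleton (Matrix (Fin n) (Fin n) K) := by
    cases subsingleton_or_nontrivial (Matrix (Fin n) (Fin n) K)
    · exact Or.inr inferInstance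
    · exact Or.inl (charP_of_injective_algebraMap (algebraMap K (Module.End K _)).injective p)
  rcases this with h | h
  · refine LinearMap.ext fun y => Subtype.ext ?_
    have e : ∀ k : ℕ, ∀ y : skewMat K n, ((skewAct A ^ k) y : Matrix (Fin n) (Fin n) K) =
        ((LinearMap.mulLeft K (-Aᵀ) + LinearMap.mulRight K (-A)) ^ k) y.1 := by
      intro k
      induction k with
      | zero => intro y; rfl
      | succ k ih => intro y; rw [pow_succ, pow_succ, Module.End.mul_apply, ih]; rfl
    rw [e, add_pow_char_of_commute p (LinearMap.commute_mulLeft_right (R := K) _ _),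
      LinearMap.pow_mulLeft, LinearMap.pow_mulRight, hp.neg_pow, hp.neg_pow, skewAct_coe]
    simp [add_comm]
  · exact LinearMap.ext fun y => Subtype.ext (Subsingleton.elim _ _)

/-- `M ↦ M - Mᵗ`. -/
def skewPart : Matrix (Fin n) (Fin n) K →ₗ[K] skewMat K n where
  toFun M := ⟨M - Mᵀ, by simp, by simp⟩
  map_add' M M' := Subtype.ext (by simp; abel)
  map_smul' r M := Subtype.ext (by simp [smul_sub])

lemma skewPart_coe (M : Matrix (Fin n) (Fin n) K) : (skewPart M).1 = M - Mᵀ := rfl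

end Skew

section Exterior

variable {K : Type*} [Field K]

/-- The space `Λ(G) ⊗ E`. -/
def ExteriorTensor (K G E : Type*) [Field K] [AddCommGroup G] [Module K G] [AddCommGroup E]
    [Module K E] : Type _ := ExteriorAlgebra K G ⊗[K] E

variable {G : Type*} [AddCommGroup G] [Module K G] {E : Type*} [AddCommGroup E] [Module K E]

instance : AddCommGroup (ExteriorTensor K G E) :=
  inferInstanceAs (AddCommGroup (ExteriorAlgebra K G ⊗[K] E))

instance : Module K (ExteriorTensor K G E) :=
  inferInstanceAs (Module K (ExteriorAlgebra K G ⊗[K] E))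

/-- The pure tensors. -/
def extMk : ExteriorAlgebra K G →ₗ[K] E →ₗ[K] ExteriorTensor K G E :=
  TensorProduct.mk K (ExteriorAlgebra K G) E

/-- The embedding of `E` as `1 ⊗ E`. -/
def extOne : E →ₗ[K] ExteriorTensor K G E := extMk 1

/-- The augmentation of the exterior algebra gives a retraction. -/
lemma extOne_injective : Function.Injective (extOne : E →ₗ[K] ExteriorTensor K G E) := by
  let f : ExteriorTensor K G E →ₗ[K] E :=
    TensorProduct.lift (LinearMap.toSpanSingleton K (E →ₗ[K] E) LinearMap.id ∘ₗ
      (ExteriorAlgebra.algebraMapInv : ExteriorAlgebra K G →ₐ[K] K).toLinearMap)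
  have hf : ∀ m, f (extOne m) = m := fun m => by
    change (LinearMap.toSpanSingleton K (E →ₗ[K] E) LinearMap.id
      ((ExteriorAlgebra.algebraMapInv : ExteriorAlgebra K G →ₐ[K] K) 1)) m = m
    simp
  exact Function.LeftInverse.injective hf

/-- Multiplication by an element of `G` on `Λ(G) ⊗ E`. -/
def wedge : G →ₗ[K] Module.End K (ExteriorTensor K G E) where
  toFun y := (LinearMap.mulLeft K (ExteriorAlgebra.ι K y)).rTensor E
  map_add' y z := TensorProduct.ext' fun x m => by
    change (ExteriorAlgebra.ι K (y + z) * x) ⊗ₜ[K] m =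
      (ExteriorAlgebra.ι K y * x) ⊗ₜ[K] m + (ExteriorAlgebra.ι K z * x) ⊗ₜ[K] m
    rw [map_add, add_mul, add_tmul]
  map_smul' r y := TensorProduct.ext' fun x m => by
    change (ExteriorAlgebra.ι K (r • y) * x) ⊗ₜ[K] m =
      r • ((ExteriorAlgebra.ι K y * x) ⊗ₜ[K] m)
    rw [map_smul, smul_mul_assoc, smul_tmul']

lemma wedge_extMk (y : G) (x : ExteriorAlgebra K G) (m : E) :
    wedge y (extMk x m) = extMk (ExteriorAlgebra.ι K y * x) m := rfl

lemma ext_of_extMk {P : Type*} [AddCommGroup P] [Module K P]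
    {f g : ExteriorTensor K G E →ₗ[K] P} (h : ∀ x m, f (extMk x m) = g (extMk x m)) : f = g :=
  TensorProduct.ext' h

lemma wedge_sq (y : G) : (wedge y * wedge y : Module.End K (ExteriorTensor K G E)) = 0 := by
  refine ext_of_extMk fun x m => ?_
  rw [Module.End.mul_apply, wedge_extMk, wedge_extMk, ← mul_assoc, ExteriorAlgebra.ι_sq_zero,
    zero_mul, map_zero, LinearMap.zero_apply, LinearMap.zero_apply]

lemma wedge_anticomm (y z : G) :
    (wedge y * wedge z + wedge z * wedge y : Module.End K (ExteriorTensor K G E)) = 0 := by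
  have h := wedge_sq (K := K) (E := E) (y + z)
  rw [map_add, add_mul, mul_add, mul_add, wedge_sq, wedge_sq, zero_add, add_zero] at h
  exact h

/-- An operator on `Λ(G) ⊗ E` that commutes, up to a scalar, with multiplication by the elements
of `G` is determined by its values on `1 ⊗ E`. -/
lemma eq_zero_of_wedge_comm {D : Module.End K (ExteriorTensor K G E)} (σ : K)
    (h1 : ∀ m, D (extOne m) = 0) (h : ∀ y, D * wedge y = σ • (wedge y * D)) : D = 0 := by
  refine ext_of_extMk fun x m => ?_
  rw [LinearMap.zero_apply]
  induction x using CliffordAlgebra.left_induction with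
  | algebraMap r =>
    rw [Algebra.algebraMap_eq_smul_one, map_smul, LinearMap.smul_apply, map_smul]
    exact (congrArg (r • ·) (h1 m)).trans (smul_zero r)
  | add x y hx hy => rw [map_add, LinearMap.add_apply, map_add, hx, hy, add_zero]
  | ι_mul x y hx =>
    have e := LinearMap.congr_fun (h y) (extMk x m)
    rw [Module.End.mul_apply, wedge_extMk, LinearMap.smul_apply, Module.End.mul_apply, hx,
      map_zero, smul_zero] at e
    exact e

/-- Operators on `Λ(G) ⊗ E` defined by recursion over the generators of the exterior algebra. -/
lemma exists_wedge_recursion {P : Type*} [AddCommGroup P] [Module K P] (σ : K)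
    (E₀ : P →ₗ[K] E →ₗ[K] ExteriorTensor K G E)
    (T : P →ₗ[K] G →ₗ[K] Module.End K (ExteriorTensor K G E))
    (hT : ∀ x y, σ • (wedge y * T x y) + T x y * wedge y = 0) :
    ∃ D : P →ₗ[K] Module.End K (ExteriorTensor K G E),
      (∀ x m, D x (extOne m) = E₀ x m) ∧
      ∀ x y, D x * wedge y = σ • (wedge y * D x) + T x y := by
  have one : ∀ x : P, ∃ D : Module.End K (ExteriorTensor K G E),
      (∀ m, D (extOne m) = E₀ x m) ∧ ∀ y, D * wedge y = σ • (wedge y * D) + T x y := by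
    intro x
    -- The recursion has to remember the exterior element next to the value already computed, since
    -- `T x y` acts on the former. The fold is well defined because y ∧ y = 0 and because of `hT`.
    let f : G →ₗ[K] ExteriorAlgebra K G × (E →ₗ[K] ExteriorTensor K G E) →ₗ[K]
        (E →ₗ[K] ExteriorTensor K G E) :=
      LinearMap.mk₂ K (fun y u => σ • (wedge y ∘ₗ u.2) + T x y ∘ₗ extMk u.1)
        (fun y z u => by
          ext m; simp; abel)
        (fun r y u => by
          ext m
          simp only [map_smul, LinearMap.add_apply, LinearMap.smul_apply, LinearMap.comp_apply,
            smul_add]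
          rw [smul_comm])
        (fun y u v => by
          ext m
          simp only [map_add, Prod.fst_add, Prod.snd_add, LinearMap.add_apply,
            LinearMap.smul_apply, LinearMap.comp_apply, smul_add]
          abel)
        (fun r y u => by
          ext m
          simp only [map_smul, Prod.smul_fst, Prod.smul_snd, LinearMap.add_apply,
            LinearMap.smul_apply, LinearMap.comp_apply, smul_add]
          rw [smul_comm])
    have f_apply : ∀ y u m, f y u m = σ • wedge y (u.2 m) + T x y (extMk u.1 m) :=
      fun _ _ _ => rfl
    have hf : ∀ y w u, f y (CliffordAlgebra.ι 0 y * w, f y (w, u)) =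
        (0 : QuadraticForm K G) y • u := by
      intro y w u
      ext m
      have h := LinearMap.congr_fun (hT x y) (extMk w m)
      have hs := LinearMap.congr_fun (wedge_sq (K := K) (E := E) y) (u m)
      rw [Module.End.mul_apply] at hs
      rw [f_apply, f_apply, map_add, map_smul, hs]
      simp only [LinearMap.zero_apply, smul_zero, zero_add, _root_.zero_apply, zero_smul]
      exact h
    let D : Module.End K (ExteriorTensor K G E) :=
      TensorProduct.lift (CliffordAlgebra.foldr' (0 : QuadraticForm K G) f hf (E₀ x))
    have D_extMk : ∀ w m, D (extMk w m) = CliffordAlgebra.foldr' 0 f hf (E₀ x) w m :=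
      fun _ _ => rfl
    refine ⟨D, fun m => ?_, fun y => ext_of_extMk fun w m => ?_⟩
    · have := CliffordAlgebra.foldr'_algebraMap (0 : QuadraticForm K G) f hf (E₀ x) 1
      rw [map_one, one_smul] at this
      change D (extMk 1 m) = _
      rw [D_extMk, this]
    · rw [Module.End.mul_apply, wedge_extMk, D_extMk]
      have := CliffordAlgebra.foldr'_ι_mul (0 : QuadraticForm K G) f hf (E₀ x) y w
      change CliffordAlgebra.foldr' 0 f hf (E₀ x) (CliffordAlgebra.ι 0 y * w) m = _
      rw [this, f_apply]
      rfl
  choose D h1 h2 using one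
  -- Linearity in `x` comes from uniqueness: the defect vanishes on 1 ⊗ E and commutes, up to σ,
  -- with multiplication by `G`.
  refine ⟨{ toFun := D, map_add' := fun x x' => ?_, map_smul' := fun r x => ?_ }, h1, h2⟩
  · rw [← sub_eq_zero]
    refine eq_zero_of_wedge_comm σ (fun m => ?_) fun y => ?_
    · simp only [LinearMap.sub_apply, LinearMap.add_apply, h1, map_add, sub_self]
    · rw [sub_mul, add_mul, h2, h2, h2, mul_sub, mul_add, map_add, LinearMap.add_apply, smul_sub,
        smul_add]
      abel
  · rw [← sub_eq_zero]
    refine eq_zero_of_wedge_comm σ (fun m => ?_) fun y => ?_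
    · simp only [LinearMap.sub_apply, LinearMap.smul_apply, h1, map_smul, sub_self,
        RingHom.id_apply]
    · rw [sub_mul, h2, RingHom.id_apply, smul_mul_assoc, h2, mul_sub, map_smul,
        LinearMap.smul_apply, smul_sub, smul_add, mul_smul_comm, smul_comm σ r]
      abel

end Exterior

section RingIdentities

variable {𝒜 : Type*} [Ring 𝒜]

/-- These identities carry commutators and anticommutators past a wedge operator. By
`eq_zero_of_wedge_comm`, a relation between operators on Λ ⊗ E then follows from its validity on 1 ⊗
E and the agreement of the correction terms. -/
lemma commutator_mul_of_comm {a a' w w₁ w₁' w₂ w₂' : 𝒜} (h : a * w = w * a + w₁)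
    (h' : a' * w = w * a' + w₁') (h₂ : a * w₁' = w₁' * a + w₂) (h₂' : a' * w₁ = w₁ * a' + w₂') :
    (a * a' - a' * a) * w = w * (a * a' - a' * a) + (w₂ - w₂') := by
  rw [sub_mul, mul_assoc, h', mul_add, ← mul_assoc, h, h₂, mul_assoc a', h, mul_add, ← mul_assoc,
    h', h₂']
  noncomm_ring

lemma commutator_mul_of_anticomm {a b w w₁ d d₁ : 𝒜} (h : a * w = w * a + w₁)
    (hb : b * w = -(w * b) + d) (hb₁ : b * w₁ = -(w₁ * b) + d₁) :
    (a * b - b * a) * w = -(w * (a * b - b * a)) + (a * d - d * a - d₁) := by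
  rw [sub_mul, mul_assoc, hb, mul_add, mul_neg, ← mul_assoc, h, mul_assoc b, h, mul_add,
    ← mul_assoc, hb, hb₁]
  noncomm_ring

lemma anticommutator_mul_of_anticomm {b b' w d d' : 𝒜} (h : b * w = -(w * b) + d)
    (h' : b' * w = -(w * b') + d') :
    (b * b' + b' * b) * w = w * (b * b' + b' * b) - (d * b' - b' * d + (d' * b - b * d')) := by
  rw [add_mul, mul_assoc, h', mul_add, mul_neg, ← mul_assoc, h, mul_assoc b', h, mul_add, mul_neg,
    ← mul_assoc, h']
  noncomm_ring

lemma sub_mul_comm_of_eq {c c' w d : 𝒜} (h : c * w = w * c + d) (h' : c' * w = w * c' + d) :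
    (c - c') * w = w * (c - c') := by
  rw [sub_mul, h, h']
  noncomm_ring

lemma sub_mul_anticomm_of_eq {c c' w d : 𝒜} (h : c * w = -(w * c) + d)
    (h' : c' * w = -(w * c') + d) : (c - c') * w = -(w * (c - c')) := by
  rw [sub_mul, h, h']
  noncomm_ring

end RingIdentities

section KacConstruction

variable {K : Type*} [Field K] {n p : ℕ} [Fact p.Prime] [CharP K p]
  {χ : Matrix (Fin n) (Fin n) K →ₗ[K] K} {E : Type*} [AddCommGroup E] [Module K E]

set_option maxHeartbeats 2000000 in
/-- The action of `𝔭(n)` on `Λ(𝔤₋₁) ⊗ E`, for a representation `E` of `𝔤₀` on which `𝔤₊₁` acts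
by zero. -/
theorem exists_exterior_operatorRep (hp : Odd p) (ρ : EvenOperatorRep p χ (Module.End K E)) :
    ∃ R : OperatorRep p χ (Module.End K (ExteriorTensor K (skewMat K n) E)),
      (∀ A m, R.a A (extOne m) = extOne (ρ.a A m)) ∧ ∀ M m, R.b M (extOne m) = 0 := by
  have tr : ∀ M (y : skewMat K n), ((M + Mᵀ) * y.1).trace = 0 := fun M y =>
    trace_symm_skew K n _ _ (by simp [add_comm]) y.2.1 y.2.2
  have act_add : ∀ A B : Matrix (Fin n) (Fin n) K, skewAct (A + B) = skewAct A + skewAct B := by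
    intro A B
    refine LinearMap.ext fun y => Subtype.ext ?_
    rw [LinearMap.add_apply, Submodule.coe_add, skewAct_coe, skewAct_coe, skewAct_coe,
      transpose_add]
    noncomm_ring
  have act_smul : ∀ (r : K) (A : Matrix (Fin n) (Fin n) K), skewAct (r • A) = r • skewAct A := by
    intro r A
    refine LinearMap.ext fun y => Subtype.ext ?_
    rw [LinearMap.smul_apply, Submodule.coe_smul, skewAct_coe, skewAct_coe, transpose_smul]
    simp
  -- The even part acts on 1 ⊗ E through `ρ` and on the exterior algebra by derivations, hence σ =
  -- 1.
  obtain ⟨a, a_one, a_wedge⟩ := exists_wedge_recursion (K := K) (G := skewMat K n) (E := E)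
    (P := Matrix (Fin n) (Fin n) K) 1
    { toFun := fun A => extOne ∘ₗ ρ.a A
      map_add' := fun A B => by rw [map_add, LinearMap.comp_add]
      map_smul' := fun r A => by rw [map_smul, LinearMap.comp_smul, RingHom.id_apply] }
    { toFun := fun A => wedge ∘ₗ skewAct A
      map_add' := fun A B => by rw [act_add, LinearMap.comp_add]
      map_smul' := fun r A => by rw [act_smul, LinearMap.comp_smul, RingHom.id_apply] }
    (fun A y => by
      rw [one_smul]
      exact wedge_anticomm _ _)
  replace a_one : ∀ A m, a A (extOne m) = extOne (ρ.a A m) := a_one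
  replace a_wedge : ∀ A y, a A * wedge y = wedge y * a A + wedge (skewAct A y) := fun A y => by
    rw [a_wedge, one_smul]; rfl
  have a_a : ∀ A A', A.trace = 0 → A'.trace = 0 →
      a A * a A' - a A' * a A = a (A * A' - A' * A) := by
    intro A A' hA hA'
    rw [← sub_eq_zero]
    refine eq_zero_of_wedge_comm 1 (fun m => ?_) fun y => ?_
    · have := LinearMap.congr_fun (ρ.a_a A A' hA hA') m
      simp only [LinearMap.sub_apply, Module.End.mul_apply] at this
      simp only [LinearMap.sub_apply, Module.End.mul_apply, a_one]
      rw [← this, map_sub, sub_self]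
    · have e : skewAct (A * A' - A' * A) y = skewAct A (skewAct A' y) -
          skewAct A' (skewAct A y) := by
        refine Subtype.ext ?_
        simp only [Submodule.coe_sub, skewAct_coe, transpose_sub, transpose_mul]
        noncomm_ring
      rw [one_smul]
      refine sub_mul_comm_of_eq (commutator_mul_of_comm (a_wedge A y) (a_wedge A' y) (a_wedge A _)
        (a_wedge A' _)) ?_
      rw [← map_sub wedge, ← e, a_wedge]
  -- The upper odd part kills 1 ⊗ E and anticommutes with `y` up to the even element S y, where S =
  -- M + Mᵗ; hence σ = -1. The consistency condition is that S y annihilates `y`: -((S y)ᵗ y + y S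
  -- y) = 0, because `y` is skew and S symmetric.
  obtain ⟨b, b_one, b_wedge⟩ := exists_wedge_recursion (K := K) (G := skewMat K n) (E := E)
    (P := Matrix (Fin n) (Fin n) K) (-1) 0
    (LinearMap.mk₂ K (fun M y => a ((M + Mᵀ) * y.1))
      (fun M M' y => by rw [← map_add, transpose_add]; congr 1; noncomm_ring)
      (fun r M y => by rw [← map_smul, transpose_smul, ← smul_add, Matrix.smul_mul])
      (fun M y z => by rw [← map_add, Submodule.coe_add, mul_add])
      (fun r M y => by rw [← map_smul, Submodule.coe_smul, Matrix.mul_smul]))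
    (fun M y => by
      rw [LinearMap.mk₂_apply, a_wedge]
      have : skewAct ((M + Mᵀ) * y.1) y = 0 := by
        refine Subtype.ext ?_
        rw [skewAct_coe, transpose_mul, y.2.1, transpose_add, transpose_transpose]
        simp only [ZeroMemClass.coe_zero]
        noncomm_ring
      rw [this, map_zero, add_zero, neg_one_smul, neg_add_cancel])
  replace b_one : ∀ M m, b M (extOne m) = 0 := b_one
  replace b_wedge : ∀ M y, b M * wedge y = -(wedge y * b M) + a ((M + Mᵀ) * y.1) := fun M y => by
    rw [b_wedge, neg_one_smul]; rfl
  have b_eq_zero : ∀ M, M + Mᵀ = 0 → b M = 0 := fun M hM =>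
    eq_zero_of_wedge_comm (-1) (b_one M) fun y => by
      rw [b_wedge, hM, zero_mul, map_zero, add_zero, neg_one_smul]
  have a_b : ∀ A M, A.trace = 0 → a A * b M - b M * a A = b (A * M + M * Aᵀ) := by
    intro A M hA
    rw [← sub_eq_zero]
    refine eq_zero_of_wedge_comm (-1) (fun m => ?_) fun y => ?_
    · simp only [LinearMap.sub_apply, Module.End.mul_apply, a_one, b_one, map_zero, sub_self]
    · have e : a ((A * M + M * Aᵀ + (A * M + M * Aᵀ)ᵀ) * y.1) =
          a A * a ((M + Mᵀ) * y.1) - a ((M + Mᵀ) * y.1) * a A -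
            a ((M + Mᵀ) * (skewAct A y).1) := by
        rw [a_a _ _ hA (tr M y), ← map_sub, skewAct_coe]
        congr 1
        simp only [transpose_add, transpose_mul, transpose_transpose]
        noncomm_ring
      rw [neg_one_smul]
      refine sub_mul_anticomm_of_eq (commutator_mul_of_anticomm (a_wedge A y) (b_wedge M y)
        (b_wedge M _)) ?_
      rw [b_wedge, e]
  refine ⟨⟨a, b, wedge ∘ₗ skewPart, a_a, a_b, ?_, ?_, ?_, ?_, ?_, ?_, ?_⟩, a_one, b_one⟩
  · intro A M _
    rw [LinearMap.comp_apply, LinearMap.comp_apply, a_wedge, add_sub_cancel_left, ← map_neg,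
      ← map_neg]
    congr 1
    refine Subtype.ext ?_
    simp only [skewAct_coe, skewPart_coe, transpose_neg, transpose_add, transpose_mul,
      transpose_transpose]
    noncomm_ring
  · intro M M'
    rw [LinearMap.comp_apply, b_wedge, skewPart_coe]
    abel
  · intro M M'
    refine eq_zero_of_wedge_comm 1 (fun m => ?_) fun y => ?_
    · simp only [LinearMap.add_apply, Module.End.mul_apply, b_one, map_zero, add_zero]
    -- The corrections from moving the anticommutator past `y` add up to `b` of a matrix with zero
    -- symmetric part, and `b` sees only the symmetric part.
    · have e := b_eq_zero (((M + Mᵀ) * y.1) * M' + M' * ((M + Mᵀ) * y.1)ᵀ +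
        (((M' + M'ᵀ) * y.1) * M + M * ((M' + M'ᵀ) * y.1)ᵀ)) (by
          simp only [transpose_add, transpose_mul, transpose_transpose, transpose_neg, y.2.1]
          noncomm_ring)
      rw [map_add, ← a_b _ _ (tr M y), ← a_b _ _ (tr M' y)] at e
      rw [anticommutator_mul_of_anticomm (b_wedge M y) (b_wedge M' y), e, sub_zero, one_smul]
  · intro M M'
    exact wedge_anticomm _ _
  · intro M
    rw [← sub_eq_zero, ← map_sub]
    exact b_eq_zero _ (by simp)
  · intro M
    rw [LinearMap.comp_apply, LinearMap.comp_apply, ← map_neg]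
    congr 1
    exact Subtype.ext (by simp [skewPart_coe])
  · intro A hA
    rw [← sub_eq_zero]
    refine eq_zero_of_wedge_comm 1 (fun m => ?_) fun y => ?_
    · have h : ∀ k : ℕ, (a A ^ k) (extOne m) = extOne ((ρ.a A ^ k) m) := by
        intro k
        induction k with
        | zero => rfl
        | succ k ih => rw [pow_succ', Module.End.mul_apply, ih, a_one, pow_succ']; rfl
      have := LinearMap.congr_fun (ρ.a_pow A hA) m
      rw [LinearMap.sub_apply, Module.algebraMap_end_apply] at this
      rw [LinearMap.sub_apply, LinearMap.sub_apply, h, a_one, ← map_sub, this,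
        Module.algebraMap_end_apply, map_smul, sub_self]
    -- The p-th power of ad (a A) is ad (a A ^ p), so `a A ^ p` and `a (A ^ p)` have the same
    -- commutator with every wedge operator.
    · have h := commutator_pow_char (K := K) p (a A) (wedge y)
      have h' : ∀ k : ℕ, ((LinearMap.mulLeft K (a A) - LinearMap.mulRight K (a A)) ^ k) (wedge y) =
          wedge ((skewAct A ^ k) y) := by
        intro k
        induction k with
        | zero => rfl
        | succ k ih =>
          rw [pow_succ', Module.End.mul_apply, ih, LinearMap.sub_apply, LinearMap.mulLeft_apply,
            LinearMap.mulRight_apply, a_wedge, pow_succ', Module.End.mul_apply,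
            add_sub_cancel_left]
      rw [h', skewAct_pow_char hp] at h
      have h3 : a A ^ p * wedge y = wedge y * a A ^ p + wedge (skewAct (A ^ p) y) := by
        rw [h]; abel
      rw [one_smul, sub_mul, sub_mul, h3, a_wedge, mul_sub, mul_sub, Algebra.commutes]
      abel

end KacConstruction

end Periplectic

/-! ### Derivations in characteristic p and Jacobson's formula -/

namespace Periplectic

section Derivations

variable {K : Type*} [Field K] (p : ℕ) [Fact p.Prime] [CharP K p] {A : Type*} [CommRing A]
  [Algebra K A] (D : Derivation K A A)

/-- Bracketing with `D` turns multiplication by `f` into multiplication by `D f`. Iterating p times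
and using (ad D)^p = ad (D^p) gives the Leibniz rule for the p-th power. -/
lemma derivation_pow_char_mul (f g : A) :
    (D.toLinearMap ^ p) (f * g) = f * (D.toLinearMap ^ p) g + (D.toLinearMap ^ p) f * g := by
  have h := commutator_pow_char (K := K) p D.toLinearMap (LinearMap.mulLeft K f)
  have h' : ∀ k : ℕ, ((LinearMap.mulLeft K D.toLinearMap - LinearMap.mulRight K D.toLinearMap) ^ k)
      (LinearMap.mulLeft K f) = LinearMap.mulLeft K ((D.toLinearMap ^ k) f) := by
    intro k
    induction k with
    | zero => rfl
    | succ k ih =>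
      rw [pow_succ', Module.End.mul_apply, ih]
      refine LinearMap.ext fun x => ?_
      have := D.leibniz ((D.toLinearMap ^ k) f) x
      simp only [smul_eq_mul] at this
      simp [pow_succ', mul_comm]
  rw [h'] at h
  have h2 := LinearMap.congr_fun h g
  simp only [LinearMap.mulLeft_apply, LinearMap.sub_apply, Module.End.mul_apply] at h2
  rw [h2]
  ring

/-- The `p`-th power of a derivation, in characteristic `p`. -/
def derivationPowChar : Derivation K A A :=
  Derivation.mk' (D.toLinearMap ^ p) fun f g => by
    rw [derivation_pow_char_mul, smul_eq_mul, smul_eq_mul, mul_comm g]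

lemma derivationPowChar_apply (f : A) : derivationPowChar p D f = (D.toLinearMap ^ p) f := rfl

open Polynomial in
/-- Application of a derivation to the coefficients of a polynomial. -/
lemma exists_coeff_derivation : ∃ D' : A[X] →ₗ[K] A[X], ∀ g k, (D' g).coeff k = D (g.coeff k) := by
  let _ : Differential A := ⟨D.restrictScalars ℤ⟩
  refine ⟨{ toFun := Differential.mapCoeffs, map_add' := fun g h => map_add _ g h,
            map_smul' := fun r g => ?_ }, fun g k => Differential.coeff_mapCoeffs g k⟩
  ext k
  rw [Differential.coeff_mapCoeffs, RingHom.id_apply, coeff_smul, coeff_smul,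
    Differential.coeff_mapCoeffs]
  exact D.map_smul r _

open Polynomial in
/-- Jacobson's formula for the `p`-th power of the sum of a derivation and a multiplication
operator. -/
theorem derivation_add_mul_pow_char (f : A) :
    ((D.toLinearMap + LinearMap.mulLeft K f) ^ p) 1 = (D.toLinearMap ^ (p - 1)) f + f ^ p := by
  obtain ⟨D', hD'⟩ := exists_coeff_derivation D
  have hp : p.Prime := Fact.out
  obtain ⟨q, rfl⟩ : ∃ q, p = q + 1 := ⟨p - 1, (Nat.succ_pred_eq_of_pos hp.pos).symm⟩
  rw [Nat.add_sub_cancel]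
  -- A formal variable is attached to `f`: the coefficients of `T ^ p` applied to 1 separate the
  -- terms by their degree in `f`, and X = 1 gives back the operator in question.
  let T : Module.End K A[X] := D' + LinearMap.mulLeft K (C f * X)
  let der : Module.End K A[X] := derivative.restrictScalars K
  have T_apply : ∀ g, T g = D' g + C f * X * g := fun _ => rfl
  have T_zero : ∀ g, (T g).coeff 0 = D (g.coeff 0) := by
    intro g
    simp [T_apply, hD', mul_assoc]
  have T_succ : ∀ g k, (T g).coeff (k + 1) = D (g.coeff (k + 1)) + f * g.coeff k := by
    intro g k
    rw [T_apply, coeff_add, hD', mul_assoc, coeff_C_mul, coeff_X_mul]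
  have T_mul : ∀ (h : A) (g), T (C h * g) = C (D h) * g + C h * T g := by
    intro h g
    ext k
    cases k <;> simp [T_zero, T_succ] <;> ring
  have T_der : T * der - der * T = -LinearMap.mulLeft K (C f) := by
    refine LinearMap.ext fun g => ?_
    change T (derivative g) - derivative (T g) = -(C f * g)
    have : derivative (D' g) = D' (derivative g) := by
      ext k
      simp only [coeff_derivative, hD']
      rw [← Nat.cast_succ, mul_comm, ← nsmul_eq_mul, ← map_nsmul, nsmul_eq_mul, mul_comm]
    rw [T_apply, T_apply, derivative_add, derivative_mul, derivative_mul, derivative_C,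
      derivative_X, this]
    ring
  -- The commutator of `T` with d/dX is multiplication by `-f`, and further commutators with `T`
  -- only differentiate `f`. The p-fold commutator is also the commutator with `T ^ p`, evaluated
  -- here at 1.
  have key : derivative ((T ^ (q + 1)) 1) = C ((D.toLinearMap ^ q) f) := by
    have h : ∀ k : ℕ, ((LinearMap.mulLeft K T - LinearMap.mulRight K T) ^ (k + 1)) der =
        -LinearMap.mulLeft K (C ((D.toLinearMap ^ k) f)) := by
      intro k
      induction k with
      | zero => simpa using T_der
      | succ k ih =>
        rw [pow_succ', Module.End.mul_apply, ih]
        refine LinearMap.ext fun g => ?_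
        change T (-(C ((D.toLinearMap ^ k) f) * g)) - -(C ((D.toLinearMap ^ k) f) * T g) =
          -(C ((D.toLinearMap ^ (k + 1)) f) * g)
        have : (D.toLinearMap ^ (k + 1)) f = D ((D.toLinearMap ^ k) f) := by rw [pow_succ']; rfl
        rw [map_neg, T_mul, this]
        ring
    have h1 := LinearMap.congr_fun ((h q).symm.trans
      (commutator_pow_char (K := K) (q + 1) T der)) 1
    change -(C ((D.toLinearMap ^ q) f) * 1) = (T ^ (q + 1)) (derivative 1) -
      derivative ((T ^ (q + 1)) 1) at h1
    rw [derivative_one, map_zero, mul_one, zero_sub] at h1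
    exact (neg_injective h1).symm
  have top : ∀ m : ℕ, ((T ^ m) 1).coeff m = f ^ m ∧ ∀ k, m < k → ((T ^ m) 1).coeff k = 0 := by
    intro m
    induction m with
    | zero =>
      refine ⟨by simp, fun k hk => ?_⟩
      simp [coeff_one, hk.ne']
    | succ m ih =>
      rw [pow_succ', Module.End.mul_apply]
      refine ⟨?_, fun k hk => ?_⟩
      · rw [T_succ, ih.1, ih.2 _ (Nat.lt_succ_self m), map_zero, zero_add, pow_succ']
      · obtain ⟨k, rfl⟩ : ∃ j, k = j + 1 := ⟨k - 1, by omega⟩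
        rw [T_succ, ih.2 _ (by omega), ih.2 _ (by omega), map_zero, mul_zero, add_zero]
  have bot : ∀ m : ℕ, D (((T ^ m) 1).coeff 0) = 0 := by
    intro m
    induction m with
    | zero => simp
    | succ m ih => rw [pow_succ', Module.End.mul_apply, T_zero, ih, map_zero]
  -- The derivative is constant and determines all coefficients of degree 1 to p - 1, whose indices
  -- are invertible. Degree p, invisible to the derivative, is the top coefficient, and the constant
  -- term vanishes since D 1 = 0.
  have hT : (T ^ (q + 1)) 1 = C ((D.toLinearMap ^ q) f) * X + C (f ^ (q + 1)) * X ^ (q + 1) := by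
    ext k
    have hq : q ≠ 0 := fun h => by subst h; exact hp.ne_one rfl
    rcases lt_trichotomy k (q + 1) with hk | rfl | hk
    · rw [coeff_add, coeff_C_mul, coeff_C_mul, coeff_X_pow, if_neg hk.ne, mul_zero, add_zero]
      cases k with
      | zero => rw [pow_succ', Module.End.mul_apply, T_zero, bot]; simp
      | succ k =>
        have h := congrArg (fun g => coeff g k) key
        simp only [coeff_derivative] at h
        rw [coeff_X]
        cases k with
        | zero => simpa using h
        | succ k =>
          rw [coeff_C_succ] at h
          have hu : IsUnit (((k + 1 : ℕ) : A) + 1) := by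
            have : ((k + 1 + 1 : ℕ) : K) ≠ 0 := by
              rw [Ne, CharP.cast_eq_zero_iff K (q + 1)]
              exact Nat.not_dvd_of_pos_of_lt (by omega) hk
            simpa using (IsUnit.mk0 _ this).map (algebraMap K A)
          rw [hu.mul_left_eq_zero] at h
          rw [h, if_neg (by omega), mul_zero]
    · rw [(top _).1, coeff_add, coeff_C_mul, coeff_C_mul, coeff_X_pow, coeff_X, if_neg (by omega)]
      simp
    · rw [(top _).2 _ hk, coeff_add, coeff_C_mul, coeff_C_mul, coeff_X_pow, coeff_X,
        if_neg (by omega), if_neg (by omega)]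
      simp
  have ev : ∀ g, eval 1 (T g) = (D.toLinearMap + LinearMap.mulLeft K f) (eval 1 g) := by
    intro g
    have : eval 1 (D' g) = D (eval 1 g) := by
      induction g using Polynomial.induction_on' with
      | add g h hg hh => rw [map_add, eval_add, eval_add, map_add, hg, hh]
      | monomial k a =>
        have : D' (monomial k a) = monomial k (D a) := by
          ext j
          rw [hD', coeff_monomial, coeff_monomial]
          split_ifs <;> simp
        rw [this]
        simp
    rw [T_apply, eval_add, this]
    simp
  have ev' : ∀ m : ℕ, eval 1 ((T ^ m) 1) = ((D.toLinearMap + LinearMap.mulLeft K f) ^ m) 1 := by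
    intro m
    induction m with
    | zero => simp
    | succ m ih => rw [pow_succ', Module.End.mul_apply, ev, ih, pow_succ', Module.End.mul_apply]
  rw [← ev', hT]
  simp

/-- A twisted form of a derivation has as `p`-th power a twisted form of the `p`-th power. -/
theorem derivation_twist_pow_char (φ g : A) :
    ((D.toLinearMap + LinearMap.mulLeft K (D φ)) ^ p) g =
      (D.toLinearMap ^ p) g + ((D.toLinearMap ^ p) φ + D φ ^ p) * g := by
  set T := D.toLinearMap + LinearMap.mulLeft K (D φ) with hT
  -- The multiplication part of `T` commutes with multiplication by `g`, so the p-fold commutator is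
  -- multiplication by D^p g. This reduces the claim to the value of `T ^ p` at 1.
  have h := commutator_pow_char (K := K) p T (LinearMap.mulLeft K g)
  have h' : ∀ k : ℕ, ((LinearMap.mulLeft K T - LinearMap.mulRight K T) ^ k)
      (LinearMap.mulLeft K g) = LinearMap.mulLeft K ((D.toLinearMap ^ k) g) := by
    intro k
    induction k with
    | zero => rfl
    | succ k ih =>
      rw [pow_succ', Module.End.mul_apply, ih]
      refine LinearMap.ext fun x => ?_
      have := D.leibniz ((D.toLinearMap ^ k) g) x
      simp only [smul_eq_mul] at this
      simp [pow_succ', this, hT]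
      ring
  rw [h'] at h
  have h2 := LinearMap.congr_fun h 1
  simp only [LinearMap.mulLeft_apply, LinearMap.sub_apply, Module.End.mul_apply, mul_one] at h2
  have h3 : (D.toLinearMap ^ p) φ = (D.toLinearMap ^ (p - 1)) (D φ) := by
    conv_lhs => rw [← Nat.sub_add_cancel (Fact.out : p.Prime).one_le, pow_succ]
    rfl
  rw [h2, hT, derivation_add_mul_pow_char, h3]
  ring

end Derivations

end Periplectic

/-! ### Right translations on the coordinate ring of matrices, and leading minors -/

namespace Periplectic

section DualNumbers

variable {K : Type*} [CommRing K] {A : Type*} [CommRing A] [Algebra K A] {B : Type*} [CommRing B]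

/-- The ring homomorphism `f ↦ e(f) + ε e(D f)` attached to a derivation `D`. -/
def derivationToDual (D : Derivation K A A) (e : A →+* B) : A →+* DualNumber B where
  toFun f := TrivSqZeroExt.inl (e f) + TrivSqZeroExt.inr (e (D f))
  map_one' := by simp
  map_mul' f g := by
    ext <;> simp [mul_comm]
  map_zero' := by simp
  map_add' f g := by
    ext <;> simp

lemma derivationToDual_apply (D : Derivation K A A) (e : A →+* B) (f : A) :
    derivationToDual D e f = TrivSqZeroExt.inl (e f) + TrivSqZeroExt.inr (e (D f)) := rfl

/-- The derivative of a determinant. -/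
lemma derivation_det {m : Type*} [Fintype m] [DecidableEq m] (D : Derivation K A A)
    (M T : Matrix m m A) (h : ∀ i j, D (M i j) = (M * T) i j) : D M.det = M.det * T.trace := by
  let inl : A →+* DualNumber A := TrivSqZeroExt.inlHom A A
  -- Over the dual numbers the hypothesis reads M + ε D(M) = M (1 + ε T); the ε-part of the
  -- determinant is the claim.
  have e : (derivationToDual D (RingHom.id A)).mapMatrix M =
      inl.mapMatrix M * (1 + (DualNumber.eps : DualNumber A) • inl.mapMatrix T) := by
    rw [mul_add, mul_one, Matrix.mul_smul, ← map_mul]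
    refine Matrix.ext fun i j => ?_
    simp only [RingHom.mapMatrix_apply, map_apply, derivationToDual_apply, RingHom.id_apply, h,
      Matrix.add_apply, Matrix.smul_apply]
    ext <;> simp [inl]
  have h1 := congrArg Matrix.det e
  rw [← RingHom.map_det, det_mul, det_one_add_smul, pow_two, DualNumber.eps_mul_eps, mul_zero,
    add_zero, ← RingHom.map_det,
    show (inl.mapMatrix T).trace = inl T.trace by simp [trace]] at h1
  have h2 := congrArg TrivSqZeroExt.snd h1
  simpa [derivationToDual_apply, inl] using h2

end DualNumbers

section Minors

variable {n : ℕ}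

/-- The rows `0, …, j - 1, i`. -/
def minorRow (j i : Fin n) (k : Fin (j.val + 1)) : Fin n :=
  if k.val < j.val then Fin.castLE j.isLt k else i

/-- The minor with rows `0, …, j - 1, i` and columns `0, …, j`. -/
def leadingMinor {S : Type*} [CommRing S] (Y : Matrix (Fin n) (Fin n) S) (j i : Fin n) : S :=
  (Y.submatrix (minorRow j i) (Fin.castLE j.isLt)).det

lemma map_leadingMinor {S T : Type*} [CommRing S] [CommRing T] (f : S →+* T)
    (Y : Matrix (Fin n) (Fin n) S) (j i : Fin n) :
    f (leadingMinor Y j i) = leadingMinor (f.mapMatrix Y) j i := by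
  rw [leadingMinor, RingHom.map_det]
  rfl

/-- The submatrix is again lower triangular, with diagonal 1, …, 1, Y i j, wherever `i` lies
relative to `j`. -/
lemma leadingMinor_of_lower {S : Type*} [CommRing S] (Y : Matrix (Fin n) (Fin n) S)
    (h1 : ∀ i, Y i i = 1) (h0 : ∀ i j, i < j → Y i j = 0) {j i : Fin n} :
    leadingMinor Y j i = Y i j := by
  rw [leadingMinor, det_of_isLowerTriangular, Fin.prod_univ_castSucc]
  · have hlast : Fin.castLE j.isLt (Fin.last j.val) = j := rfl
    have : ∀ k : Fin j.val, Y.submatrix (minorRow j i) (Fin.castLE j.isLt) k.castSucc k.castSucc =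
        1 := by
      intro k
      simp [minorRow, h1]
    rw [Finset.prod_congr rfl fun k _ => this k, Finset.prod_const_one, one_mul, submatrix_apply,
      hlast]
    simp [minorRow]
  · intro k l hkl
    have hkl' : k.val < l.val := hkl
    have : k.val < j.val := by omega
    rw [submatrix_apply, minorRow, if_pos this]
    exact h0 _ _ hkl

end Minors

section RightDerivation

open MvPolynomial

variable {K : Type*} [Field K] {n : ℕ}

/-- The generic matrix. -/
noncomputable def genericMat (K : Type*) [Field K] (n : ℕ) :
    Matrix (Fin n) (Fin n) (MvPolynomial (Fin n × Fin n) K) :=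
  of fun i j => X (i, j)

lemma genericMat_apply (i j : Fin n) : genericMat K n i j = X (i, j) := rfl

/-- The generic matrix times a matrix of scalars. -/
noncomputable def genericMul : Matrix (Fin n) (Fin n) K →ₗ[K]
    Matrix (Fin n) (Fin n) (MvPolynomial (Fin n × Fin n) K) where
  toFun A := genericMat K n * A.map C
  map_add' A B := by
    rw [← mul_add]
    congr 1
    ext i j
    simp
  map_smul' r A := by
    rw [RingHom.id_apply, ← Matrix.mul_smul]
    congr 1
    ext i j
    simp [← C_mul']

lemma genericMul_apply (A : Matrix (Fin n) (Fin n) K) (i j : Fin n) :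
    genericMul A i j = ∑ k, X (i, k) * C (A k j) := rfl

/-- The derivation of the coordinate ring of the matrices given by right multiplication. -/
noncomputable def rightDerivation : Matrix (Fin n) (Fin n) K →ₗ[K]
    Derivation K (MvPolynomial (Fin n × Fin n) K) (MvPolynomial (Fin n × Fin n) K) where
  toFun A := mkDerivation K fun ij => genericMul A ij.1 ij.2
  map_add' A B := derivation_ext fun ij => by
    rw [Derivation.add_apply, mkDerivation_X, mkDerivation_X, mkDerivation_X, map_add,
      Matrix.add_apply]
  map_smul' r A := derivation_ext fun ij => by
    rw [RingHom.id_apply, Derivation.smul_apply, mkDerivation_X, mkDerivation_X, map_smul,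
      Matrix.smul_apply]

lemma rightDerivation_X (A : Matrix (Fin n) (Fin n) K) (i j : Fin n) :
    rightDerivation A (X (i, j)) = genericMul A i j :=
  mkDerivation_X K _ (i, j)

lemma rightDerivation_genericMul (A B : Matrix (Fin n) (Fin n) K) (i j : Fin n) :
    rightDerivation A (genericMul B i j) = genericMul (A * B) i j := by
  have : genericMul (A * B) = genericMul A * B.map C := by
    change genericMat K n * (A * B).map C = genericMat K n * A.map C * B.map C
    rw [mul_assoc, ← Matrix.map_mul]
  rw [this, mul_apply, genericMul_apply, map_sum]
  refine Finset.sum_congr rfl fun k _ => ?_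
  rw [Derivation.leibniz, derivation_C, smul_zero, zero_add, smul_eq_mul, rightDerivation_X,
    mul_comm, map_apply]

lemma rightDerivation_commutator (A B : Matrix (Fin n) (Fin n) K)
    (f : MvPolynomial (Fin n × Fin n) K) :
    rightDerivation A (rightDerivation B f) - rightDerivation B (rightDerivation A f) =
      rightDerivation (A * B - B * A) f := by
  rw [← Derivation.commutator_apply]
  congr 1
  refine derivation_ext fun ⟨i, j⟩ => ?_
  rw [Derivation.commutator_apply, rightDerivation_X, rightDerivation_X,
    rightDerivation_genericMul, rightDerivation_genericMul, rightDerivation_X, map_sub,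
    Matrix.sub_apply]

/-- In characteristic `p` both sides are derivations, so they need only be compared on the
variables, where `k` applications multiply the generic matrix by A^k on the right. -/
lemma rightDerivation_pow_char (p : ℕ) [Fact p.Prime] [CharP K p] (A : Matrix (Fin n) (Fin n) K)
    (f : MvPolynomial (Fin n × Fin n) K) :
    ((rightDerivation A).toLinearMap ^ p) f = rightDerivation (A ^ p) f := by
  rw [← derivationPowChar_apply]
  congr 1
  refine derivation_ext fun ⟨i, j⟩ => ?_
  have : ∀ k : ℕ, ((rightDerivation A).toLinearMap ^ k) (X (i, j)) = genericMul (A ^ k) i j := by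
    intro k
    induction k with
    | zero => simp [genericMul_apply, one_apply, apply_ite C]
    | succ k ih =>
      rw [pow_succ', Module.End.mul_apply, ih, pow_succ']
      exact rightDerivation_genericMul _ _ _ _
  rw [derivationPowChar_apply, this, rightDerivation_X]

/-- The leading minors are eigenvectors of the upper triangular matrices. -/
lemma rightDerivation_leadingMinor {A : Matrix (Fin n) (Fin n) K} (hA : ∀ i j, j < i → A i j = 0)
    (j i : Fin n) :
    rightDerivation A (leadingMinor (genericMat K n) j i) =
      (∑ k ∈ Finset.Iic j, A k k) • leadingMinor (genericMat K n) j i := by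
  have inj : Function.Injective (Fin.castLE j.isLt : Fin (j.val + 1) → Fin n) :=
    Fin.castLE_injective _
  have himg : Finset.Iic j = Finset.univ.image (Fin.castLE j.isLt) := by
    ext k
    simp only [Finset.mem_Iic, Finset.mem_image, Finset.mem_univ, true_and]
    constructor
    · intro h
      exact ⟨⟨k.val, Nat.lt_succ_of_le h⟩, rfl⟩
    · rintro ⟨l, rfl⟩
      exact Nat.le_of_lt_succ l.isLt
  -- For upper triangular `A`, the first j + 1 columns of X A involve only the first j + 1 columns
  -- of X. The derivative of the submatrix is therefore the submatrix times the leading block of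
  -- `A`, whose trace is the eigenvalue.
  rw [leadingMinor, derivation_det (T := (A.submatrix (Fin.castLE j.isLt)
    (Fin.castLE j.isLt)).map C), mul_comm, ← C_mul']
  · congr 1
    rw [himg, Finset.sum_image fun _ _ _ _ h => inj h]
    simp [trace]
  · intro k l
    rw [submatrix_apply, genericMat_apply, rightDerivation_X, genericMul_apply, mul_apply,
      ← Finset.sum_subset (Finset.subset_univ (Finset.Iic j)), himg,
      Finset.sum_image fun _ _ _ _ h => inj h]
    · rfl
    · intro m _ hm
      have : Fin.castLE j.isLt l < m := by
        have h1 : ¬ m ≤ j := by simpa using hm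
        exact lt_of_le_of_lt (Nat.le_of_lt_succ l.isLt) (not_le.1 h1)
      rw [hA _ _ this, C_0, mul_zero]

/-- Evaluation of polynomial functions at the identity matrix. -/
noncomputable def evalOne : MvPolynomial (Fin n × Fin n) K →ₐ[K] K :=
  aeval fun ij => (1 : Matrix (Fin n) (Fin n) K) ij.1 ij.2

lemma evalOne_leadingMinor (j i : Fin n) :
    evalOne (leadingMinor (genericMat K n) j i) =
      (1 : Matrix (Fin n) (Fin n) K) i j := by
  have h : (evalOne : MvPolynomial (Fin n × Fin n) K →ₐ[K] K).toRingHom.mapMatrix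
      (genericMat K n) = 1 := by
    ext i j
    simp [evalOne, genericMat_apply]
  have := map_leadingMinor (evalOne : MvPolynomial (Fin n × Fin n) K →ₐ[K] K).toRingHom
    (genericMat K n) j i
  rw [h, leadingMinor_of_lower _ (fun i => one_apply_eq i) (fun i j h => one_apply_ne h.ne)] at this
  exact this

/-- The derivative at the identity is the ε-part of the minor at 1 + ε E_{kl}. This matrix is lower
unitriangular, so the minor is just its (i, j) entry. -/
lemma evalOne_rightDerivation_leadingMinor {k l : Fin n} (hkl : l < k) (j i : Fin n) :
    evalOne (rightDerivation (single k l 1) (leadingMinor (genericMat K n) j i)) =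
      single k l (1 : K) i j := by
  set f := derivationToDual (rightDerivation (single k l (1 : K)))
    (evalOne : MvPolynomial (Fin n × Fin n) K →ₐ[K] K).toRingHom with hf
  have h : ∀ a b, f.mapMatrix (genericMat K n) a b =
      TrivSqZeroExt.inl ((1 : Matrix (Fin n) (Fin n) K) a b) +
        TrivSqZeroExt.inr (single k l (1 : K) a b) := by
    intro a b
    rw [RingHom.mapMatrix_apply, map_apply, hf, derivationToDual_apply, genericMat_apply,
      rightDerivation_X]
    have e1 : (evalOne : MvPolynomial (Fin n × Fin n) K →ₐ[K] K).toRingHom (X (a, b)) =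
        (1 : Matrix (Fin n) (Fin n) K) a b := by simp [evalOne]
    have e2 : (evalOne : MvPolynomial (Fin n × Fin n) K →ₐ[K] K).toRingHom
        (genericMul (single k l 1) a b) = single k l (1 : K) a b := by
      rw [genericMul_apply, map_sum]
      simp [evalOne, one_apply]
    rw [e1, e2]
  have hm := map_leadingMinor f (genericMat K n) j i
  rw [leadingMinor_of_lower (f.mapMatrix _), h, hf, derivationToDual_apply] at hm
  · have h2 := congrArg TrivSqZeroExt.snd hm
    simp only [TrivSqZeroExt.snd_add, TrivSqZeroExt.snd_inl, TrivSqZeroExt.snd_inr, zero_add] at h2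
    exact h2
  · intro a
    rw [h, one_apply_eq, single_apply_of_ne]
    · simp
    · rintro ⟨rfl, rfl⟩
      exact lt_irrefl _ hkl
  · intro a b hab
    rw [h, one_apply_ne hab.ne, single_apply_of_ne]
    · simp
    · rintro ⟨rfl, rfl⟩
      exact lt_asymm hab hkl

end RightDerivation

end Periplectic

/-! ### A module with p-character χ and a vector of prescribed weight -/

namespace Periplectic

section TwistedRep

open MvPolynomial

variable {K : Type*} [Field K] {n : ℕ} (p : ℕ) [Fact p.Prime] [CharP K p]

/-- A function on matrices that is invariant under the upper triangular matrices and has a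
prescribed differential at the identity. -/
noncomputable def potential (χ : Matrix (Fin n) (Fin n) K →ₗ[K] K) :
    MvPolynomial (Fin n × Fin n) K :=
  ∑ i, ∑ j, χ (single i j 1) •
    (leadingMinor (genericMat K n) j i * leadingMinor (genericMat K n) j j ^ (p - 1))

lemma rightDerivation_leadingMinor_pow {A : Matrix (Fin n) (Fin n) K}
    (hA : ∀ i j, j < i → A i j = 0) (j : Fin n) (c : ℕ) :
    rightDerivation A (leadingMinor (genericMat K n) j j ^ c) =
      ((c : K) * ∑ k ∈ Finset.Iic j, A k k) • leadingMinor (genericMat K n) j j ^ c := by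
  cases c with
  | zero => simp
  | succ c =>
    rw [Derivation.leibniz_pow, rightDerivation_leadingMinor hA, Nat.add_sub_cancel, smul_eq_mul,
      mul_smul_comm, ← pow_succ, mul_smul, Nat.cast_smul_eq_nsmul]

/-- The minors for (i, j) and (j, j) have the same weight, so each summand has p times that weight,
which is zero. This explains the exponent p - 1. -/
lemma rightDerivation_potential_of_upper (χ : Matrix (Fin n) (Fin n) K →ₗ[K] K)
    {A : Matrix (Fin n) (Fin n) K} (hA : ∀ i j, j < i → A i j = 0) :
    rightDerivation A (potential p χ) = 0 := by
  rw [potential, map_sum]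
  refine Finset.sum_eq_zero fun i _ => ?_
  rw [map_sum]
  refine Finset.sum_eq_zero fun j _ => ?_
  have hp : (((p - 1 : ℕ) : K) + 1) = 0 := by
    rw [← Nat.cast_succ, Nat.succ_eq_add_one, Nat.sub_add_cancel (Fact.out : p.Prime).one_le,
      CharP.cast_eq_zero]
  rw [Derivation.map_smul, Derivation.leibniz, rightDerivation_leadingMinor_pow hA,
    rightDerivation_leadingMinor hA, smul_eq_mul, smul_eq_mul, mul_smul_comm, mul_smul_comm,
    mul_comm (_ ^ _), ← add_smul, ← add_one_mul, hp, zero_mul, zero_smul, smul_zero]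

/-- At the identity the (j, j) minor is 1 and, for i > j, the (i, j) minor vanishes with
differential the (i, j) coordinate on strictly lower triangular matrices. On upper triangular
matrices both sides are zero. -/
lemma evalOne_rightDerivation_potential {χ : Matrix (Fin n) (Fin n) K →ₗ[K] K}
    (hχ : ∀ i j, i ≤ j → χ (single i j 1) = 0) (A : Matrix (Fin n) (Fin n) K) :
    evalOne (rightDerivation A (potential p χ)) = χ A := by
  let ev : Matrix (Fin n) (Fin n) K →ₗ[K] K :=
    { toFun := fun A => evalOne (rightDerivation A (potential p χ))
      map_add' := fun A B => by rw [map_add, Derivation.add_apply, map_add]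
      map_smul' := fun r A => by rw [map_smul, Derivation.smul_apply, map_smul]; rfl }
  suffices h : ∀ k l, ev (single k l 1) = χ (single k l 1) by
    have : ev = χ := Matrix.ext_linearMap K fun k l => LinearMap.ext_ring (h k l)
    exact LinearMap.congr_fun this A
  intro k l
  change evalOne (rightDerivation _ (potential p χ)) = _
  rcases le_or_gt k l with hkl | hkl
  · rw [rightDerivation_potential_of_upper, map_zero, hχ k l hkl]
    intro i j hij
    refine single_apply_of_ne _ _ _ _ _ ?_
    rintro ⟨rfl, rfl⟩
    exact absurd hij (not_lt.2 hkl)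
  · have : ∀ i j, evalOne (rightDerivation (single k l 1) (χ (single i j 1) •
        (leadingMinor (genericMat K n) j i * leadingMinor (genericMat K n) j j ^ (p - 1)))) =
        χ (single i j 1) * single k l (1 : K) i j := by
      intro i j
      rw [Derivation.map_smul, map_smul, smul_eq_mul]
      rcases le_or_gt i j with hij | hij
      · rw [hχ i j hij, zero_mul, zero_mul]
      · rw [Derivation.leibniz, map_add, smul_eq_mul, smul_eq_mul, map_mul, map_mul,
          map_pow evalOne, evalOne_leadingMinor, evalOne_leadingMinor, one_apply_ne hij.ne', one_apply_eq,
          evalOne_rightDerivation_leadingMinor hkl, zero_mul, zero_add, one_pow, one_mul]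
    rw [potential, map_sum, map_sum, Finset.sum_eq_single k]
    · rw [map_sum, map_sum, Finset.sum_eq_single l]
      · rw [this, single_apply_same, mul_one]
      · intro j _ hj
        rw [this, single_apply_of_ne _ _ _ _ _ (by rintro ⟨-, rfl⟩; exact hj rfl), mul_zero]
      · simp
    · intro i _ hi
      rw [map_sum, map_sum]
      refine Finset.sum_eq_zero fun j _ => ?_
      rw [this, single_apply_of_ne _ _ _ _ _ (by rintro ⟨rfl, -⟩; exact hi rfl), mul_zero]
    · simp

/-- The ideal generated by the elements `X_ij ^ p - δ_ij`. -/
noncomputable def frobeniusIdeal (K : Type*) [Field K] (n p : ℕ) :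
    Ideal (MvPolynomial (Fin n × Fin n) K) :=
  Ideal.span (Set.range fun ij : Fin n × Fin n =>
    X ij ^ p - C ((1 : Matrix (Fin n) (Fin n) K) ij.1 ij.2))

omit [CharP K p] in
lemma frobeniusIdeal_le_ker : frobeniusIdeal K n p ≤
    RingHom.ker (evalOne : MvPolynomial (Fin n × Fin n) K →ₐ[K] K) := by
  rw [frobeniusIdeal, Ideal.span_le]
  rintro _ ⟨⟨i, j⟩, rfl⟩
  change evalOne _ = 0
  rw [map_sub, map_pow, evalOne, aeval_X, aeval_C, one_apply, Algebra.algebraMap_self_apply]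
  split_ifs
  · rw [one_pow, sub_self]
  · rw [zero_pow (Fact.out : p.Prime).ne_zero, sub_zero]

/-- Modulo the ideal, f ↦ f^p and f ↦ f(1)^p are ring homomorphisms that agree on constants and
variables. The quotient is the coordinate ring of the first Frobenius kernel of GL(n). -/
lemma pow_sub_evalOne_pow_mem (f : MvPolynomial (Fin n × Fin n) K) :
    f ^ p - C (evalOne f ^ p) ∈ frobeniusIdeal K n p := by
  rw [← Ideal.Quotient.eq]
  have : (Ideal.Quotient.mk (frobeniusIdeal K n p)).comp (frobenius _ p) =
      ((Ideal.Quotient.mk (frobeniusIdeal K n p)).comp C).comp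
        ((frobenius K p).comp (evalOne : MvPolynomial (Fin n × Fin n) K →ₐ[K] K).toRingHom) := by
    refine MvPolynomial.ringHom_ext (fun r => ?_) fun ij => ?_
    · simp [frobenius_def]
    · have h : X ij ^ p - C ((1 : Matrix (Fin n) (Fin n) K) ij.1 ij.2) ∈ frobeniusIdeal K n p :=
        Ideal.subset_span ⟨ij, rfl⟩
      have h' : (1 : Matrix (Fin n) (Fin n) K) ij.1 ij.2 ^ p =
          (1 : Matrix (Fin n) (Fin n) K) ij.1 ij.2 := by
        rw [one_apply]
        split_ifs
        · rw [one_pow]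
        · rw [zero_pow (Fact.out : p.Prime).ne_zero]
      rw [← Ideal.Quotient.eq] at h
      simpa [frobenius_def, evalOne, h'] using h
  exact RingHom.congr_fun this f

omit [Fact p.Prime] in
lemma derivation_mem_frobeniusIdeal
    (D : Derivation K (MvPolynomial (Fin n × Fin n) K) (MvPolynomial (Fin n × Fin n) K))
    {f : MvPolynomial (Fin n × Fin n) K} (hf : f ∈ frobeniusIdeal K n p) :
    D f ∈ frobeniusIdeal K n p := by
  induction hf using Submodule.span_induction with
  | mem f hf =>
    obtain ⟨ij, rfl⟩ := hf
    have : (p : MvPolynomial (Fin n × Fin n) K) = 0 := CharP.cast_eq_zero _ _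
    rw [map_sub, Derivation.leibniz_pow, derivation_C, ← Nat.cast_smul_eq_nsmul
      (MvPolynomial (Fin n × Fin n) K), this, zero_smul, sub_zero]
    exact zero_mem _
  | zero => rw [map_zero]; exact zero_mem _
  | add f g _ _ hf hg => rw [map_add]; exact add_mem hf hg
  | smul a f hf' hf =>
    rw [smul_eq_mul, Derivation.leibniz]
    exact add_mem (Ideal.mul_mem_left _ _ hf) (Ideal.mul_mem_right _ _ hf')

/-- The action of a matrix on the coordinate ring of the matrices, twisted by `φ`. -/
noncomputable def twistedOp (φ : MvPolynomial (Fin n × Fin n) K) : Matrix (Fin n) (Fin n) K →ₗ[K]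
    Module.End K (MvPolynomial (Fin n × Fin n) K) where
  toFun A := (rightDerivation A).toLinearMap + LinearMap.mulLeft K (rightDerivation A φ)
  map_add' A B := by
    refine LinearMap.ext fun f => ?_
    simp [add_mul]
    ring
  map_smul' r A := by
    refine LinearMap.ext fun f => ?_
    simp

lemma twistedOp_apply (φ : MvPolynomial (Fin n × Fin n) K) (A : Matrix (Fin n) (Fin n) K)
    (f : MvPolynomial (Fin n × Fin n) K) :
    twistedOp φ A f = rightDerivation A f + rightDerivation A φ * f := rfl

/-- Formally, the twisted operators are the conjugates e^{-φ} D e^{φ} of right translations, so the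
twist leaves brackets unchanged. -/
lemma twistedOp_commutator (φ : MvPolynomial (Fin n × Fin n) K) (A B : Matrix (Fin n) (Fin n) K)
    (f : MvPolynomial (Fin n × Fin n) K) :
    twistedOp φ A (twistedOp φ B f) - twistedOp φ B (twistedOp φ A f) =
      twistedOp φ (A * B - B * A) f := by
  simp only [twistedOp_apply, map_add, Derivation.leibniz, smul_eq_mul,
    ← rightDerivation_commutator]
  ring

/-- Unlike brackets, p-th powers feel the twist: Jacobson's formula leaves the extra term (D_A φ)^p.
Modulo the Frobenius ideal it is the p-th power of the differential of φ at the identity, which is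
how the potential creates the p-character. -/
lemma twistedOp_pow_char (φ : MvPolynomial (Fin n × Fin n) K) (A : Matrix (Fin n) (Fin n) K)
    (f : MvPolynomial (Fin n × Fin n) K) :
    (twistedOp φ A ^ p) f = twistedOp φ (A ^ p) f + rightDerivation A φ ^ p * f := by
  have := derivation_twist_pow_char p (rightDerivation A) φ f
  refine this.trans ?_
  rw [rightDerivation_pow_char, rightDerivation_pow_char, twistedOp_apply]
  ring

/-- There are representations of `U_χ(𝔰𝔩(n))` with a vector that is an eigenvector, of prescribed
weight, of the upper triangular matrices. -/
theorem exists_weight_evenOperatorRep {K : Type u} [Field K] [CharP K p]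
    (χ : Matrix (Fin n) (Fin n) K →ₗ[K] K)
    (hχ : ∀ i j, i ≤ j → χ (single i j 1) = 0) (c : Fin n → ℕ) :
    ∃ (Q : Type u) (_ : AddCommGroup Q) (_ : Module K Q)
      (ρ : EvenOperatorRep p χ (Module.End K Q)) (v : Q), v ≠ 0 ∧
      ∀ A : Matrix (Fin n) (Fin n) K, (∀ i j, j < i → A i j = 0) →
        ρ.a A v = (∑ j, (c j : K) * ∑ k ∈ Finset.Iic j, A k k) • v := by
  let I := (frobeniusIdeal K n p).restrictScalars K
  let φ := potential p χ
  have hI : ∀ A, I ≤ I.comap (twistedOp φ A) := fun A f hf =>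
    add_mem (derivation_mem_frobeniusIdeal p _ hf) (Ideal.mul_mem_left _ _ hf)
  let a : Matrix (Fin n) (Fin n) K →ₗ[K] Module.End K (MvPolynomial (Fin n × Fin n) K ⧸ I) :=
    { toFun := fun A => I.mapQ I (twistedOp φ A) (hI A)
      map_add' := fun A B => by
        refine Submodule.linearMap_qext _ (LinearMap.ext fun f => ?_)
        simp
      map_smul' := fun r A => by
        refine Submodule.linearMap_qext _ (LinearMap.ext fun f => ?_)
        simp }
  have a_mk : ∀ A f, a A (I.mkQ f) = I.mkQ (twistedOp φ A f) := fun _ _ => rfl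
  have a_pow : ∀ A f (k : ℕ), (a A ^ k) (I.mkQ f) = I.mkQ ((twistedOp φ A ^ k) f) := by
    intro A f k
    induction k with
    | zero => rfl
    | succ k ih => rw [pow_succ', Module.End.mul_apply, ih, a_mk, pow_succ']; rfl
  -- A product of leading principal minors has the required weight, and upper triangular matrices do
  -- not see the twist since they kill the potential. Its value at the identity is 1, so it survives
  -- in the quotient.
  let u : MvPolynomial (Fin n × Fin n) K := ∏ j, leadingMinor (genericMat K n) j j ^ c j
  refine ⟨MvPolynomial (Fin n × Fin n) K ⧸ I, inferInstance, inferInstance, ⟨a, ?_, ?_⟩,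
    I.mkQ u, ?_, ?_⟩
  · intro A B _ _
    refine Submodule.linearMap_qext _ (LinearMap.ext fun f => ?_)
    simp only [LinearMap.comp_apply, LinearMap.sub_apply, Module.End.mul_apply, a_mk, ← map_sub,
      twistedOp_commutator]
  · intro A _
    refine Submodule.linearMap_qext _ (LinearMap.ext fun f => ?_)
    rw [LinearMap.comp_apply, LinearMap.sub_apply, a_pow, a_mk, twistedOp_pow_char, ← map_sub,
      add_sub_cancel_left, LinearMap.comp_apply, Module.algebraMap_end_apply, ← map_smul,
      ← evalOne_rightDerivation_potential p hχ, ← C_mul', ← sub_eq_zero, ← map_sub, ← sub_mul]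
    exact (Submodule.Quotient.mk_eq_zero I).2
      (Ideal.mul_mem_right _ _ (pow_sub_evalOne_pow_mem p _))
  · intro h
    have h1 : u ∈ frobeniusIdeal K n p := (Submodule.Quotient.mk_eq_zero I).1 h
    have h2 : evalOne u = 0 := frobeniusIdeal_le_ker p h1
    rw [map_prod] at h2
    simp [evalOne_leadingMinor] at h2
  · intro A hA
    have : ∀ s : Finset (Fin n),
        rightDerivation A (∏ j ∈ s, leadingMinor (genericMat K n) j j ^ c j) =
          (∑ j ∈ s, (c j : K) * ∑ k ∈ Finset.Iic j, A k k) •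
            ∏ j ∈ s, leadingMinor (genericMat K n) j j ^ c j := by
      intro s
      induction s using Finset.induction_on with
      | empty => simp
      | insert j s hj ih =>
        rw [Finset.prod_insert hj, Finset.sum_insert hj, Derivation.leibniz, ih,
          rightDerivation_leadingMinor_pow hA, smul_eq_mul, smul_eq_mul, mul_smul_comm,
          mul_smul_comm, mul_comm (∏ j ∈ s, _), add_smul, add_comm]
    change a A (I.mkQ u) = _
    rw [a_mk, twistedOp_apply, rightDerivation_potential_of_upper p χ hA, zero_mul, add_zero,
      this, map_smul]

end TwistedRep

end Periplectic

/-! ### Reduced enveloping algebras and induced modules: generators and nonvanishing -/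

namespace RestrictedLieSuper

section

variable {K : Type*} {p : ℕ} {A : Type*} [Field K] [Ring A] [Algebra K A]
  {B : Type*} [Ring B] [Algebra K B]

lemma liftUChi_toUChi (L : RestrictedLieSuper K p A) (χ : Module.Dual K L.even)
    (f : L.even →ₗ[K] B) (g : L.odd →ₗ[K] B) (h00 h01 h11 hp)
    (x : TensorAlgebra K (L.even × L.odd)) :
    L.liftUChi χ f g h00 h01 h11 hp (L.toUChi χ (L.toU x)) =
      TensorAlgebra.lift K (f.coprod g) x :=
  (RingQuot.liftAlgHom_mkAlgHom_apply K (L.liftU f g h00 h01 h11) _ _).trans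
    (RingQuot.liftAlgHom_mkAlgHom_apply K _ _ _)

lemma liftUChi_ιEven (L : RestrictedLieSuper K p A) (χ : Module.Dual K L.even)
    (f : L.even →ₗ[K] B) (g : L.odd →ₗ[K] B) (h00 h01 h11 hp) (x : L.even) :
    L.liftUChi χ f g h00 h01 h11 hp (L.ιEven χ x) = f x := by
  rw [ιEven_apply, liftUChi_toUChi, tEven, TensorAlgebra.lift_ι_apply]
  simp

lemma liftUChi_ιOdd (L : RestrictedLieSuper K p A) (χ : Module.Dual K L.even)
    (f : L.even →ₗ[K] B) (g : L.odd →ₗ[K] B) (h00 h01 h11 hp) (y : L.odd) :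
    L.liftUChi χ f g h00 h01 h11 hp (L.ιOdd χ y) = g y := by
  rw [ιOdd_apply, liftUChi_toUChi, tOdd, TensorAlgebra.lift_ι_apply]
  simp

lemma incl_ιEven {L L' : RestrictedLieSuper K p A} (h : L ≤ L') (χ : Module.Dual K L'.even)
    (x : L.even) : incl h χ (L.ιEven (resDual h χ) x) = L'.ιEven χ (Submodule.inclusion h.1 x) :=
  liftUChi_ιEven _ _ _ _ _ _ _ _ _

lemma incl_ιOdd {L L' : RestrictedLieSuper K p A} (h : L ≤ L') (χ : Module.Dual K L'.even)
    (y : L.odd) : incl h χ (L.ιOdd (resDual h χ) y) = L'.ιOdd χ (Submodule.inclusion h.2 y) :=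
  liftUChi_ιOdd _ _ _ _ _ _ _ _ _

lemma br11_add_add (L : RestrictedLieSuper K p A)
    (x x' y y' : L.odd) : L.br11 (x + x') (y + y') =
      L.br11 x y + L.br11 x y' + (L.br11 y x' + L.br11 x' y') := by
  refine Subtype.ext ?_
  simp only [br11, Submodule.coe_add]
  noncomm_ring

lemma br01_add (L : RestrictedLieSuper K p A)
    (x : L.even) (y y' : L.odd) : L.br01 x (y + y') = L.br01 x y + L.br01 x y' := by
  refine Subtype.ext ?_
  simp only [br01, Submodule.coe_add]
  noncomm_ring

lemma toU_surjective (L : RestrictedLieSuper K p A) : Function.Surjective L.toU :=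
  RingQuot.mkAlgHom_surjective K _

lemma toUChi_surjective (L : RestrictedLieSuper K p A) (χ : Module.Dual K L.even) :
    Function.Surjective (L.toUChi χ) :=
  RingQuot.mkAlgHom_surjective K _

/-- The reduced enveloping algebra is generated by the Lie superalgebra. -/
lemma adjoin_range_ι (L : RestrictedLieSuper K p A) (χ : Module.Dual K L.even) :
    Algebra.adjoin K (Set.range (L.ιEven χ) ∪ Set.range (L.ιOdd χ)) = ⊤ := by
  rw [eq_top_iff]
  rintro u -
  obtain ⟨u, rfl⟩ := L.toUChi_surjective χ u
  obtain ⟨u, rfl⟩ := L.toU_surjective u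
  have hu : u ∈ Algebra.adjoin K (Set.range (TensorAlgebra.ι K (M := L.even × L.odd))) := by
    rw [TensorAlgebra.adjoin_range_ι]; trivial
  induction hu using Algebra.adjoin_induction with
  | mem x hx =>
    obtain ⟨⟨x, y⟩, rfl⟩ := hx
    have : (TensorAlgebra.ι K (x, y) : TensorAlgebra K (L.even × L.odd)) =
        L.tEven x + L.tOdd y := by
      rw [tEven, tOdd, ← map_add]
      simp
    rw [this, map_add, map_add]
    exact add_mem (Algebra.subset_adjoin (Or.inl ⟨x, rfl⟩))
      (Algebra.subset_adjoin (Or.inr ⟨y, rfl⟩))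
  | algebraMap r => rw [AlgHom.commutes, AlgHom.commutes]; exact algebraMap_mem _ _
  | add x y _ _ hx hy => rw [map_add, map_add]; exact add_mem hx hy
  | mul x y _ _ hx hy => rw [map_mul, map_mul]; exact mul_mem hx hy

end

end RestrictedLieSuper

section IndGen

variable {K : Type*} [Field K] {A B : Type*} [Ring A] [Ring B] [Algebra K A]
  [Algebra K B] {M : Type*} [AddCommGroup M] [Module K M]

/-- A subspace stable under generators of an algebra is stable under the algebra. -/
lemma smul_mem_of_adjoin_eq_top [Module B M] [IsScalarTower K B M] {s : Set B}
    (hs : Algebra.adjoin K s = ⊤) {T : Submodule K M} (h : ∀ b ∈ s, ∀ m ∈ T, b • m ∈ T) (b : B)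
    {m : M} (hm : m ∈ T) : b • m ∈ T := by
  have hb : b ∈ Algebra.adjoin K s := by rw [hs]; trivial
  induction hb using Algebra.adjoin_induction generalizing m with
  | mem x hx => exact h x hx m hm
  | algebraMap r => rw [algebraMap_smul]; exact T.smul_mem r hm
  | add x y _ _ hx hy => rw [add_smul]; exact add_mem (hx hm) (hy hm)
  | mul x y _ _ hx hy => rw [mul_smul]; exact hx (hy hm)

lemma ind_mk_mul (φ : A →ₐ[K] B) (r : A →ₐ[K] Module.End K M) (b : B) (a : A) (m : M) :
    (indRel φ r).mkQ ((b * φ a) ⊗ₜ[K] m) = (indRel φ r).mkQ (b ⊗ₜ[K] r a m) := by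
  rw [← sub_eq_zero, ← map_sub]
  exact (Submodule.Quotient.mk_eq_zero _).2 (Submodule.subset_span ⟨b, a, m, rfl⟩)

lemma smul_ind_mk_one (φ : A →ₐ[K] B) (r : A →ₐ[K] Module.End K M) (a : A) (m : M) :
    φ a • (indRel φ r).mkQ (1 ⊗ₜ[K] m) = (indRel φ r).mkQ (1 ⊗ₜ[K] r a m) := by
  rw [← ind_mk_mul, ← map_smul, smul_tmul', smul_eq_mul, mul_one, one_mul]

/-- A vector that survives in some module over the larger algebra is nonzero in the induced
module. -/
lemma ind_mk_one_ne_zero (φ : A →ₐ[K] B) (r : A →ₐ[K] Module.End K M) {s : Set A}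
    (hs : Algebra.adjoin K s = ⊤) {N : Type*} [AddCommGroup N] [Module K N]
    (σ : B →ₐ[K] Module.End K N) (g : M →ₗ[K] N) (h : ∀ a ∈ s, ∀ m, g (r a m) = σ (φ a) (g m))
    {m : M} (hm : g m ≠ 0) : (indRel φ r).mkQ (1 ⊗ₜ[K] m) ≠ 0 := by
  have h' : ∀ a m, g (r a m) = σ (φ a) (g m) := by
    intro a
    have ha : a ∈ Algebra.adjoin K s := by rw [hs]; trivial
    induction ha using Algebra.adjoin_induction with
    | mem x hx => exact h x hx
    | algebraMap r => intro m; simp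
    | add x y _ _ hx hy => intro m; simp [hx, hy]
    | mul x y _ _ hx hy => intro m; simp [hx, hy]
  -- By Frobenius reciprocity `g` extends to the induced module, and `G` is that extension before
  -- passing to the quotient.
  let G : B ⊗[K] M →ₗ[K] N := TensorProduct.lift (LinearMap.lcomp K N g ∘ₗ σ.toLinearMap)
  have G_tmul : ∀ b m, G (b ⊗ₜ m) = σ b (g m) := fun _ _ => rfl
  have G_smul : ∀ (b : B) (t), G (b • t) = σ b (G t) := by
    intro b t
    induction t with
    | zero => simp
    | tmul c m => rw [smul_tmul', G_tmul, smul_eq_mul, map_mul, G_tmul]; rfl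
    | add x y hx hy => rw [smul_add, map_add, hx, hy, map_add, map_add]
  have G_rel : ∀ t ∈ indRel φ r, G t = 0 := by
    intro t ht
    induction ht using Submodule.span_induction with
    | mem t ht =>
      obtain ⟨b, a, m, rfl⟩ := ht
      rw [map_sub, G_tmul, G_tmul, h', map_mul, Module.End.mul_apply, sub_self]
    | zero => exact map_zero _
    | add x y _ _ hx hy => rw [map_add, hx, hy, add_zero]
    | smul b x _ hx => rw [G_smul, hx, map_zero]
  intro h0
  have := G_rel _ ((Submodule.Quotient.mk_eq_zero _).1 h0)
  rw [G_tmul, map_one] at this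
  exact hm this

end IndGen

/-! ### From block matrices to operator relations and back -/

namespace Periplectic

section Blocks

variable {K : Type*} [Field K] {n : ℕ}

/-- The projection onto the matrices of trace zero along the scalar matrices. -/
def slProj : Matrix (Fin n) (Fin n) K →ₗ[K] Matrix (Fin n) (Fin n) K where
  toFun A := A - (A.trace / n) • 1
  map_add' A B := by rw [trace_add, add_div, add_smul]; abel
  map_smul' r A := by
    rw [trace_smul, smul_eq_mul, mul_div_assoc, mul_smul, ← smul_sub, RingHom.id_apply]

lemma slProj_apply (A : Matrix (Fin n) (Fin n) K) : slProj A = A - (A.trace / n) • 1 := rfl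

lemma slProj_of_trace {A : Matrix (Fin n) (Fin n) K} (h : A.trace = 0) : slProj A = A := by
  rw [slProj_apply, h, zero_div, zero_smul, sub_zero]

lemma trace_slProj (hn : (n : K) ≠ 0) (A : Matrix (Fin n) (Fin n) K) : (slProj A).trace = 0 := by
  rw [slProj_apply, trace_sub, trace_smul, trace_one, Fintype.card_fin, smul_eq_mul,
    div_mul_cancel₀ _ hn, sub_self]

lemma slProj_one (hn : (n : K) ≠ 0) : slProj (1 : Matrix (Fin n) (Fin n) K) = 0 := by
  rw [slProj_apply, trace_one, Fintype.card_fin, div_self hn, one_smul, sub_self]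

variable (p : ℕ) [Fact p.Prime] [CharP K p]

/-- The even element of `𝔭(n)` with the same traceless part as a given matrix. -/
def toEven (hn : (n : K) ≠ 0) : Matrix (Fin n) (Fin n) K →ₗ[K] (periplectic K p n).even :=
  (diagBlock K n ∘ₗ slProj).codRestrict _ fun A => ⟨slProj A, trace_slProj hn A, rfl⟩

lemma toEven_coe (hn : (n : K) ≠ 0) (A : Matrix (Fin n) (Fin n) K) :
    (toEven p hn A).1 = diagBlock K n (slProj A) := rfl

lemma toEven_coe_of_trace (hn : (n : K) ≠ 0) {A : Matrix (Fin n) (Fin n) K} (h : A.trace = 0) :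
    (toEven p hn A).1 = diagBlock K n A := by
  rw [toEven_coe, slProj_of_trace h]

lemma exists_toEven (hn : (n : K) ≠ 0) (x : (periplectic K p n).even) :
    ∃ A : Matrix (Fin n) (Fin n) K, A.trace = 0 ∧ toEven p hn A = x := by
  obtain ⟨_, A, hA, rfl⟩ := x
  exact ⟨A, hA, Subtype.ext (toEven_coe_of_trace p hn hA)⟩

/-- The element of `𝔤₀` with the same traceless part as a given matrix. -/
def toEvenPart (hn : (n : K) ≠ 0) : Matrix (Fin n) (Fin n) K →ₗ[K] (evenPart K p n).even :=
  (diagBlock K n ∘ₗ slProj).codRestrict _ fun A => ⟨slProj A, trace_slProj hn A, rfl⟩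

lemma toEvenPart_coe_of_trace (hn : (n : K) ≠ 0) {A : Matrix (Fin n) (Fin n) K}
    (h : A.trace = 0) : (toEvenPart p hn A).1 = diagBlock K n A := by
  change diagBlock K n (slProj A) = _
  rw [slProj_of_trace h]

lemma exists_toEvenPart (hn : (n : K) ≠ 0) (x : (evenPart K p n).even) :
    ∃ A : Matrix (Fin n) (Fin n) K, A.trace = 0 ∧ toEvenPart p hn A = x := by
  obtain ⟨_, A, hA, rfl⟩ := x
  exact ⟨A, hA, Subtype.ext (toEvenPart_coe_of_trace p hn hA)⟩

/-- The odd element `(0, M + Mᵗ; 0, 0)`. -/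
def toOddUpper : Matrix (Fin n) (Fin n) K →ₗ[K] (periplectic K p n).odd :=
  (offBlock K n ∘ₗ LinearMap.inl K _ _ ∘ₗ (LinearMap.id +
    (transposeLinearEquiv (Fin n) (Fin n) K K).toLinearMap)).codRestrict _ fun M =>
      ⟨(M + Mᵀ, 0), ⟨by simp [add_comm], by simp, by simp⟩, rfl⟩

lemma toOddUpper_coe (M : Matrix (Fin n) (Fin n) K) :
    (toOddUpper p M).1 = offBlock K n (M + Mᵀ, 0) := rfl

/-- The odd element `(0, 0; M - Mᵗ, 0)`. -/
def toOddLower : Matrix (Fin n) (Fin n) K →ₗ[K] (periplectic K p n).odd :=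
  (offBlock K n ∘ₗ LinearMap.inr K _ _ ∘ₗ (LinearMap.id -
    (transposeLinearEquiv (Fin n) (Fin n) K K).toLinearMap)).codRestrict _ fun M =>
      ⟨(0, M - Mᵀ), ⟨by simp, by simp, by simp⟩, rfl⟩

lemma toOddLower_coe (M : Matrix (Fin n) (Fin n) K) :
    (toOddLower p M).1 = offBlock K n (0, M - Mᵀ) := rfl

lemma exists_toOdd (h2 : (2 : K) ≠ 0) (y : (periplectic K p n).odd) :
    ∃ M M' : Matrix (Fin n) (Fin n) K, toOddUpper p M + toOddLower p M' = y := by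
  obtain ⟨_, ⟨B, C⟩, ⟨hB, hC, -⟩, rfl⟩ := y
  have hB' : Bᵀ = B := hB
  have hC' : Cᵀ = -C := hC
  refine ⟨(2 : K)⁻¹ • B, (2 : K)⁻¹ • C, Subtype.ext ?_⟩
  change _ = offBlock K n (B, C)
  rw [Submodule.coe_add, toOddUpper_coe, toOddLower_coe, ← map_add, transpose_smul, transpose_smul,
    hB', hC', smul_neg, sub_neg_eq_add, ← add_smul, ← add_smul, ← two_mul, mul_inv_cancel₀ h2,
    one_smul, one_smul, Prod.mk_add_mk, add_zero, zero_add]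

lemma br00_toEven (hn : (n : K) ≠ 0) {A A' : Matrix (Fin n) (Fin n) K} (h : A.trace = 0)
    (h' : A'.trace = 0) : (periplectic K p n).br00 (toEven p hn A) (toEven p hn A') =
      toEven p hn (A * A' - A' * A) := by
  refine Subtype.ext ?_
  rw [toEven_coe_of_trace p hn (trace_comm_zero A A')]
  change (toEven p hn A).1 * (toEven p hn A').1 - (toEven p hn A').1 * (toEven p hn A).1 = _
  rw [toEven_coe_of_trace p hn h, toEven_coe_of_trace p hn h']
  simp [diagBlock_apply, fromBlocks_multiply, sub_eq_add_neg, transpose_mul, fromBlocks_add,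
    fromBlocks_neg, add_comm]

lemma pmap_toEven (hn : (n : K) ≠ 0) {A : Matrix (Fin n) (Fin n) K} (h : A.trace = 0) :
    (periplectic K p n).pmap (toEven p hn A) = toEven p hn (A ^ p) := by
  have hp : (A ^ p).trace = 0 := slMat_pow K p n h
  refine Subtype.ext ?_
  rw [toEven_coe_of_trace p hn hp]
  change (toEven p hn A).1 ^ p = _
  rw [toEven_coe_of_trace p hn h, diagBlock_pow]

lemma br00_toEvenPart (hn : (n : K) ≠ 0) {A A' : Matrix (Fin n) (Fin n) K} (h : A.trace = 0)
    (h' : A'.trace = 0) : (evenPart K p n).br00 (toEvenPart p hn A) (toEvenPart p hn A') =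
      toEvenPart p hn (A * A' - A' * A) :=
  br00_toEven p hn h h'

lemma pmap_toEvenPart (hn : (n : K) ≠ 0) {A : Matrix (Fin n) (Fin n) K} (h : A.trace = 0) :
    (evenPart K p n).pmap (toEvenPart p hn A) = toEvenPart p hn (A ^ p) :=
  pmap_toEven p hn h

lemma br01_toOddUpper (hn : (n : K) ≠ 0) {A : Matrix (Fin n) (Fin n) K} (h : A.trace = 0)
    (M : Matrix (Fin n) (Fin n) K) : (periplectic K p n).br01 (toEven p hn A) (toOddUpper p M) =
      toOddUpper p (A * M + M * Aᵀ) := by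
  refine Subtype.ext ?_
  rw [toOddUpper_coe]
  change (toEven p hn A).1 * (toOddUpper p M).1 - (toOddUpper p M).1 * (toEven p hn A).1 = _
  rw [toEven_coe_of_trace p hn h, toOddUpper_coe]
  simp [diagBlock_apply, offBlock_apply, fromBlocks_multiply, sub_eq_add_neg, transpose_mul,
    fromBlocks_add, fromBlocks_neg, mul_add, add_mul]
  abel

lemma br01_toOddLower (hn : (n : K) ≠ 0) {A : Matrix (Fin n) (Fin n) K} (h : A.trace = 0)
    (M : Matrix (Fin n) (Fin n) K) : (periplectic K p n).br01 (toEven p hn A) (toOddLower p M) =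
      -toOddLower p (Aᵀ * M + M * A) := by
  rw [← map_neg]
  refine Subtype.ext ?_
  rw [toOddLower_coe]
  change (toEven p hn A).1 * (toOddLower p M).1 - (toOddLower p M).1 * (toEven p hn A).1 = _
  rw [toEven_coe_of_trace p hn h, toOddLower_coe]
  simp [diagBlock_apply, offBlock_apply, fromBlocks_multiply, sub_eq_add_neg, transpose_mul,
    fromBlocks_add, fromBlocks_neg, mul_add, add_mul]
  abel

lemma br11_toOddUpper_toOddLower (hn : (n : K) ≠ 0) (M M' : Matrix (Fin n) (Fin n) K) :
    (periplectic K p n).br11 (toOddUpper p M) (toOddLower p M') =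
      toEven p hn ((M + Mᵀ) * (M' - M'ᵀ)) := by
  refine Subtype.ext ?_
  have ht : ((M + Mᵀ) * (M' - M'ᵀ)).trace = 0 :=
    trace_symm_skew K n _ _ (by simp [add_comm]) (by simp) (by simp)
  rw [toEven_coe_of_trace p hn ht]
  change (toOddUpper p M).1 * (toOddLower p M').1 + (toOddLower p M').1 * (toOddUpper p M).1 = _
  rw [toOddUpper_coe, toOddLower_coe]
  simp [diagBlock_apply, offBlock_apply, fromBlocks_multiply, transpose_mul, fromBlocks_add]
  noncomm_ring

lemma br11_toOddUpper (M M' : Matrix (Fin n) (Fin n) K) :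
    (periplectic K p n).br11 (toOddUpper p M) (toOddUpper p M') = 0 := by
  refine Subtype.ext ?_
  change (toOddUpper p M).1 * (toOddUpper p M').1 + (toOddUpper p M').1 * (toOddUpper p M).1 = 0
  simp [toOddUpper_coe, offBlock_apply, fromBlocks_multiply]

lemma br11_toOddLower (M M' : Matrix (Fin n) (Fin n) K) :
    (periplectic K p n).br11 (toOddLower p M) (toOddLower p M') = 0 := by
  refine Subtype.ext ?_
  change (toOddLower p M).1 * (toOddLower p M').1 + (toOddLower p M').1 * (toOddLower p M).1 = 0
  simp [toOddLower_coe, offBlock_apply, fromBlocks_multiply]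

lemma toOddUpper_transpose (M : Matrix (Fin n) (Fin n) K) :
    toOddUpper p Mᵀ = toOddUpper p M := by
  refine Subtype.ext ?_
  rw [toOddUpper_coe, toOddUpper_coe, transpose_transpose, add_comm]

lemma toOddLower_transpose (M : Matrix (Fin n) (Fin n) K) :
    toOddLower p Mᵀ = -toOddLower p M := by
  rw [← map_neg]
  refine Subtype.ext ?_
  rw [toOddLower_coe, toOddLower_coe, transpose_transpose, transpose_neg, sub_neg_eq_add,
    neg_add_eq_sub]

/-- A linear form on the even part of `𝔭(n)` as a linear form on matrices. -/
def matForm (hn : (n : K) ≠ 0) (χ : Module.Dual K (periplectic K p n).even) :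
    Matrix (Fin n) (Fin n) K →ₗ[K] K :=
  χ ∘ₗ toEven p hn

lemma matForm_apply (hn : (n : K) ≠ 0) (χ : Module.Dual K (periplectic K p n).even)
    (A : Matrix (Fin n) (Fin n) K) : matForm p hn χ A = χ (toEven p hn A) := rfl

/-- The generators of `U_χ(𝔭(n))`. -/
def universalRep (hn : (n : K) ≠ 0) (χ : Module.Dual K (periplectic K p n).even) :
    OperatorRep p (matForm p hn χ) ((periplectic K p n).UChi χ) where
  a := (periplectic K p n).ιEven χ ∘ₗ toEven p hn
  b := (periplectic K p n).ιOdd χ ∘ₗ toOddUpper p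
  c := (periplectic K p n).ιOdd χ ∘ₗ toOddLower p
  a_a A A' h h' := by
    simp only [LinearMap.comp_apply]
    rw [RestrictedLieSuper.ιEven_br00, br00_toEven p hn h h']
  a_b A M h := by
    simp only [LinearMap.comp_apply]
    rw [RestrictedLieSuper.ιEven_br01, br01_toOddUpper p hn h]
  a_c A M h := by
    simp only [LinearMap.comp_apply]
    rw [RestrictedLieSuper.ιEven_br01, br01_toOddLower p hn h, map_neg]
  b_c M M' := by
    simp only [LinearMap.comp_apply]
    rw [RestrictedLieSuper.ιOdd_br11, br11_toOddUpper_toOddLower]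
  b_b M M' := by
    simp only [LinearMap.comp_apply]
    rw [RestrictedLieSuper.ιOdd_br11, br11_toOddUpper, map_zero]
  c_c M M' := by
    simp only [LinearMap.comp_apply]
    rw [RestrictedLieSuper.ιOdd_br11, br11_toOddLower, map_zero]
  b_transpose M := congrArg ((periplectic K p n).ιOdd χ) (toOddUpper_transpose p M)
  c_transpose M := by
    simp only [LinearMap.comp_apply]
    rw [toOddLower_transpose, map_neg]
  a_pow A h := by
    simp only [LinearMap.comp_apply]
    rw [← pmap_toEven p hn h, RestrictedLieSuper.ιEven_pow]
    rfl

/-- The generators of `U_χ(𝔤₀)`. -/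
def evenUniversalRep (hn : (n : K) ≠ 0) (χ : Module.Dual K (periplectic K p n).even) :
    EvenOperatorRep p (matForm p hn χ) ((evenPart K p n).UChi (χEven χ)) where
  a := (evenPart K p n).ιEven (χEven χ) ∘ₗ toEvenPart p hn
  a_a A A' h h' := by
    simp only [LinearMap.comp_apply]
    rw [RestrictedLieSuper.ιEven_br00, br00_toEvenPart p hn h h']
  a_pow A h := by
    simp only [LinearMap.comp_apply]
    rw [← pmap_toEvenPart p hn h, RestrictedLieSuper.ιEven_pow]
    rfl

section Lift

variable {ℬ : Type*} [Ring ℬ] [Algebra K ℬ]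

/-- Operators satisfying the relations of `U_χ(𝔤₀)` define a homomorphism. -/
lemma EvenOperatorRep.exists_lift (hn : (n : K) ≠ 0)
    {χ : Module.Dual K (periplectic K p n).even} (ρ : EvenOperatorRep p (matForm p hn χ) ℬ) :
    ∃ σ : (evenPart K p n).UChi (χEven χ) →ₐ[K] ℬ, ∀ A, A.trace = 0 →
      σ ((evenPart K p n).ιEven (χEven χ) (toEvenPart p hn A)) = ρ.a A := by
  let f : (evenPart K p n).even →ₗ[K] ℬ := ρ.a ∘ₗ
    { toFun := fun x => x.1.toBlocks₁₁, map_add' := fun _ _ => rfl, map_smul' := fun _ _ => rfl }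
  have hf : ∀ A, A.trace = 0 → f (toEvenPart p hn A) = ρ.a A := fun A hA => by
    change ρ.a (slProj A) = _
    rw [slProj_of_trace hA]
  refine ⟨(evenPart K p n).liftUChi (χEven χ) f 0 ?_ ?_ ?_ ?_, fun A hA => ?_⟩
  · intro x y
    obtain ⟨A, hA, rfl⟩ := exists_toEvenPart p hn x
    obtain ⟨B, hB, rfl⟩ := exists_toEvenPart p hn y
    rw [br00_toEvenPart p hn hA hB, hf A hA, hf B hB, hf _ (trace_comm_zero A B), ρ.a_a A B hA hB]
  · intro x y
    simp
  · intro x y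
    have hx : x = 0 := by
      obtain ⟨_, B, hB, rfl⟩ := x
      have hB' : B = 0 := hB
      subst hB'
      exact Subtype.ext (map_zero _)
    have h : (evenPart K p n).br11 x y = 0 :=
      Subtype.ext (by simp [RestrictedLieSuper.br11, hx])
    rw [h, map_zero]
    simp
  · intro x
    obtain ⟨A, hA, rfl⟩ := exists_toEvenPart p hn x
    rw [pmap_toEvenPart p hn hA, hf A hA, hf _ (slMat_pow K p n hA), ρ.a_pow A hA]
    rfl
  · rw [RestrictedLieSuper.liftUChi_ιEven, hf A hA]

/-- Operators satisfying the relations of `U_χ(𝔭(n))` define a homomorphism. -/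
lemma OperatorRep.exists_lift (hn : (n : K) ≠ 0) (h2 : (2 : K) ≠ 0)
    {χ : Module.Dual K (periplectic K p n).even} (R : OperatorRep p (matForm p hn χ) ℬ) :
    ∃ σ : (periplectic K p n).UChi χ →ₐ[K] ℬ,
      (∀ A, A.trace = 0 → σ ((periplectic K p n).ιEven χ (toEven p hn A)) = R.a A) ∧
      ∀ M, σ ((periplectic K p n).ιOdd χ (toOddUpper p M)) = R.b M := by
  let f : (periplectic K p n).even →ₗ[K] ℬ := R.a ∘ₗ
    { toFun := fun x => x.1.toBlocks₁₁, map_add' := fun _ _ => rfl, map_smul' := fun _ _ => rfl }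
  -- The blocks of an odd element are M + Mᵗ and M' - M'ᵗ, on which `R.b` and `R.c` give twice the
  -- values at M and M'; hence the factor 1/2.
  let g : (periplectic K p n).odd →ₗ[K] ℬ := (2 : K)⁻¹ • (R.b ∘ₗ
    { toFun := fun x => x.1.toBlocks₁₂, map_add' := fun _ _ => rfl, map_smul' := fun _ _ => rfl } +
    R.c ∘ₗ
    { toFun := fun x => x.1.toBlocks₂₁, map_add' := fun _ _ => rfl, map_smul' := fun _ _ => rfl })
  have hf : ∀ A, A.trace = 0 → f (toEven p hn A) = R.a A := fun A hA => by
    change R.a (slProj A) = _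
    rw [slProj_of_trace hA]
  have hg : ∀ M, g (toOddUpper p M) = R.b M := fun M => by
    change (2 : K)⁻¹ • (R.b (M + Mᵀ) + R.c 0) = _
    rw [map_add, R.b_transpose, map_zero, add_zero, ← two_smul K, inv_smul_smul₀ h2]
  have hg' : ∀ M, g (toOddLower p M) = R.c M := fun M => by
    change (2 : K)⁻¹ • (R.b 0 + R.c (M - Mᵀ)) = _
    rw [map_sub, R.c_transpose, map_zero, zero_add, sub_neg_eq_add, ← two_smul K, inv_smul_smul₀ h2]
  refine ⟨(periplectic K p n).liftUChi χ f g ?_ ?_ ?_ ?_, fun A hA => ?_, fun M => ?_⟩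
  · intro x y
    obtain ⟨A, hA, rfl⟩ := exists_toEven p hn x
    obtain ⟨B, hB, rfl⟩ := exists_toEven p hn y
    rw [br00_toEven p hn hA hB, hf A hA, hf B hB, hf _ (trace_comm_zero A B), R.a_a A B hA hB]
  · intro x y
    obtain ⟨A, hA, rfl⟩ := exists_toEven p hn x
    obtain ⟨M, M', rfl⟩ := exists_toOdd p h2 y
    rw [RestrictedLieSuper.br01_add, br01_toOddUpper p hn hA, br01_toOddLower p hn hA, map_add, map_add,
      map_neg, hf A hA, hg, hg, hg', hg', ← R.a_b A M hA, ← R.a_c A M' hA]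
    noncomm_ring
  · intro x y
    obtain ⟨M, M', rfl⟩ := exists_toOdd p h2 x
    obtain ⟨N, N', rfl⟩ := exists_toOdd p h2 y
    have htr : ∀ X Y : Matrix (Fin n) (Fin n) K, ((X + Xᵀ) * (Y - Yᵀ)).trace = 0 := fun X Y =>
      trace_symm_skew K n _ _ (by simp [add_comm]) (by simp) (by simp)
    rw [RestrictedLieSuper.br11_add_add, br11_toOddUpper, br11_toOddUpper_toOddLower p hn,
      br11_toOddUpper_toOddLower p hn, br11_toOddLower, zero_add, add_zero, map_add,
      map_add, map_add, hf _ (htr _ _), hf _ (htr _ _), hg, hg, hg', hg', ← R.b_c, ← R.b_c]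
    have h1 := R.b_b M N
    have h3 := R.c_c M' N'
    calc (R.b M + R.c M') * (R.b N + R.c N') + (R.b N + R.c N') * (R.b M + R.c M') =
        (R.b M * R.b N + R.b N * R.b M) + (R.c M' * R.c N' + R.c N' * R.c M') +
        (R.b M * R.c N' + R.c N' * R.b M + (R.b N * R.c M' + R.c M' * R.b N)) := by noncomm_ring
      _ = _ := by rw [h1, h3, zero_add, zero_add]
  · intro x
    obtain ⟨A, hA, rfl⟩ := exists_toEven p hn x
    rw [pmap_toEven p hn hA, hf A hA, hf _ (slMat_pow K p n hA), R.a_pow A hA]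
    rfl
  · rw [RestrictedLieSuper.liftUChi_ιEven, hf A hA]
  · rw [RestrictedLieSuper.liftUChi_ιOdd, hg]

end Lift

/-- The image of generators under an algebra map. -/
def EvenOperatorRep.map {χ : Matrix (Fin n) (Fin n) K →ₗ[K] K} {𝒜 ℬ : Type*} [Ring 𝒜]
    [Algebra K 𝒜] [Ring ℬ] [Algebra K ℬ] (R : EvenOperatorRep p χ 𝒜) (f : 𝒜 →ₐ[K] ℬ) :
    EvenOperatorRep p χ ℬ where
  a := f.toLinearMap ∘ₗ R.a
  a_a A A' h h' := by simpa using congrArg f (R.a_a A A' h h')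
  a_pow A h := by simpa using congrArg f (R.a_pow A h)

end Blocks

end Periplectic

/-! ### The form χ vanishes on the Cartan subalgebra and weights are integral -/

namespace Periplectic

section Weights

variable {K : Type*} [Field K] {n : ℕ} {p : ℕ} [Fact p.Prime] [CharP K p]
  {χ : Module.Dual K (periplectic K p n).even}

lemma charpoly_eq_prod_of_upper {Y : Matrix (Fin n) (Fin n) K} (hY : ∀ i j, j < i → Y i j = 0) :
    Y.charpoly = ∏ i, (Polynomial.X - Polynomial.C (Y i i)) :=
  charpoly_of_isUpperTriangular Y fun i j h => hY i j h

lemma Ad_toEven (hn : (n : K) ≠ 0) (g : GL (Fin n) K) {A : Matrix (Fin n) (Fin n) K}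
    (hA : A.trace = 0) : Ad g (toEven p hn A) = toEven p hn (g.1 * (A * g⁻¹.1)) := by
  have hA' : (g.1 * (A * g⁻¹.1)).trace = 0 := by
    rw [trace_mul_comm, mul_assoc, ← Units.val_mul, inv_mul_cancel, Units.val_one, mul_one, hA]
  refine Subtype.ext ?_
  rw [toEven_coe_of_trace p hn hA']
  change glBlock g * (toEven p hn A).1 * glBlock g⁻¹ = _
  rw [toEven_coe_of_trace p hn hA]
  simp [glBlock, diagBlock_apply, fromBlocks_multiply, transpose_mul, mul_assoc]

lemma coAd_toEven (hn : (n : K) ≠ 0) (g : GL (Fin n) K) {A : Matrix (Fin n) (Fin n) K}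
    (hA : A.trace = 0) : coAd g χ (toEven p hn A) = matForm p hn χ (g⁻¹.1 * (A * g.1)) := by
  rw [coAd, LinearMap.comp_apply, Ad_toEven hn g⁻¹ hA, inv_inv]
  rfl

lemma toEven_one (hn : (n : K) ≠ 0) : toEven p hn (1 : Matrix (Fin n) (Fin n) K) = 0 := by
  refine Subtype.ext ?_
  rw [toEven_coe, slProj_one hn, map_zero]
  rfl

/-- A form that vanishes on the traceless upper triangular matrices and on the identity vanishes
on the upper triangular matrices. -/
lemma eq_zero_of_upper (hn : (n : K) ≠ 0) (ψ : Matrix (Fin n) (Fin n) K →ₗ[K] K) (h1 : ψ 1 = 0)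
    (h : ∀ A, A.trace = 0 → (∀ i j, j < i → A i j = 0) → ψ A = 0) {A : Matrix (Fin n) (Fin n) K}
    (hA : ∀ i j, j < i → A i j = 0) : ψ A = 0 := by
  have := h (slProj A) (trace_slProj hn A) fun i j hij => by
    rw [slProj_apply, Matrix.sub_apply, Matrix.smul_apply, one_apply_ne hij.ne', smul_zero,
      hA i j hij, sub_zero]
  rwa [slProj_apply, map_sub, map_smul, h1, smul_zero, sub_zero] at this

lemma single_upper {i j : Fin n} (h : i ≤ j) :
    ∀ k l, l < k → (single i j 1 : Matrix (Fin n) (Fin n) K) k l = 0 := by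
  intro k l hkl
  refine single_apply_of_ne _ _ _ _ _ ?_
  rintro ⟨rfl, rfl⟩
  exact absurd hkl (not_lt.2 h)

/-- In the situation of the theorem, some conjugate of `χ` vanishes on the upper triangular
matrices and not on the simple root vectors. -/
lemma exists_conj_of_isRegularNilpotent (hn : (n : K) ≠ 0) (hreg : IsRegularNilpotent χ) :
    ∃ g : GL (Fin n) K,
      (∀ A, (∀ i j, j < i → A i j = 0) → matForm p hn χ (g.1 * (A * g⁻¹.1)) = 0) ∧
      ∀ i j : Fin n, j.val + 1 = i.val → matForm p hn χ (g.1 * (single i j 1 * g⁻¹.1)) ≠ 0 := by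
  obtain ⟨g, hg, hg'⟩ := hreg
  refine ⟨g⁻¹, fun A hA => ?_, fun i j hij => ?_⟩
  · rw [inv_inv]
    refine eq_zero_of_upper hn
      (matForm p hn χ ∘ₗ LinearMap.mulLeft K g⁻¹.1 ∘ₗ LinearMap.mulRight K g.1) ?_ ?_ hA
    · change matForm p hn χ (g⁻¹.1 * (1 * g.1)) = 0
      rw [one_mul, ← Units.val_mul, inv_mul_cancel, Units.val_one, matForm_apply, toEven_one,
        map_zero]
    · intro A hA hA'
      rw [LinearMap.comp_apply, LinearMap.comp_apply]
      refine (coAd_toEven hn g hA).symm.trans (hg _ ⟨A, ⟨hA, hA'⟩, ?_⟩)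
      rw [toEven_coe_of_trace p hn hA]
  · have hne : i ≠ j := by rintro rfl; omega
    rw [inv_inv, ← coAd_toEven hn g (OperatorRep.trace_single_of_ne hne)]
    have : toEven p hn (single i j 1) = rootVec i j hne :=
      Subtype.ext (toEven_coe_of_trace p hn (OperatorRep.trace_single_of_ne hne))
    rw [this]
    exact hg' j i hne hij

/-- A regular nilpotent form that vanishes on the strictly upper triangular matrices vanishes on
the diagonal matrices. -/
theorem matForm_single_of_le (hn : (n : K) ≠ 0) (hχ : VanishesOnNil χ)
    (hreg : IsRegularNilpotent χ) (i j : Fin n) (h : i ≤ j) :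
    matForm p hn χ (single i j 1) = 0 := by
  have hlt : ∀ i j : Fin n, i < j → matForm p hn χ (single i j 1) = 0 := by
    intro i j h
    refine hχ _ ⟨single i j 1, fun k l hkl => ?_, ?_⟩
    · refine single_apply_of_ne _ _ _ _ _ ?_
      rintro ⟨rfl, rfl⟩
      exact absurd h (not_lt.2 hkl)
    · rw [toEven_coe_of_trace p hn (OperatorRep.trace_single_of_ne h.ne)]
  rcases h.lt_or_eq with h | rfl
  · exact hlt i j h
  obtain ⟨g, hg, -⟩ := exists_conj_of_isRegularNilpotent hn hreg
  -- `Y` represents χ through the trace form and is upper triangular. Regular nilpotency makes it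
  -- conjugate to a strictly upper triangular matrix, so its characteristic polynomial is X^n and
  -- its diagonal entries vanish.
  set Y : Matrix (Fin n) (Fin n) K := of fun j i => matForm p hn χ (single i j 1) with hY
  have h0 : Y.charpoly = ∏ i, (Polynomial.X - Polynomial.C (Y i i)) :=
    charpoly_eq_prod_of_upper fun i j h => hlt j i h
  have key : ∀ i j : Fin n, i ≤ j → (g⁻¹.1 * Y * g.1) j i = 0 := by
    intro i j hij
    have := hg _ (single_upper hij)
    rw [linearForm_eq_trace, ← hY, ← mul_assoc, ← mul_assoc, trace_mul_comm, ← mul_assoc,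
      ← mul_assoc, trace_mul_single, MulOpposite.op_one, one_smul] at this
    exact this
  have h1 : (g⁻¹.1 * Y * g.1).charpoly = ∏ i : Fin n, Polynomial.X := by
    rw [charpoly_eq_prod_of_upper fun i j h => key j i h.le]
    refine Finset.prod_congr rfl fun i _ => ?_
    rw [key i i le_rfl, map_zero, sub_zero]
  have h2 : (g⁻¹.1 * Y * g.1).charpoly = Y.charpoly := by
    simpa only [coe_units_inv] using charpoly_units_conj' g Y
  rw [h1, h0] at h2
  have h3 := congrArg (Polynomial.eval (Y i i)) h2
  rw [Polynomial.eval_prod, Polynomial.eval_prod, Finset.prod_eq_zero (Finset.mem_univ i)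
    (f := fun j => Polynomial.eval (Y i i) (Polynomial.X - Polynomial.C (Y j j)))] at h3
  · rw [Finset.prod_eq_zero_iff] at h3
    obtain ⟨_, _, h3⟩ := h3
    simpa [hY] using h3
  · simp

/-- Elements of the prime field are images of natural numbers. -/
lemma exists_natCast_of_pow_eq {x : K} (hx : x ^ p = x) : ∃ c : ℕ, (c : K) = x := by
  rw [← Subfield.mem_bot_iff_pow_eq_self (F := K) (p := p),
    ← ZMod.fieldRange_castHom_eq_bot p] at hx
  obtain ⟨z, rfl⟩ := hx
  exact ⟨z.val, by simp⟩

/-- Partial summation over `Fin n`. -/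
lemma exists_sum_Ici (f : Fin n → K) (hf : ∀ i, f i ^ p = f i) :
    ∃ c : Fin n → ℕ, ∀ i, ∑ j ∈ Finset.Ici i, (c j : K) = f i := by
  -- Extension by zero beyond the last index makes the telescoping sum over j ≥ i end in `f i`.
  let F : ℕ → K := fun m => if h : m < n then f ⟨m, h⟩ else 0
  have hF : ∀ m, F m ^ p = F m := by
    intro m
    simp only [F]
    split_ifs
    · exact hf _
    · exact zero_pow (Fact.out : p.Prime).ne_zero
  have hc : ∀ j : Fin n, ∃ c : ℕ, (c : K) = F j - F (j + 1) := fun j =>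
    exists_natCast_of_pow_eq (p := p) (by rw [sub_pow_char, hF, hF])
  choose c hc using hc
  refine ⟨c, fun i => ?_⟩
  have h1 : ∑ j ∈ Finset.Ici i, (c j : K) = ∑ m ∈ Finset.Ico i.val n, (F m - F (m + 1)) := by
    refine Finset.sum_bij (fun j _ => j.val) ?_ ?_ ?_ ?_
    · intro j hj
      have : i ≤ j := Finset.mem_Ici.1 hj
      exact Finset.mem_Ico.2 ⟨this, j.isLt⟩
    · intro a _ b _ h
      exact Fin.ext h
    · intro m hm
      rw [Finset.mem_Ico] at hm
      exact ⟨⟨m, hm.2⟩, Finset.mem_Ici.2 (Fin.le_def.2 hm.1), rfl⟩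
    · intro j _
      exact hc j
  have h2 : ∑ m ∈ Finset.Ico i.val n, (F m - F (m + 1)) = F i - F n := by
    have := Finset.sum_Ico_sub F i.isLt.le
    rw [← neg_inj, ← Finset.sum_neg_distrib, neg_sub, ← this]
    exact Finset.sum_congr rfl fun _ _ => neg_sub _ _
  rw [h1, h2]
  simp [F]

/-- The weights have integral coordinates. -/
theorem exists_natCast_weight (hn : (n : K) ≠ 0) (hχ : VanishesOnNil χ)
    (hreg : IsRegularNilpotent χ) {lam : Module.Dual K (cartan K p n).even}
    (hlam : lam ∈ weights χ) :
    ∃ c : Fin n → ℕ, ∀ x : (borel K p n).even,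
      lam (toCartan x) = ∑ j, (c j : K) * ∑ k ∈ Finset.Iic j, x.1.toBlocks₁₁ k k := by
  have hpos : 0 < n := Nat.pos_of_ne_zero fun h => hn (by rw [h, Nat.cast_zero])
  let z : Fin n := ⟨0, hpos⟩
  let H : (Fin n → K) →ₗ[K] (cartan K p n).even :=
    (diagBlock K n ∘ₗ slProj ∘ₗ diagonalLinearMap (Fin n) K K).codRestrict _ fun d =>
      ⟨slProj (diagonal d), ⟨trace_slProj hn _, fun i j hij => by
        rw [slProj_apply, Matrix.sub_apply, Matrix.smul_apply, diagonal_apply_ne _ hij,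
          one_apply_ne hij, smul_zero, sub_zero]⟩, rfl⟩
  have H_coe : ∀ d : Fin n → K, ∑ i, d i = 0 → (H d).1 = diagBlock K n (diagonal d) := by
    intro d hd
    change diagBlock K n (slProj (diagonal d)) = _
    rw [slProj_of_trace]
    rw [trace_diagonal, hd]
  -- The elements E_ii - E_00 are fixed by the p-map and χ vanishes on them, so the defining
  -- equation of a weight becomes x^p = x.
  let f : Fin n → K := fun i => lam (H (Pi.single i 1 - Pi.single z 1))
  have hf : ∀ i, f i ^ p = f i := by
    intro i
    set d : Fin n → K := Pi.single i 1 - Pi.single z 1 with hd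
    have hd0 : ∑ i, d i = 0 := by simp [hd]
    have hdp : ∀ j, d j ^ p = d j := by
      intro j
      have : ∀ i : Fin n, (Pi.single i 1 : Fin n → K) j ^ p = (Pi.single i 1 : Fin n → K) j := by
        intro i
        rw [Pi.single_apply]
        split_ifs
        · exact one_pow _
        · exact zero_pow (Fact.out : p.Prime).ne_zero
      rw [hd, Pi.sub_apply, sub_pow_char, this, this]
    have h := hlam (H d)
    have e1 : (cartan K p n).pmap (H d) = H d := by
      refine Subtype.ext ?_
      change (H d).1 ^ p = (H d).1
      rw [H_coe d hd0, diagBlock_pow, diagonal_pow]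
      congr 2
      funext j
      exact hdp j
    have e2 : χ (Submodule.inclusion (cartan_le_periplectic K p n).1 (H d)) = 0 := by
      have : Submodule.inclusion (cartan_le_periplectic K p n).1 (H d) = toEven p hn (diagonal d) :=
        rfl
      rw [this]
      change matForm p hn χ (diagonal d) = 0
      rw [matrix_eq_sum_single (diagonal d), map_sum]
      refine Finset.sum_eq_zero fun k _ => ?_
      rw [map_sum]
      refine Finset.sum_eq_zero fun l _ => ?_
      rcases eq_or_ne k l with rfl | hkl
      · rw [← mul_one (diagonal d k k), ← smul_eq_mul, ← smul_single, map_smul,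
          matForm_single_of_le hn hχ hreg k k le_rfl, smul_zero]
      · rw [diagonal_apply_ne _ hkl, single_zero, map_zero]
    rw [e1, e2, zero_pow (Fact.out : p.Prime).ne_zero, sub_eq_zero] at h
    exact h
  obtain ⟨c, hc⟩ := exists_sum_Ici f hf
  refine ⟨c, fun x => ?_⟩
  obtain ⟨_, A, hA, rfl⟩ := x
  have hA0 : ∑ i, A i i = 0 := hA.1
  have e1 : toCartan (⟨diagBlock K n A, A, hA, rfl⟩ : (borel K p n).even) = H fun i => A i i := by
    refine Subtype.ext ?_
    rw [H_coe _ hA0]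
    rfl
  have e2 : (fun i => A i i) = ∑ i, A i i • (Pi.single i 1 - Pi.single z 1 : Fin n → K) := by
    simp only [smul_sub, Finset.sum_sub_distrib, ← Finset.sum_smul, hA0, zero_smul, sub_zero]
    funext j
    simp [Finset.sum_apply, Pi.single_apply]
  rw [e1, e2, map_sum, map_sum]
  change _ = ∑ j, (c j : K) * ∑ k ∈ Finset.Iic j, A k k
  -- Interchanging the sums passes from coordinates with respect to partial traces, the weights of
  -- leading minors, to those with respect to diagonal entries.
  have e3 : ∑ j, (c j : K) * ∑ k ∈ Finset.Iic j, A k k =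
      ∑ k, A k k * ∑ j ∈ Finset.Ici k, (c j : K) := by
    simp only [Finset.mul_sum]
    rw [Finset.sum_comm' (t' := Finset.univ) (s' := fun k => Finset.Ici k)]
    · exact Finset.sum_congr rfl fun _ _ => Finset.sum_congr rfl fun _ _ => mul_comm _ _
    · simp
  rw [e3]
  refine Finset.sum_congr rfl fun k _ => ?_
  rw [hc, map_smul, map_smul, smul_eq_mul]

end Weights

end Periplectic

/-! ### Nonvanishing of the baby Verma module, its radical quotient and the Kac module -/

namespace Periplectic

section BabyVermaModule

variable {K : Type u} [Field K] {p n : ℕ} [Fact p.Prime] [CharP K p]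
  (χ : Module.Dual K (periplectic K p n).even) (hχ : VanishesOnNil χ)
  (lam : Module.Dual K (cartan K p n).even) (hlam : lam ∈ weights χ)

/-- The canonical generator of the baby Verma module. -/
def babyVermaGen : BabyVerma χ hχ lam hlam :=
  (indRel (RestrictedLieSuper.incl (borel_le_evenPart K p n) (χEven χ))
    ((Algebra.lsmul K K K).comp (Kchar χ hχ lam hlam))).mkQ (1 ⊗ₜ[K] (1 : K))

lemma exists_smul_babyVermaGen (z : BabyVerma χ hχ lam hlam) :
    ∃ u : (evenPart K p n).UChi (χEven χ), u • babyVermaGen χ hχ lam hlam = z := by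
  obtain ⟨t, rfl⟩ := Submodule.mkQ_surjective _ z
  induction t with
  | zero => exact ⟨0, by rw [zero_smul]; exact (map_zero _).symm⟩
  | tmul u m =>
    refine ⟨m • u, ?_⟩
    have : u ⊗ₜ[K] m = (m • u) • ((1 : (evenPart K p n).UChi (χEven χ)) ⊗ₜ[K] (1 : K)) := by
      rw [smul_tmul', smul_eq_mul, mul_one, smul_tmul, smul_eq_mul, mul_one]
    rw [this, map_smul]
    rfl
  | add x y hx hy =>
    obtain ⟨u, hu⟩ := hx
    obtain ⟨w, hw⟩ := hy
    exact ⟨u + w, by rw [add_smul, hu, hw, map_add]; rfl⟩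

lemma borel_odd_eq_zero (y : (borel K p n).odd) : y = 0 := by
  obtain ⟨_, B, hB, rfl⟩ := y
  have hB' : B = 0 := hB
  subst hB'
  exact Subtype.ext (map_zero _)

lemma Kchar_ιEven (x : (borel K p n).even) :
    Kchar χ hχ lam hlam ((borel K p n).ιEven (χBorel χ) x) = lam (toCartan x) :=
  RestrictedLieSuper.liftUChi_ιEven _ _ _ _ _ _ _ _ _

lemma borel_smul_babyVermaGen (x : (borel K p n).even) :
    (evenPart K p n).ιEven (χEven χ) (Submodule.inclusion (borel_le_evenPart K p n).1 x) •
      babyVermaGen χ hχ lam hlam = lam (toCartan x) • babyVermaGen χ hχ lam hlam := by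
  have h := smul_ind_mk_one (RestrictedLieSuper.incl (borel_le_evenPart K p n) (χEven χ))
    ((Algebra.lsmul K K K).comp (Kchar χ hχ lam hlam)) ((borel K p n).ιEven (χBorel χ) x) (1 : K)
  rw [RestrictedLieSuper.incl_ιEven] at h
  refine h.trans ?_
  rw [AlgHom.comp_apply, Kchar_ιEven]
  have : (1 : (evenPart K p n).UChi (χEven χ)) ⊗ₜ[K]
      Algebra.lsmul K K K (lam (toCartan x)) 1 =
      lam (toCartan x) • ((1 : (evenPart K p n).UChi (χEven χ)) ⊗ₜ[K] (1 : K)) := by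
    rw [← tmul_smul]
    rfl
  rw [this]
  exact ((indRel (RestrictedLieSuper.incl (borel_le_evenPart K p n) (χEven χ))
    ((Algebra.lsmul K K K).comp (Kchar χ hχ lam hlam))).mkQ.restrictScalars K).map_smul _ _

/-- The generator maps to the nonzero weight vector in the twisted coordinate ring of the Frobenius
kernel; integrality of the weight is what allows it to be realized by a product of minors. -/
theorem babyVermaGen_ne_zero (hn : (n : K) ≠ 0) (hreg : IsRegularNilpotent χ) :
    babyVermaGen χ hχ lam hlam ≠ 0 := by
  obtain ⟨c, hc⟩ := exists_natCast_weight hn hχ hreg hlam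
  obtain ⟨Q, _, _, ρ, v, hv, hρ⟩ := exists_weight_evenOperatorRep p (matForm p hn χ)
    (matForm_single_of_le hn hχ hreg) c
  obtain ⟨σ, hσ⟩ := ρ.exists_lift p hn
  refine ind_mk_one_ne_zero _ _ ((borel K p n).adjoin_range_ι (χBorel χ)) σ
    (LinearMap.toSpanSingleton K Q v) ?_ (by simpa using hv)
  rintro a (⟨x, rfl⟩ | ⟨y, rfl⟩) m
  · rw [RestrictedLieSuper.incl_ιEven, AlgHom.comp_apply, Kchar_ιEven, hc]
    obtain ⟨_, A, hA, rfl⟩ := x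
    have e : Submodule.inclusion (borel_le_evenPart K p n).1 ⟨diagBlock K n A, A, hA, rfl⟩ =
        toEvenPart p hn A := Subtype.ext (toEvenPart_coe_of_trace p hn hA.1).symm
    rw [e, hσ A hA.1, LinearMap.toSpanSingleton_apply, LinearMap.toSpanSingleton_apply, map_smul,
      hρ A hA.2, smul_smul, mul_comm m]
    rfl
  · rw [borel_odd_eq_zero y, map_zero, map_zero, map_zero, map_zero, LinearMap.zero_apply,
      map_zero, LinearMap.zero_apply]

/-- The image of the canonical generator in the simple quotient. -/
def simpleEvenGen : SimpleEven χ hχ lam hlam :=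
  Submodule.Quotient.mk (babyVermaGen χ hχ lam hlam)

lemma exists_smul_simpleEvenGen (l : SimpleEven χ hχ lam hlam) :
    ∃ u : (evenPart K p n).UChi (χEven χ), u • simpleEvenGen χ hχ lam hlam = l := by
  obtain ⟨z, rfl⟩ := Submodule.Quotient.mk_surjective _ l
  obtain ⟨u, rfl⟩ := exists_smul_babyVermaGen χ hχ lam hlam z
  exact ⟨u, rfl⟩

/-- A nonzero cyclic module has a maximal submodule, so its radical is proper and cannot contain the
generator. -/
theorem simpleEvenGen_ne_zero (hn : (n : K) ≠ 0) (hreg : IsRegularNilpotent χ) :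
    simpleEvenGen χ hχ lam hlam ≠ 0 := by
  have hne := babyVermaGen_ne_zero χ hχ lam hlam hn hreg
  have : Nontrivial (BabyVerma χ hχ lam hlam) := ⟨_, _, hne⟩
  have span : Submodule.span ((evenPart K p n).UChi (χEven χ))
      {babyVermaGen χ hχ lam hlam} = ⊤ := by
    rw [eq_top_iff]
    intro z _
    rw [Submodule.mem_span_singleton]
    exact exists_smul_babyVermaGen χ hχ lam hlam z
  have : Module.Finite ((evenPart K p n).UChi (χEven χ)) (BabyVerma χ hχ lam hlam) :=
    ⟨⟨{babyVermaGen χ hχ lam hlam}, by rw [Finset.coe_singleton, span]⟩⟩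
  have hlt := Module.jacobson_lt_top ((evenPart K p n).UChi (χEven χ)) (BabyVerma χ hχ lam hlam)
  intro h0
  rw [simpleEvenGen, Submodule.Quotient.mk_eq_zero] at h0
  refine hlt.not_ge ?_
  rw [← span, Submodule.span_le, Set.singleton_subset_iff]
  exact h0

end BabyVermaModule

section Kac

variable {K : Type u} [Field K] {p n : ℕ} [Fact p.Prime] [CharP K p]
  (χ : Module.Dual K (periplectic K p n).even) (hχ : VanishesOnNil χ)
  (lam : Module.Dual K (cartan K p n).even) (hlam : lam ∈ weights χ)

instance : Module K (KacModule χ hχ lam hlam) := inferInstanceAs (Module K (Ind _ _))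

instance : IsScalarTower K ((periplectic K p n).UChi χ) (KacModule χ hχ lam hlam) :=
  inferInstanceAs (IsScalarTower K _ (Ind _ _))

/-- The embedding of `L⁰_χ(λ)` in the Kac module. -/
def kacOne : SimpleEven χ hχ lam hlam →ₗ[K] KacModule χ hχ lam hlam :=
  ((indRel (RestrictedLieSuper.incl (parabolic_le_periplectic K p n) χ)
    (parRep χ hχ lam hlam)).mkQ.restrictScalars K) ∘ₗ
    TensorProduct.mk K ((periplectic K p n).UChi χ) (SimpleEven χ hχ lam hlam) 1

lemma parToEven_ιEven (x : (parabolic K p n).even) :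
    parToEven χ ((parabolic K p n).ιEven (χPar χ) x) =
      (evenPart K p n).ιEven (χEven χ) (Submodule.inclusion parabolic_even_le x) :=
  RestrictedLieSuper.liftUChi_ιEven _ _ _ _ _ _ _ _ _

lemma parToEven_ιOdd (y : (parabolic K p n).odd) :
    parToEven χ ((parabolic K p n).ιOdd (χPar χ) y) = 0 :=
  RestrictedLieSuper.liftUChi_ιOdd _ _ _ _ _ _ _ _ _

lemma ιEven_smul_kacOne (x : (evenPart K p n).even) (l : SimpleEven χ hχ lam hlam) :
    (periplectic K p n).ιEven χ (Submodule.inclusion (evenPart_le_periplectic K p n).1 x) •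
      kacOne χ hχ lam hlam l = kacOne χ hχ lam hlam ((evenPart K p n).ιEven (χEven χ) x • l) := by
  have h := smul_ind_mk_one (RestrictedLieSuper.incl (parabolic_le_periplectic K p n) χ)
    (parRep χ hχ lam hlam) ((parabolic K p n).ιEven (χPar χ)
      (Submodule.inclusion (evenPart_le_parabolic K p n).1 x)) l
  rw [RestrictedLieSuper.incl_ιEven, parRep, AlgHom.comp_apply, parToEven_ιEven] at h
  exact h

lemma ιOdd_smul_kacOne (y : (parabolic K p n).odd) (l : SimpleEven χ hχ lam hlam) :
    (periplectic K p n).ιOdd χ (Submodule.inclusion (parabolic_le_periplectic K p n).2 y) •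
      kacOne χ hχ lam hlam l = 0 := by
  have h := smul_ind_mk_one (RestrictedLieSuper.incl (parabolic_le_periplectic K p n) χ)
    (parRep χ hχ lam hlam) ((parabolic K p n).ιOdd (χPar χ) y) l
  rw [RestrictedLieSuper.incl_ιOdd, parRep, AlgHom.comp_apply, parToEven_ιOdd, map_zero,
    LinearMap.zero_apply, tmul_zero, map_zero] at h
  exact h

lemma toOddUpper_smul_kacOne (M : Matrix (Fin n) (Fin n) K) (l : SimpleEven χ hχ lam hlam) :
    (periplectic K p n).ιOdd χ (toOddUpper p M) • kacOne χ hχ lam hlam l = 0 :=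
  ιOdd_smul_kacOne χ hχ lam hlam ⟨(toOddUpper p M).1, (M + Mᵀ, 0),
    ⟨by simp [add_comm], rfl⟩, rfl⟩ l

/-- The vector has the nonzero image 1 ⊗ l in the exterior algebra model, where the upper odd part
also kills 1 ⊗ E. -/
theorem kacOne_ne_zero (hp : Odd p) (hn : (n : K) ≠ 0) (h2 : (2 : K) ≠ 0)
    {l : SimpleEven χ hχ lam hlam} (hl : l ≠ 0) : kacOne χ hχ lam hlam l ≠ 0 := by
  obtain ⟨R, hRa, hRb⟩ := exists_exterior_operatorRep hp ((evenUniversalRep p hn χ).map p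
    (Algebra.lsmul K K (SimpleEven χ hχ lam hlam)))
  obtain ⟨σ, hσa, hσb⟩ := R.exists_lift p hn h2
  refine ind_mk_one_ne_zero _ _ ((parabolic K p n).adjoin_range_ι (χPar χ)) σ extOne ?_
    (fun h => hl (extOne_injective (h.trans (map_zero extOne).symm)))
  rintro a (⟨x, rfl⟩ | ⟨y, rfl⟩) m
  · rw [RestrictedLieSuper.incl_ιEven, parRep, AlgHom.comp_apply, parToEven_ιEven]
    obtain ⟨A, hA, hx⟩ := exists_toEven p hn
      (Submodule.inclusion (parabolic_le_periplectic K p n).1 x)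
    have hx' : Submodule.inclusion parabolic_even_le x = toEvenPart p hn A :=
      Subtype.ext (congrArg Subtype.val hx).symm
    rw [← hx, hσa A hA, hRa, hx']
    rfl
  · rw [RestrictedLieSuper.incl_ιOdd, parRep, AlgHom.comp_apply, parToEven_ιOdd, map_zero,
      LinearMap.zero_apply, map_zero]
    obtain ⟨_, ⟨B, C⟩, ⟨hB, hC⟩, rfl⟩ := y
    have hB' : Bᵀ = B := hB
    have hC' : C = 0 := hC
    subst hC'
    have e : Submodule.inclusion (parabolic_le_periplectic K p n).2
        ⟨offBlock K n (B, 0), (B, 0), ⟨hB, hC⟩, rfl⟩ = toOddUpper p ((2 : K)⁻¹ • B) := by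
      refine Subtype.ext ?_
      change offBlock K n (B, 0) = _
      rw [toOddUpper_coe, transpose_smul, hB', ← add_smul, ← two_mul, mul_inv_cancel₀ h2, one_smul]
    rw [e, hσb, hRb]

/-- A subspace stable under `𝔭(n)` that contains the highest weight vector is everything. -/
theorem eq_top_of_kacOne_mem (hn : (n : K) ≠ 0) (h2 : (2 : K) ≠ 0)
    {T : Submodule K (KacModule χ hχ lam hlam)}
    (hT : kacOne χ hχ lam hlam (simpleEvenGen χ hχ lam hlam) ∈ T)
    (ha : ∀ A : Matrix (Fin n) (Fin n) K, A.trace = 0 → ∀ w ∈ T,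
      (periplectic K p n).ιEven χ (toEven p hn A) • w ∈ T)
    (hb : ∀ M, ∀ w ∈ T, (periplectic K p n).ιOdd χ (toOddUpper p M) • w ∈ T)
    (hc : ∀ M, ∀ w ∈ T, (periplectic K p n).ιOdd χ (toOddLower p M) • w ∈ T) : T = ⊤ := by
  have hU : ∀ (u : (periplectic K p n).UChi χ), ∀ w ∈ T, u • w ∈ T := by
    intro u w hw
    refine smul_mem_of_adjoin_eq_top ((periplectic K p n).adjoin_range_ι χ) ?_ u hw
    rintro _ (⟨x, rfl⟩ | ⟨y, rfl⟩) m hm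
    · obtain ⟨A, hA, rfl⟩ := exists_toEven p hn x
      exact ha A hA m hm
    · obtain ⟨M, M', rfl⟩ := exists_toOdd p h2 y
      rw [map_add, add_smul]
      exact add_mem (hb M m hm) (hc M' m hm)
  have hL : ∀ l, kacOne χ hχ lam hlam l ∈ T := by
    intro l
    obtain ⟨u, rfl⟩ := exists_smul_simpleEvenGen χ hχ lam hlam l
    refine smul_mem_of_adjoin_eq_top (T := T.comap (kacOne χ hχ lam hlam))
      ((evenPart K p n).adjoin_range_ι (χEven χ)) ?_ u hT
    rintro _ (⟨x, rfl⟩ | ⟨y, rfl⟩) m hm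
    · rw [Submodule.mem_comap, ← ιEven_smul_kacOne]
      exact hU _ _ hm
    · have hy : y = 0 := borel_odd_eq_zero y
      rw [hy, map_zero, zero_smul]
      exact zero_mem _
  rw [eq_top_iff]
  rintro w -
  obtain ⟨t, rfl⟩ := Submodule.mkQ_surjective _ w
  induction t with
  | zero => rw [map_zero]; exact zero_mem _
  | add x y hx hy => rw [map_add]; exact add_mem hx hy
  | tmul u l =>
    have : u ⊗ₜ[K] l = u • ((1 : (periplectic K p n).UChi χ) ⊗ₜ[K] l) := by
      rw [smul_tmul', smul_eq_mul, mul_one]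
    rw [this, map_smul]
    exact hU u _ (hL l)

end Kac

end Periplectic

/-! ### The two dimension estimates for the Kac module and irreducibility -/

namespace Periplectic

section Simplicity

variable {K : Type u} [Field K] {p n : ℕ} [Fact p.Prime] [CharP K p]
  (χ : Module.Dual K (periplectic K p n).even) (hχ : VanishesOnNil χ)
  (lam : Module.Dual K (cartan K p n).even) (hlam : lam ∈ weights χ)

/-- The action of the generators of `U_χ(𝔭(n))` on the Kac module. -/
def kacRep (hn : (n : K) ≠ 0) :
    OperatorRep p (matForm p hn χ) (Module.End K (KacModule χ hχ lam hlam)) :=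
  (universalRep p hn χ).map (Algebra.lsmul K K (KacModule χ hχ lam hlam))

lemma kacRep_a (hn : (n : K) ≠ 0) (A : Matrix (Fin n) (Fin n) K) (w : KacModule χ hχ lam hlam) :
    (kacRep χ hχ lam hlam hn).a A w = (periplectic K p n).ιEven χ (toEven p hn A) • w := rfl

lemma kacRep_b (hn : (n : K) ≠ 0) (M : Matrix (Fin n) (Fin n) K) (w : KacModule χ hχ lam hlam) :
    (kacRep χ hχ lam hlam hn).b M w = (periplectic K p n).ιOdd χ (toOddUpper p M) • w := rfl

/-- The Kac module is spanned by `(2p) ^ N` vectors, where `N` is the number of positive roots. -/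
theorem exists_span_kacModule (hn : (n : K) ≠ 0) (h2 : (2 : K) ≠ 0) :
    ∃ t : Finset (KacModule χ hχ lam hlam), t.card ≤ (2 * p) ^ (OperatorRep.lowerPairs n).card ∧
      Submodule.span K (t : Set (KacModule χ hχ lam hlam)) = ⊤ := by
  refine (kacRep χ hχ lam hlam hn).exists_span_of_highestWeight h2
    (kacOne χ hχ lam hlam (simpleEvenGen χ hχ lam hlam)) ?_ ?_ ?_
  · intro A hA hA'
    let x : (borel K p n).even := ⟨diagBlock K n A, A, ⟨hA, hA'⟩, rfl⟩
    have hx : toEven p hn A = Submodule.inclusion (evenPart_le_periplectic K p n).1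
        (Submodule.inclusion (borel_le_evenPart K p n).1 x) :=
      Subtype.ext (toEven_coe_of_trace p hn hA)
    refine ⟨lam (toCartan x), ?_⟩
    rw [kacRep_a, hx, ιEven_smul_kacOne, ← map_smul]
    congr 1
    exact congrArg Submodule.Quotient.mk (borel_smul_babyVermaGen χ hχ lam hlam x)
  · intro M
    rw [kacRep_b, toOddUpper_smul_kacOne]
  · intro T hT ha hb hc
    exact eq_top_of_kacOne_mem χ hχ lam hlam hn h2 hT ha hb hc

/-- A nonzero subspace of the Kac module that is stable under `𝔭(n)` has dimension at least
`(2p) ^ N`, where `N` is the number of positive roots. -/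
theorem pow_card_lowerPairs_le_finrank (hn : (n : K) ≠ 0) (h2 : (2 : K) ≠ 0)
    (hreg : IsRegularNilpotent χ) [FiniteDimensional K (KacModule χ hχ lam hlam)]
    {N : Submodule K (KacModule χ hχ lam hlam)} (hN : N ≠ ⊥)
    (ha : ∀ A : Matrix (Fin n) (Fin n) K, A.trace = 0 → ∀ w ∈ N,
      (kacRep χ hχ lam hlam hn).a A w ∈ N)
    (hb : ∀ M, ∀ w ∈ N, (kacRep χ hχ lam hlam hn).b M w ∈ N)
    (hc : ∀ M, ∀ w ∈ N, (kacRep χ hχ lam hlam hn).c M w ∈ N) :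
    (2 * p) ^ (OperatorRep.lowerPairs n).card ≤ Module.finrank K N := by
  -- The first conjugation makes χ vanish on the Borel subalgebra, the second brings it to normal
  -- form below the diagonal. Conjugating the operators by GL(n) does not affect which subspaces are
  -- invariant.
  obtain ⟨g, hg, hg'⟩ := exists_conj_of_isRegularNilpotent hn hreg
  obtain ⟨g₂, hg₂⟩ := exists_conj_subdiagonal
    (matForm p hn χ ∘ₗ LinearMap.mulLeft K g.1 ∘ₗ LinearMap.mulRight K g⁻¹.1)
    (fun i j hij => hg _ (single_upper hij)) hg'
  have tr : ∀ (g : GL (Fin n) K) (A : Matrix (Fin n) (Fin n) K), A.trace = 0 →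
      (g.1 * (A * g⁻¹.1)).trace = 0 := by
    intro g A hA
    rw [trace_mul_comm, mul_assoc, ← Units.val_mul, inv_mul_cancel, Units.val_one, mul_one, hA]
  rw [← OperatorRep.prod_eq_pow_card_lowerPairs]
  refine (((kacRep χ hχ lam hlam hn).conj g).conj g₂).prod_le_finrank h2 hn ?_ ?_ hN
    (fun A hA w hw => ha _ (tr g _ (tr g₂ A hA)) w hw) (fun M w hw => hb _ w hw)
    (fun M w hw => hc _ w hw)
  · intro k i hki
    have := hg₂ k i (Fin.lt_def.2 (by omega))
    rw [if_pos hki] at this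
    exact fun h => one_ne_zero (this.symm.trans h)
  · intro k i hki
    have := hg₂ k i (Fin.lt_def.2 (by omega))
    rwa [if_neg (by omega)] at this

end Simplicity

end Periplectic

theorem mainTheorem2 {K : Type*} [Field K] [IsAlgClosed K] (p n : ℕ) [Fact p.Prime] [CharP K p]
    (hn : 2 < n) (hp : n + 1 ≤ p)
    (χ : Module.Dual K (Periplectic.periplectic K p n).even) (hχ : Periplectic.VanishesOnNil χ)
    (hreg : Periplectic.IsRegularNilpotent χ)
    (lam : Module.Dual K (Periplectic.cartan K p n).even) (hlam : lam ∈ Periplectic.weights χ) :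
    IsSimpleModule (Periplectic.periplectic K p n).U (Periplectic.KacModule χ hχ lam hlam) := by
  -- The bound on `p` makes `n` invertible, so that scalar matrices split off from the traceless
  -- ones; with n > 2 it also makes 2 invertible and `p` odd.
  have natCast_ne_zero : ∀ m : ℕ, 0 < m → m < p → (m : K) ≠ 0 := fun m h h' => by
    rw [Ne, CharP.cast_eq_zero_iff K p]
    exact Nat.not_dvd_of_pos_of_lt h h'
  have hn' : (n : K) ≠ 0 := natCast_ne_zero n (by omega) (by omega)
  have h2 : (2 : K) ≠ 0 := by exact_mod_cast natCast_ne_zero 2 (by omega) (by omega)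
  have hodd : Odd p := (Fact.out : p.Prime).odd_of_ne_two (by omega)
  obtain ⟨t, ht, hspan⟩ := Periplectic.exists_span_kacModule χ hχ lam hlam hn' h2
  have : FiniteDimensional K (Periplectic.KacModule χ hχ lam hlam) := ⟨⟨t, hspan⟩⟩
  have hdim : Module.finrank K (Periplectic.KacModule χ hχ lam hlam) ≤
      (2 * p) ^ (Periplectic.OperatorRep.lowerPairs n).card := by
    rw [← finrank_top, ← hspan]
    exact (finrank_span_finset_le_card t).trans ht
  have hne := Periplectic.kacOne_ne_zero χ hχ lam hlam hodd hn' h2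
    (Periplectic.simpleEvenGen_ne_zero χ hχ lam hlam hn' hreg)
  have : Nontrivial (Periplectic.KacModule χ hχ lam hlam) := ⟨_, _, hne⟩
  refine (isSimpleModule_iff _ _).2 { eq_bot_or_eq_top := fun N => ?_ }
  by_cases hN : N = ⊥
  · exact Or.inl hN
  let N' : Submodule K (Periplectic.KacModule χ hχ lam hlam) :=
    { carrier := N
      add_mem' := N.add_mem
      zero_mem' := N.zero_mem
      smul_mem' := fun r w hw => by
        have := N.smul_mem (algebraMap K (Periplectic.periplectic K p n).U r) hw
        have e : algebraMap K (Periplectic.periplectic K p n).U r • w = r • w := by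
          change (Periplectic.periplectic K p n).toUChi χ (algebraMap K _ r) • w = _
          rw [AlgHom.commutes, algebraMap_smul]
        rwa [e] at this }
  have hN' : N' ≠ ⊥ := by
    intro h
    refine hN ((Submodule.eq_bot_iff _).2 fun w hw => ?_)
    exact (Submodule.eq_bot_iff _).1 h w hw
  have hle := Periplectic.pow_card_lowerPairs_le_finrank χ hχ lam hlam hn' h2 hreg hN'
    (fun A _ w hw => N.smul_mem ((Periplectic.periplectic K p n).toU
      ((Periplectic.periplectic K p n).tEven (Periplectic.toEven p hn' A))) hw)
    (fun M w hw => N.smul_mem ((Periplectic.periplectic K p n).toU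
      ((Periplectic.periplectic K p n).tOdd (Periplectic.toOddUpper p M))) hw)
    (fun M w hw => N.smul_mem ((Periplectic.periplectic K p n).toU
      ((Periplectic.periplectic K p n).tOdd (Periplectic.toOddLower p M))) hw)
  -- The lower bound for `N'` meets the upper bound for the whole module.
  have htop : N' = ⊤ :=
    Submodule.eq_top_of_finrank_eq (le_antisymm (Submodule.finrank_le _) (hdim.trans hle))
  refine Or.inr (eq_top_iff.2 fun w _ => ?_)
  have : w ∈ N' := by rw [htop]; trivial
  exact this
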